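/- Let $k$ be a field, $n\ge 2$ an integer, $p_1,\dots,p_n,q_1,\dots,q_n\in k^\times$ such that $p_iq_i^{-1}$ is not a root of unity for any $i$, and let $\Gamma=(\gamma_{ij})\in M_n(k^\times)$ be multiplicatively antisymmetric, i.e. $\gamma_{ii}=1$ and $\gamma_{ij}\gamma_{ji}=1$ for all $i,j$. Let $K_n=K_{n,\Gamma}^{P,Q}(k)$ be the Horton algebra: the $k$-algebra with generators $x_1,\dots,x_n,y_1,\dots,y_n$ and relations \begin{align*} y_iy_j&=\gamma_{ij}\,y_jy_i && \text{for all } i,j,\\ x_iy_j&=p_j\gamma_{ji}\,y_jx_i && (i<j),\\ x_iy_j&=q_j\gamma_{ji}\,y_jx_i && (i>j),\\ x_ix_j&=q_ip_j^{-1}\gamma_{ij}\,x_jx_i && (i<j),\\ x_iy_i&=q_iy_ix_i+\sum_{l<i}(q_l-p_l)\,y_lx_l && \text{for all } i. \end{align*} Let the torus $H=(k^\times)^{n+1}$ act on $K_n$ by $k$-algebra automorphisms, where $h=(a_1,\dots,a_n,c)$ acts by $h\cdot x_i=a_ix_i$ and $h\cdot y_i=c\,a_i^{-1}y_i$ for $1\le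 i\le n$, and let $\operatorname{Spec}_H K_n$ be the set of $H$-stable prime (two-sided) ideals of $K_n$, partially ordered by inclusion. Let $W$ be the Weyl group of type $D_{n+1}$, regarded as a Coxeter group with generators $s_0,s_1,\dots,s_n$ labelled so that the edges of the Dynkin diagram are $s_0 - s_2$ and $s_i - s_{i+1}$ for $1\le i\le n-1$; thus $s_0$ and $s_1$ commute and are both joined to $s_2$. Put $w_n=s_n\cdots s_2s_1s_0s_2\cdots s_n\in W$. Then $\operatorname{Spec}_H K_n$ is isomorphic, as a partially ordered set, to the Bruhat order interval $[1,w_n]=\{w\in W: w\le w_n\}$ of $W$. -/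

import Mathlib

/-! ### The Bruhat order of a Coxeter group -/

namespace CoxeterSystem

variable {B W : Type*} [Group W] {M : CoxeterMatrix B}

/-- One step `u < u t` of the Bruhat order: `t` is a reflection (a conjugate of a generator) and
the length goes up. -/
def BruhatStep (cs : CoxeterSystem M W) (u v : W) : Prop :=
  ∃ t : W, cs.IsReflection t ∧ v = u * t ∧ cs.length u < cs.length v

/-- The Bruhat order `u ≤ v`: the reflexive and transitive closure of the relation `u < u t`. -/
def BruhatLE (cs : CoxeterSystem M W) : W → W → Prop :=
  Relation.ReflTransGen cs.BruhatStep

theorem BruhatLE.eq_or_length_lt {cs : CoxeterSystem M W} {u v : W} (h : cs.BruhatLE u v) :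
    u = v ∨ cs.length u < cs.length v := by
  induction h with
  | refl => exact Or.inl rfl
  | tail _ hstep ih =>
    obtain ⟨t, _, _, hlt⟩ := hstep
    rcases ih with rfl | ih
    · exact Or.inr hlt
    · exact Or.inr (ih.trans hlt)

/-- The Coxeter group `W`, regarded as a set ordered by the Bruhat order. -/
def BruhatPoset (_cs : CoxeterSystem M W) : Type _ := W

/-- An element of `W`, regarded as an element of the Bruhat poset. -/
def toBruhat (cs : CoxeterSystem M W) (w : W) : cs.BruhatPoset := w

/-- An element of the Bruhat poset, regarded as an element of `W`. -/
def ofBruhat (cs : CoxeterSystem M W) (w : cs.BruhatPoset) : W := w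

instance (cs : CoxeterSystem M W) : PartialOrder cs.BruhatPoset where
  le u v := cs.BruhatLE (cs.ofBruhat u) (cs.ofBruhat v)
  le_refl _ := Relation.ReflTransGen.refl
  le_trans _ _ _ := Relation.ReflTransGen.trans
  le_antisymm u v h₁ h₂ := by
    rcases h₁.eq_or_length_lt with h | h
    · exact h
    · rcases h₂.eq_or_length_lt with h' | h'
      · exact h'.symm
      · exact absurd (h.trans h') (lt_irrefl _)

/-- The Bruhat order interval `[1, w]`. -/
abbrev bruhatInterval (cs : CoxeterSystem M W) (w : W) : Set cs.BruhatPoset :=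
  Set.Icc (cs.toBruhat 1) (cs.toBruhat w)

end CoxeterSystem

/-! ### The Weyl group of type `D` -/

/-- The Coxeter matrix of type `D_{n+1}` on the nodes `0, 1, …, n`. The edges of the Dynkin diagram
are `0 — 2`, `1 — 2`, `2 — 3`, …, `(n-1) — n`, so that `0` and `1` are the two nodes of the fork. -/
def typeD (n : ℕ) : CoxeterMatrix (Fin (n + 1)) where
  M := Matrix.of fun i j : Fin (n + 1) ↦
    if i = j then 1
    else if ((i : ℕ) = 0 ∧ (j : ℕ) = 2) ∨ ((j : ℕ) = 0 ∧ (i : ℕ) = 2) ∨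
        ((i : ℕ) ≠ 0 ∧ (i : ℕ) + 1 = j) ∨ ((j : ℕ) ≠ 0 ∧ (j : ℕ) + 1 = i) then 3
    else 2
  isSymm := by
    ext i j
    simp only [Matrix.transpose_apply, Matrix.of_apply]
    split_ifs <;> first | rfl | (exfalso; grind)
  diagonal := by simp
  off_diagonal := by
    intro i j h
    simp only [Matrix.of_apply, if_neg h]
    split_ifs <;> decide

/-- The word `s_n ⋯ s_2 s_1 s_0 s_2 ⋯ s_n`, as the list `n, …, 2, 1, 0, 2, …, n` of indices. -/
def hortonWord (n : ℕ) : List (Fin (n + 1)) :=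
  (List.finRange (n + 1)).reverse ++ (List.finRange (n + 1)).drop 2

/-! ### Invariant prime spectra of noncommutative algebras -/

/-- A two-sided ideal `P` of a (noncommutative) ring is prime if it is proper and, for all
two-sided ideals `I` and `J`, `I J ⊆ P` implies `I ⊆ P` or `J ⊆ P`. -/
def TwoSidedIdeal.IsPrimeIdeal {A : Type*} [Ring A] (P : TwoSidedIdeal A) : Prop :=
  P ≠ ⊤ ∧ ∀ I J : TwoSidedIdeal A, (∀ a ∈ I, ∀ b ∈ J, a * b ∈ P) → I ≤ P ∨ J ≤ P

/-- The invariant prime spectrum `Spec_H A` of a `k`-algebra `A` on which the group `H` acts by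
algebra automorphisms through `φ`: the `H`-stable prime ideals of `A`, ordered by inclusion. -/
def InvariantPrimeSpectrum {k A H : Type*} [CommRing k] [Ring A] [Algebra k A] [Group H]
    (φ : H →* (A ≃ₐ[k] A)) : Type _ :=
  {P : TwoSidedIdeal A // P.IsPrimeIdeal ∧ ∀ h : H, ∀ a ∈ P, φ h a ∈ P}

instance {k A H : Type*} [CommRing k] [Ring A] [Algebra k A] [Group H]
    (φ : H →* (A ≃ₐ[k] A)) : PartialOrder (InvariantPrimeSpectrum φ) :=
  inferInstanceAs (PartialOrder
    {P : TwoSidedIdeal A // P.IsPrimeIdeal ∧ ∀ h : H, ∀ a ∈ P, φ h a ∈ P})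

/-! ### The Horton algebra and its torus action -/

/-- The generators `x_1, …, x_n, y_1, …, y_n`, indexed by `Fin n`. -/
inductive HortonGen (n : ℕ) : Type
  | x (i : Fin n) : HortonGen n
  | y (i : Fin n) : HortonGen n

/-- The generator `x_i` of the free algebra. -/
abbrev freeX (k : Type*) [Field k] {n : ℕ} (i : Fin n) : FreeAlgebra k (HortonGen n) :=
  FreeAlgebra.ι k (HortonGen.x i)

/-- The generator `y_i` of the free algebra. -/
abbrev freeY (k : Type*) [Field k] {n : ℕ} (i : Fin n) : FreeAlgebra k (HortonGen n) :=
  FreeAlgebra.ι k (HortonGen.y i)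

/-- The defining relations of the Horton algebra. -/
inductive HortonRel {k : Type*} [Field k] {n : ℕ} (p q : Fin n → kˣ) (γ : Fin n → Fin n → kˣ) :
    FreeAlgebra k (HortonGen n) → FreeAlgebra k (HortonGen n) → Prop
  | yy (i j : Fin n) : HortonRel p q γ (freeY k i * freeY k j)
      ((γ i j : k) • (freeY k j * freeY k i))
  | xy_lt (i j : Fin n) (h : i < j) : HortonRel p q γ (freeX k i * freeY k j)
      ((p j * γ j i : k) • (freeY k j * freeX k i))
  | xy_gt (i j : Fin n) (h : j < i) : HortonRel p q γ (freeX k i * freeY k j)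
      ((q j * γ j i : k) • (freeY k j * freeX k i))
  | xx (i j : Fin n) (h : i < j) : HortonRel p q γ (freeX k i * freeX k j)
      ((q i * (p j : k)⁻¹ * γ i j : k) • (freeX k j * freeX k i))
  | xy_eq (i : Fin n) : HortonRel p q γ (freeX k i * freeY k i)
      ((q i : k) • (freeY k i * freeX k i) +
        ∑ l ∈ Finset.Iio i, (q l - p l : k) • (freeY k l * freeX k l))

/-- The Horton algebra `K_n = K_{n,Γ}^{P,Q}(k)`. -/
abbrev HortonAlgebra {k : Type*} [Field k] {n : ℕ} (p q : Fin n → kˣ) (γ : Fin n → Fin n → kˣ) :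
    Type _ :=
  RingQuot (HortonRel p q γ)

namespace HortonAlgebra

variable {k : Type*} [Field k] {n : ℕ}

/-- The image of a generator in the Horton algebra. -/
noncomputable def gen (p q : Fin n → kˣ) (γ : Fin n → Fin n → kˣ) (g : HortonGen n) :
    HortonAlgebra p q γ :=
  RingQuot.mkAlgHom k (HortonRel p q γ) (FreeAlgebra.ι k g)

/-- The torus `H = (kˣ)^{n+1}`, with elements `h = (a_1, …, a_n, c)`. -/
abbrev Torus (k : Type*) [Field k] (n : ℕ) : Type _ := (Fin n → kˣ) × kˣ

/-- The scalar by which `h = (a, c)` acts on a generator: `x_i ↦ a_i x_i`, `y_i ↦ c a_i⁻¹ y_i`. -/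
def weight (h : Torus k n) : HortonGen n → kˣ
  | .x i => h.1 i
  | .y i => h.2 * (h.1 i)⁻¹

/-- The endomorphism of the Horton algebra with `x_i ↦ a_i x_i` and `y_i ↦ c a_i⁻¹ y_i`. -/
noncomputable def torusEnd (p q : Fin n → kˣ) (γ : Fin n → Fin n → kˣ) (h : Torus k n) :
    HortonAlgebra p q γ →ₐ[k] HortonAlgebra p q γ :=
  RingQuot.liftAlgHom k ⟨FreeAlgebra.lift k fun g ↦ (weight h g : k) • gen p q γ g, by
    have key : ∀ {a b}, HortonRel p q γ a b →
        RingQuot.mkAlgHom k (HortonRel p q γ) a = RingQuot.mkAlgHom k (HortonRel p q γ) b :=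
      fun r ↦ RingQuot.mkAlgHom_rel k r
    intro a b r
    cases r with
    | yy i j =>
      have := key (.yy (p := p) (q := q) (γ := γ) i j)
      simp only [map_mul, map_smul] at this
      simp only [map_mul, map_smul, FreeAlgebra.lift_ι_apply, gen, smul_mul_smul_comm, this,
        smul_smul]
      congr 1; ring
    | xy_lt i j hij =>
      have := key (.xy_lt (p := p) (q := q) (γ := γ) i j hij)
      simp only [map_mul, map_smul] at this
      simp only [map_mul, map_smul, FreeAlgebra.lift_ι_apply, gen, smul_mul_smul_comm, this,
        smul_smul]
      congr 1; ring
    | xy_gt i j hij =>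
      have := key (.xy_gt (p := p) (q := q) (γ := γ) i j hij)
      simp only [map_mul, map_smul] at this
      simp only [map_mul, map_smul, FreeAlgebra.lift_ι_apply, gen, smul_mul_smul_comm, this,
        smul_smul]
      congr 1; ring
    | xx i j hij =>
      have := key (.xx (p := p) (q := q) (γ := γ) i j hij)
      simp only [map_mul, map_smul] at this
      simp only [map_mul, map_smul, FreeAlgebra.lift_ι_apply, gen, smul_mul_smul_comm, this,
        smul_smul]
      congr 1; ring
    | xy_eq i =>
      have hw : ∀ l : Fin n, (weight h (.y l) : k) * weight h (.x l) = h.2 := by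
        intro l; simp [weight]
      have hw' : ∀ l : Fin n, (weight h (.x l) : k) * weight h (.y l) = h.2 := by
        intro l; rw [mul_comm, hw]
      have := key (.xy_eq (p := p) (q := q) (γ := γ) i)
      simp only [map_mul, map_smul, map_add, map_sum] at this
      simp only [map_mul, map_smul, map_add, map_sum, FreeAlgebra.lift_ι_apply, gen,
        smul_mul_smul_comm, hw, hw', this, smul_add, Finset.smul_sum]
      congr 1
      · exact smul_comm _ _ _
      · exact Finset.sum_congr rfl fun l _ ↦ smul_comm _ _ _⟩

@[simp]
theorem torusEnd_gen (p q : Fin n → kˣ) (γ : Fin n → Fin n → kˣ) (h : Torus k n)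
    (g : HortonGen n) : torusEnd p q γ h (gen p q γ g) = (weight h g : k) • gen p q γ g := by
  simp only [torusEnd, gen, RingQuot.liftAlgHom_mkAlgHom_apply, FreeAlgebra.lift_ι_apply]

theorem algHom_ext {p q : Fin n → kˣ} {γ : Fin n → Fin n → kˣ} {A : Type*} [Semiring A]
    [Algebra k A] {f g : HortonAlgebra p q γ →ₐ[k] A}
    (h : ∀ s, f (gen p q γ s) = g (gen p q γ s)) : f = g :=
  RingQuot.ringQuot_ext' k f g (FreeAlgebra.hom_ext (funext h))

theorem torusEnd_one (p q : Fin n → kˣ) (γ : Fin n → Fin n → kˣ) :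
    torusEnd p q γ 1 = AlgHom.id k _ := by
  refine algHom_ext fun s ↦ ?_
  cases s <;> simp [weight]

theorem torusEnd_mul (p q : Fin n → kˣ) (γ : Fin n → Fin n → kˣ) (h h' : Torus k n) :
    torusEnd p q γ (h * h') = (torusEnd p q γ h).comp (torusEnd p q γ h') := by
  refine algHom_ext fun s ↦ ?_
  rw [AlgHom.comp_apply, torusEnd_gen, torusEnd_gen, map_smul, torusEnd_gen, smul_smul]
  congr 1
  cases s <;> simp [weight] <;> ring

/-- The action of the torus `H = (kˣ)^{n+1}` on the Horton algebra by algebra automorphisms: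
`(a, c)` sends `x_i` to `a_i x_i` and `y_i` to `c a_i⁻¹ y_i`. -/
noncomputable def torusAction (p q : Fin n → kˣ) (γ : Fin n → Fin n → kˣ) :
    Torus k n →* (HortonAlgebra p q γ ≃ₐ[k] HortonAlgebra p q γ) where
  toFun h := AlgEquiv.ofAlgHom (torusEnd p q γ h) (torusEnd p q γ h⁻¹)
    (by rw [← torusEnd_mul, mul_inv_cancel, torusEnd_one])
    (by rw [← torusEnd_mul, inv_mul_cancel, torusEnd_one])
  map_one' := by
    ext a
    simp [torusEnd_one]
  map_mul' h h' := by
    ext a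
    simp [torusEnd_mul]

end HortonAlgebra

/-! Number the levels from 0 and let Ω_m = ∑_{l<m} (q_l - p_l) y_l x_l. Every Ω_m commutes with all
generators up to scalars, and x_i y_i = q_i y_i x_i + Ω_i = p_i y_i x_i + Ω_{i+1}. Both sides of the
isomorphism are encoded by the same lists of n level types, compared levelwise.

Algebra. An invariant prime P is recorded by which of x_i, y_i, Ω_{i+1} it contains. If x_i or y_i
lies in P, so do Ω_i and Ω_{i+1}; if both Ω's lie in P, then so does y_i x_i, and y_i is normal
modulo P, so P contains x_i or y_i. Hence over Ω_i ∉ P only the types `empty` and `center` occur,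
and `center` occurs only there (`admissible_levelType`). Conversely, every admissible list is
realised by the kernel of a homomorphism to a quantum torus, which is a domain
(`exists_invariant_isPrimeIdeal`). Finally P is generated by the letters x_i, y_i, Ω_i in it
(`le_of_forall_val_mem`), so inclusion is levelwise: monomials without opposite letters x_i, y_i
span the algebra modulo those letters, and they are independent modulo P. For independence, torus
weights and commutation with some x_j or y_j shorten any relation to a single monomial; this is
where p_i/q_i not being a root of unity enters. Such a monomial is not in P by `prodVal_notMem`.

Coxeter group. The word s_n ⋯ s_2 s_1 s_0 s_2 ⋯ s_n is nested: each level adds one letter on the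
left and one on the right. By strong exchange, the elements below it are products of subwords. If a
level keeps no letter, the letters of the next level commute with everything inside: the left and
right ones become equal (`center`) and the pair cancels (`empty`). Every subword thus normalises to
an admissible list, and signed permutations show that different lists give different elements.
Deletion of a letter followed by normalisation goes down in the levelwise order and generates it,
which gives `bruhatLE_typesProd_iff`. -/

namespace CoxeterSystem

/-! ### Strong exchange through signed conjugations -/

variable {B W : Type*} [Group W] {M : CoxeterMatrix B} (cs : CoxeterSystem M W)

/-- The sign `-1` or `1` according to whether a proposition holds. -/
noncomputable def propSign (P : Prop) : ℤˣ := by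
  classical exact if P then -1 else 1

theorem propSign_mul_self (P : Prop) : propSign P * propSign P = 1 := by
  unfold propSign; split_ifs <;> simp

theorem propSign_congr {P Q : Prop} (h : P ↔ Q) : propSign P = propSign Q := by
  rw [propext h]

theorem simple_mul_mul_simple_eq_simple_iff (i : B) (w : W) :
    cs.simple i * w * cs.simple i = cs.simple i ↔ w = cs.simple i := by
  refine ⟨fun h ↦ ?_, fun h ↦ by simp [h]⟩
  have : w = cs.simple i * (cs.simple i * w * cs.simple i) * cs.simple i := by simp [mul_assoc]
  rw [this, h, simple_mul_simple_self, one_mul]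

/-- The signed conjugation by a simple reflection: `(t, ε)` goes to `(s t s, ± ε)`, with the sign
`-` exactly if `t = s`. -/
noncomputable def signedConj (i : B) : Equiv.Perm (W × ℤˣ) :=
  Function.Involutive.toPerm
    (fun a ↦ (cs.simple i * a.1 * cs.simple i, a.2 * propSign (a.1 = cs.simple i))) fun a ↦ by
      ext1
      · simp [mul_assoc]
      · simp only [propSign_congr (cs.simple_mul_mul_simple_eq_simple_iff i _)]
        rw [mul_assoc, propSign_mul_self, mul_one]

theorem signedConj_apply (i : B) (a : W × ℤˣ) : cs.signedConj i a =
    (cs.simple i * a.1 * cs.simple i, a.2 * propSign (a.1 = cs.simple i)) := rfl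

theorem simple_mul_pow_mul_simple (i j : B) (k : ℕ) :
    cs.simple j * (cs.simple i * cs.simple j) ^ k =
      ((cs.simple i * cs.simple j) ^ k)⁻¹ * cs.simple j := by
  rw [← inv_pow, mul_inv_rev, cs.inv_simple, cs.inv_simple]
  exact (SemiconjBy.pow_right (show SemiconjBy (cs.simple j) (cs.simple i * cs.simple j)
    (cs.simple j * cs.simple i) by simp [SemiconjBy, mul_assoc]) k).eq

/-- Each of the 2k conjugations contributes one sign, at the reflection (s_i s_j)^{-l} s_j of the
dihedral subgroup. For k = M i j this list runs twice through the same reflections, so all signs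
cancel; that is the braid relation. -/
theorem signedConj_mul_pow_apply (i j : B) (k : ℕ) (a : W × ℤˣ) :
    ((cs.signedConj i * cs.signedConj j) ^ k) a =
      ((cs.simple i * cs.simple j) ^ k * a.1 * ((cs.simple i * cs.simple j) ^ k)⁻¹,
        a.2 * ∏ l ∈ Finset.range (2 * k),
          propSign (a.1 = ((cs.simple i * cs.simple j) ^ l)⁻¹ * cs.simple j)) := by
  induction k with
  | zero => simp
  | succ k ih =>
    set c := cs.simple i * cs.simple j with hc
    have hcinv : c⁻¹ = cs.simple j * cs.simple i := by simp [hc]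
    have hk := cs.simple_mul_pow_mul_simple i j k
    rw [← hc] at hk
    have e1 : (c ^ k * a.1 * (c ^ k)⁻¹ = cs.simple j) ↔
        a.1 = (c ^ (2 * k))⁻¹ * cs.simple j := by
      rw [mul_inv_eq_iff_eq_mul, hk, ← eq_inv_mul_iff_mul_eq, two_mul, pow_add, mul_inv_rev,
        mul_assoc]
    have e2 : (cs.simple j * (c ^ k * a.1 * (c ^ k)⁻¹) * cs.simple j = cs.simple i) ↔
        a.1 = (c ^ (2 * k + 1))⁻¹ * cs.simple j := by
      have h2 : cs.simple j * cs.simple i * cs.simple j * c ^ k =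
          c⁻¹ * (c ^ k)⁻¹ * cs.simple j := by rw [mul_assoc _ _ (c ^ k), hk, ← hcinv, mul_assoc]
      rw [← eq_mul_inv_iff_mul_eq, cs.inv_simple, ← eq_inv_mul_iff_mul_eq, cs.inv_simple,
        mul_inv_eq_iff_eq_mul, ← mul_assoc, h2, ← eq_inv_mul_iff_mul_eq, pow_succ, two_mul, pow_add]
      have hcomm : (c ^ k)⁻¹ * c⁻¹ = c⁻¹ * (c ^ k)⁻¹ := ((Commute.refl c).pow_left k).inv_inv.eq
      simp only [mul_inv_rev, ← mul_assoc]
      rw [hcomm]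
    rw [pow_succ', Equiv.Perm.mul_apply, ih, Equiv.Perm.mul_apply, signedConj_apply,
      signedConj_apply]
    ext1
    · simp only [pow_succ', mul_inv_rev, hcinv]
      simp only [hc, mul_assoc]
    · simp only [mul_add, mul_one, Finset.prod_range_succ, propSign_congr e1, propSign_congr e2]
      rw [mul_assoc, mul_assoc, mul_assoc]

theorem isLiftable_signedConj : M.IsLiftable cs.signedConj := by
  intro i j
  ext1 a
  have hM := cs.simple_mul_simple_pow i j
  rw [signedConj_mul_pow_apply, hM, two_mul, Finset.prod_range_add]
  simp only [pow_add, hM, one_mul, ← Finset.prod_mul_distrib, propSign_mul_self]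
  simp

/-- The action of a Coxeter group on `W × {1, -1}` by signed conjugations. -/
noncomputable def signedConjHom : W →* Equiv.Perm (W × ℤˣ) :=
  cs.lift ⟨cs.signedConj, cs.isLiftable_signedConj⟩

theorem signedConjHom_simple (i : B) : cs.signedConjHom (cs.simple i) = cs.signedConj i :=
  cs.lift_apply_simple cs.isLiftable_signedConj i

/-- The sign produced depends only on the first coordinate, so it can be factored out of the
incoming sign. -/
theorem signedConjHom_apply (w : W) (a : W × ℤˣ) :
    cs.signedConjHom w a = (w * a.1 * w⁻¹, a.2 * (cs.signedConjHom w (a.1, 1)).2) := by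
  induction w using cs.simple_induction_left generalizing a with
  | one => simp
  | mul_simple_left w i ih =>
    rw [map_mul, Equiv.Perm.mul_apply, Equiv.Perm.mul_apply, ih, ih (a.1, 1),
      signedConjHom_simple, signedConj_apply, signedConj_apply]
    ext1
    · simp [mul_assoc]
    · simp [mul_assoc]

/-- A letter flips the sign exactly when the conjugate of t reaching it equals that letter, and this
puts t in the right inversion sequence. -/
theorem signedConjHom_wordProd_of_notMem (ω : List B) {t : W} (ht : t ∉ cs.rightInvSeq ω) :
    (cs.signedConjHom (cs.wordProd ω) (t, 1)).2 = 1 := by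
  induction ω with
  | nil => simp
  | cons i ω ih =>
    rw [rightInvSeq, List.mem_cons, not_or] at ht
    rw [wordProd_cons, map_mul, Equiv.Perm.mul_apply, signedConjHom_simple, signedConj_apply,
      ih ht.2, signedConjHom_apply, propSign, if_neg, mul_one]
    intro h
    apply ht.1
    simp only at h
    rw [← h]
    group

/-- For t = w s w⁻¹ the signs from w⁻¹ and from w cancel, and the middle s contributes -1. -/
theorem IsReflection.signedConjHom_apply_self {t : W} (ht : cs.IsReflection t) :
    (cs.signedConjHom t (t, 1)).2 = -1 := by
  obtain ⟨w, i, rfl⟩ := ht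
  rw [map_mul, map_mul, Equiv.Perm.mul_apply, Equiv.Perm.mul_apply]
  set t := w * cs.simple i * w⁻¹
  have h : (cs.signedConjHom w (cs.signedConjHom w⁻¹ (t, 1))).2 = 1 := by
    rw [← Equiv.Perm.mul_apply, ← map_mul]; simp
  rw [signedConjHom_apply _ w⁻¹] at h ⊢
  have h1 : w⁻¹ * t * w⁻¹⁻¹ = cs.simple i := by simp only [t]; group
  simp only [h1] at h ⊢
  rw [signedConjHom_apply] at h ⊢
  rw [signedConjHom_simple, signedConj_apply]
  simp only [cs.simple_mul_simple_self, one_mul, propSign, if_true] at h ⊢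
  rw [mul_neg_one, neg_mul, h]

/-- The strong exchange property. -/
theorem IsReflection.mem_rightInvSeq {t : W} (ht : cs.IsReflection t) {ω : List B}
    (h : cs.length (cs.wordProd ω * t) < cs.length (cs.wordProd ω)) : t ∈ cs.rightInvSeq ω := by
  by_contra hmem
  have h1 := cs.signedConjHom_wordProd_of_notMem ω hmem
  -- If the sign of w at t is 1, then that of w t at t is -1, so t occurs in the inversion sequence
  -- of a reduced word of w t. Then w = (w t) t is shorter than w t, against the hypothesis.
  obtain ⟨ω', hω', he⟩ := cs.exists_isReduced (cs.wordProd ω * t)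
  have h2 : t ∈ cs.rightInvSeq ω' := by
    by_contra hmem'
    have h3 := cs.signedConjHom_wordProd_of_notMem ω' hmem'
    rw [← he, map_mul, Equiv.Perm.mul_apply, cs.signedConjHom_apply t, signedConjHom_apply] at h3
    simp only [ht.signedConjHom_apply_self, mul_inv_cancel_right, h1] at h3
    exact absurd h3 (by decide)
  have h4 := (cs.isRightInversion_of_mem_rightInvSeq hω' h2).2
  rw [← he, mul_assoc, ht.mul_self, mul_one] at h4
  exact lt_asymm h h4

/-- One step down in the Bruhat order from the product of a word deletes a letter of the word. -/
theorem BruhatStep.exists_eraseIdx {u : W} {ω : List B} (h : cs.BruhatStep u (cs.wordProd ω)) :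
    ∃ j < ω.length, u = cs.wordProd (ω.eraseIdx j) := by
  obtain ⟨t, ht, he, hlt⟩ := h
  have hu : cs.wordProd ω * t = u := by rw [he, mul_assoc, ht.mul_self, mul_one]
  rw [← hu] at hlt
  obtain ⟨j, hj, rfl⟩ := List.mem_iff_getElem.mp (ht.mem_rightInvSeq cs hlt)
  rw [length_rightInvSeq] at hj
  refine ⟨j, hj, ?_⟩
  rw [← wordProd_mul_getD_rightInvSeq, ← hu, List.getD_eq_getElem]

/-- Deleting a letter of a word is a step of the Bruhat order, up or down. -/
theorem bruhatStep_eraseIdx_or (ω : List B) {j : ℕ} (hj : j < ω.length) :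
    cs.BruhatStep (cs.wordProd (ω.eraseIdx j)) (cs.wordProd ω) ∨
      cs.BruhatStep (cs.wordProd ω) (cs.wordProd (ω.eraseIdx j)) := by
  have ht : cs.IsReflection ((cs.rightInvSeq ω).getD j 1) := by
    rw [List.getD_eq_getElem _ _ (by simpa using hj)]
    exact cs.isReflection_of_mem_rightInvSeq ω (List.getElem_mem _)
  have he := cs.wordProd_mul_getD_rightInvSeq ω j
  rw [← he]
  rcases (ht.length_mul_left_ne (cs.wordProd ω)).lt_or_gt with h | h
  · exact Or.inl ⟨_, ht, by rw [mul_assoc, ht.mul_self, mul_one], h⟩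
  · exact Or.inr ⟨_, ht, rfl, h⟩

end CoxeterSystem

/-! ### Signed permutations -/

/-- The signed transposition of `ℤ` that exchanges `a` with `b` and `-a` with `-b`. -/
def signedSwapFun (a b z : ℤ) : ℤ :=
  if z = a then b else if z = b then a else if z = -a then -b else if z = -b then -a else z

theorem signedSwapFun_involutive {a b : ℤ} (ha : a ≠ 0) (hb : b ≠ 0) (h : a ≠ b) (h' : a ≠ -b) :
    Function.Involutive (signedSwapFun a b) := by
  intro z
  unfold signedSwapFun
  grind

theorem signedSwapFun_left (a b : ℤ) : signedSwapFun a b a = b := by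
  simp [signedSwapFun]

theorem signedSwapFun_right (a b : ℤ) : signedSwapFun a b b = a := by
  unfold signedSwapFun; split_ifs <;> omega

theorem signedSwapFun_of_ne {a b z : ℤ} (h : z ≠ a ∧ z ≠ b ∧ z ≠ -a ∧ z ≠ -b) :
    signedSwapFun a b z = z := by
  simp [signedSwapFun, h]

theorem signedSwapFun_neg {a b : ℤ} (ha : a ≠ 0) (hb : b ≠ 0) (h : a ≠ b) (h' : a ≠ -b) (z : ℤ) :
    signedSwapFun a b (-z) = -signedSwapFun a b z := by
  unfold signedSwapFun; split_ifs <;> omega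

theorem signedSwapFun_comm {a b c d : ℤ} (ha : a ≠ 0) (hb : b ≠ 0) (hc : c ≠ 0) (hd : d ≠ 0)
    (hab : a ≠ b) (hab' : a ≠ -b) (hcd : c ≠ d) (hcd' : c ≠ -d) (hac : a ≠ c) (hac' : a ≠ -c) (had : a ≠ d)
    (had' : a ≠ -d) (hbc : b ≠ c) (hbc' : b ≠ -c) (hbd : b ≠ d) (hbd' : b ≠ -d) (z : ℤ) :
    signedSwapFun a b (signedSwapFun c d z) = signedSwapFun c d (signedSwapFun a b z) := by
  have h1 : ∀ z, z = a ∨ z = b → signedSwapFun c d z = z := fun z hz ↦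
    signedSwapFun_of_ne (by omega)
  have h2 : ∀ z, z = c ∨ z = d → signedSwapFun a b z = z := fun z hz ↦
    signedSwapFun_of_ne (by omega)
  -- Both sides are odd functions of z and fix everything outside ±a, ±b, ±c, ±d, so these four
  -- values suffice.
  have key : ∀ z, z = a ∨ z = b ∨ z = c ∨ z = d →
      signedSwapFun a b (signedSwapFun c d z) = signedSwapFun c d (signedSwapFun a b z) := by
    rintro z (rfl | rfl | rfl | rfl) <;>
      simp only [h1, h2, signedSwapFun_left, signedSwapFun_right, true_or, or_true]
  by_cases hz : z = a ∨ z = b ∨ z = c ∨ z = d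
  · exact key z hz
  by_cases hz' : -z = a ∨ -z = b ∨ -z = c ∨ -z = d
  · have := key (-z) hz'
    simpa only [signedSwapFun_neg ha hb hab hab', signedSwapFun_neg hc hd hcd hcd', neg_inj] using this
  · rw [signedSwapFun_of_ne (a := c) (b := d) (z := z) (by omega),
      signedSwapFun_of_ne (a := a) (b := b) (z := z) (by omega),
      signedSwapFun_of_ne (a := c) (b := d) (z := z) (by omega)]

theorem signedSwapFun_braid {a b d : ℤ} (ha : a ≠ 0) (hb : b ≠ 0) (hd : d ≠ 0) (hab : a ≠ b)
    (hab' : a ≠ -b) (had : a ≠ d)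
    (had' : a ≠ -d) (hbd : b ≠ d) (hbd' : b ≠ -d) (z : ℤ) :
    signedSwapFun a b (signedSwapFun b d (signedSwapFun a b z)) =
      signedSwapFun b d (signedSwapFun a b (signedSwapFun b d z)) := by
  have h1 : signedSwapFun b d a = a := signedSwapFun_of_ne (by omega)
  have h2 : signedSwapFun a b d = d := signedSwapFun_of_ne (by omega)
  have key : ∀ z, z = a ∨ z = b ∨ z = d →
      signedSwapFun a b (signedSwapFun b d (signedSwapFun a b z)) =
      signedSwapFun b d (signedSwapFun a b (signedSwapFun b d z)) := by
    rintro z (rfl | rfl | rfl) <;>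
      simp only [h1, h2, signedSwapFun_left, signedSwapFun_right]
  by_cases hz : z = a ∨ z = b ∨ z = d
  · exact key z hz
  by_cases hz' : -z = a ∨ -z = b ∨ -z = d
  · have := key (-z) hz'
    simpa only [signedSwapFun_neg ha hb hab hab', signedSwapFun_neg hb hd hbd hbd', neg_inj] using this
  · rw [signedSwapFun_of_ne (a := a) (b := b) (z := z) (by omega),
      signedSwapFun_of_ne (a := b) (b := d) (z := z) (by omega),
      signedSwapFun_of_ne (a := a) (b := b) (z := z) (by omega),
      signedSwapFun_of_ne (a := b) (b := d) (z := z) (by omega)]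

/-- The signed transpositions that represent the generators of the Weyl groups of type `D`: the
generator `0` exchanges `1` and `-2`, the generator `i ≥ 1` exchanges `i` and `i + 1`. -/
def typeDPerm (i : ℕ) : Equiv.Perm ℤ :=
  Function.Involutive.toPerm (if i = 0 then signedSwapFun 1 (-2) else signedSwapFun i (i + 1)) <| by
    split_ifs with h
    · apply signedSwapFun_involutive <;> omega
    · apply signedSwapFun_involutive <;> omega

theorem typeDPerm_zero_apply (z : ℤ) : typeDPerm 0 z = signedSwapFun 1 (-2) z := rfl

theorem typeDPerm_apply {i : ℕ} (hi : i ≠ 0) (z : ℤ) :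
    typeDPerm i z = signedSwapFun i (i + 1) z := by
  simp [typeDPerm, hi]

theorem typeDPerm_mul_self (i : ℕ) : typeDPerm i * typeDPerm i = 1 := by
  ext z
  exact Function.Involutive.toPerm_involutive _ z

theorem typeDPerm_inv (i : ℕ) : (typeDPerm i)⁻¹ = typeDPerm i :=
  inv_eq_of_mul_eq_one_left (typeDPerm_mul_self i)

theorem typeDPerm_comm_zero_one :
    typeDPerm 0 * typeDPerm 1 = typeDPerm 1 * typeDPerm 0 := by
  ext z
  simp only [Equiv.Perm.mul_apply, typeDPerm_zero_apply, typeDPerm_apply one_ne_zero,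
    signedSwapFun]
  grind

theorem typeDPerm_comm {i j : ℕ} (hij : i + 1 < j) (h : i = 0 → 2 < j) :
    typeDPerm i * typeDPerm j = typeDPerm j * typeDPerm i := by
  ext z
  have hj : j ≠ 0 := by omega
  rcases eq_or_ne i 0 with rfl | hi
  · simp only [Equiv.Perm.mul_apply, typeDPerm_zero_apply, typeDPerm_apply hj]
    have := h rfl
    apply signedSwapFun_comm <;> omega
  · simp only [Equiv.Perm.mul_apply, typeDPerm_apply hi, typeDPerm_apply hj]
    apply signedSwapFun_comm <;> omega

theorem typeDPerm_braid_zero : typeDPerm 0 * typeDPerm 2 * typeDPerm 0 =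
    typeDPerm 2 * typeDPerm 0 * typeDPerm 2 := by
  -- Read as the exchange of -1 and 2, generator 0 forms a chain -1, 2, 3 with generator 2, and the
  -- general braid identity applies.
  have h : ∀ z, signedSwapFun 1 (-2) z = signedSwapFun (-1) 2 z := by
    intro z; unfold signedSwapFun; grind
  ext z
  simp only [Equiv.Perm.mul_apply, typeDPerm_zero_apply, typeDPerm_apply two_ne_zero, h]
  apply signedSwapFun_braid <;> norm_num

theorem typeDPerm_braid {i : ℕ} (hi : i ≠ 0) : typeDPerm i * typeDPerm (i + 1) * typeDPerm i =
    typeDPerm (i + 1) * typeDPerm i * typeDPerm (i + 1) := by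
  ext z
  simp only [Equiv.Perm.mul_apply, typeDPerm_apply hi, typeDPerm_apply (Nat.succ_ne_zero i)]
  push_cast
  apply signedSwapFun_braid <;> omega

theorem mul_pow_three_eq_one_of_braid {G : Type*} [Group G] {a b : G} (ha : a * a = 1)
    (hb : b * b = 1) (h : a * b * a = b * a * b) : (a * b) ^ 3 = 1 := by
  calc (a * b) ^ 3 = (a * b * a) * (b * a * b) := by simp only [pow_succ, pow_zero]; group
    _ = (a * b * a) * (a * b * a) := by rw [h]
    _ = a * (b * (a * a) * b) * a := by group
    _ = 1 := by rw [ha, mul_one, hb, mul_one, ha]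

theorem mul_pow_two_eq_one_of_comm {G : Type*} [Group G] {a b : G} (ha : a * a = 1)
    (hb : b * b = 1) (h : a * b = b * a) : (a * b) ^ 2 = 1 := by
  calc (a * b) ^ 2 = (a * b) * (b * a) := by rw [pow_two, h]
    _ = a * (b * b) * a := by group
    _ = 1 := by rw [hb, mul_one, ha]

theorem isLiftable_typeDPerm (n : ℕ) :
    (typeD n).IsLiftable fun i : Fin (n + 1) ↦ typeDPerm i := by
  intro i j
  have key : ∀ {i j : ℕ}, i < j →
      (typeDPerm i * typeDPerm j) ^ (if (i = 0 ∧ j = 2) ∨ (i ≠ 0 ∧ i + 1 = j) then 3 else 2) = 1 := by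
    intro i j hij
    split_ifs with h
    · apply mul_pow_three_eq_one_of_braid (typeDPerm_mul_self _) (typeDPerm_mul_self _)
      rcases h with ⟨rfl, rfl⟩ | ⟨hi, rfl⟩
      · exact typeDPerm_braid_zero
      · exact typeDPerm_braid hi
    · apply mul_pow_two_eq_one_of_comm (typeDPerm_mul_self _) (typeDPerm_mul_self _)
      by_cases h01 : i = 0 ∧ j = 1
      · obtain ⟨rfl, rfl⟩ := h01
        exact typeDPerm_comm_zero_one
      · exact typeDPerm_comm (by omega) (by omega)
  simp only [typeD, Matrix.of_apply]
  rcases lt_trichotomy i j with h | rfl | h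
  · have hv : (i : ℕ) < j := h
    rw [if_neg h.ne]
    exact (congrArg _ (if_congr (by omega) rfl rfl)).trans (key hv)
  · simp [typeDPerm_mul_self]
  · have hv : (j : ℕ) < i := h
    rw [if_neg h.ne', ← inv_inj, ← inv_pow, mul_inv_rev, typeDPerm_inv, typeDPerm_inv, inv_one]
    exact (congrArg _ (if_congr (by omega) rfl rfl)).trans (key hv)

namespace CoxeterSystem

variable {n : ℕ} {W : Type*} [Group W] (cs : CoxeterSystem (typeD n) W)

/-- The representation of the Weyl group of type `D` by signed permutations. -/
def signedPermHom : W →* Equiv.Perm ℤ :=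
  cs.lift ⟨_, isLiftable_typeDPerm n⟩

theorem signedPermHom_simple (i : Fin (n + 1)) :
    cs.signedPermHom (cs.simple i) = typeDPerm i :=
  cs.lift_apply_simple (isLiftable_typeDPerm n) i

theorem simple_comm_of_add_one_lt {i j : Fin (n + 1)} (hij : (i : ℕ) + 1 < j)
    (h : (i : ℕ) = 0 → 2 < (j : ℕ)) : Commute (cs.simple i) (cs.simple j) := by
  have hM : (typeD n).M i j = 2 := by
    simp only [typeD, Matrix.of_apply]
    rw [if_neg (by rintro rfl; omega), if_neg (by omega)]
  have := cs.simple_mul_simple_pow i j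
  rw [hM, pow_two, mul_eq_one_iff_eq_inv, mul_inv_rev, cs.inv_simple, cs.inv_simple] at this
  exact this

end CoxeterSystem

/-! ### Encoding of the Bruhat interval by sequences of types -/

/-- The possible types of a level: at a level `i` of an `H`-prime they record which of the elements
`Ω_i, x_i, y_i` it contains, and in the word `s_n ⋯ s_1 s_0 s_2 ⋯ s_n` they record which of the
letters of the level are kept. -/
inductive LevelType : Type
  | empty | center | left | right | both
  deriving DecidableEq

namespace LevelType

/-- The order of the types: `empty` is the least one, then `center`, and `both` is the greatest. -/
def TypeLE : LevelType → LevelType → Prop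
  | empty, _ => True
  | center, b => b ≠ empty
  | left, b => b = left ∨ b = both
  | right, b => b = right ∨ b = both
  | both, b => b = both

theorem TypeLE.refl (a : LevelType) : TypeLE a a := by cases a <;> simp [TypeLE]

theorem TypeLE.trans {a b c : LevelType} (h : TypeLE a b) (h' : TypeLE b c) : TypeLE a c := by
  cases a <;> cases b <;> cases c <;> simp_all [TypeLE]

theorem TypeLE.antisymm {a b : LevelType} (h : TypeLE a b) (h' : TypeLE b a) : a = b := by
  cases a <;> cases b <;> simp_all [TypeLE]

theorem TypeLE.eq_empty {a : LevelType} (h : TypeLE a empty) : a = empty := by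
  cases a <;> simp_all [TypeLE]

theorem le_both (a : LevelType) : TypeLE a both := by cases a <;> simp [TypeLE]

/-- The letter on the left of the level is kept. -/
def hasLeft : LevelType → Bool
  | left | both => true
  | _ => false

/-- The letter on the right of the level is kept. -/
def hasRight : LevelType → Bool
  -- A `center` letter commutes with the word inside it, so its side is a convention; the right is
  -- chosen.
  | center | right | both => true
  | _ => false

/-- A list of types, the highest level first, is admissible if `center` occurs only immediately
above `empty`, and only `empty` and `center` occur there. -/
def Admissible : List LevelType → Prop
  | [] => True
  | a :: l => Admissible l ∧ if l.head? = some empty then a = empty ∨ a = center else a ≠ center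

/-- The word encoded by a list of types. -/
def word : List LevelType → List ℕ
  | [] => []
  | a :: l => (if a.hasLeft then [l.length + 1] else []) ++ word l ++
      -- At the bottom level the two letters are the fork nodes: 1 on the left and 0 on the right.
      -- At higher levels both are equal.
      if a.hasRight then [if l = [] then 0 else l.length + 1] else []

/-- The levelwise order on lists of types. -/
abbrev ListLE : List LevelType → List LevelType → Prop := List.Forall₂ TypeLE

theorem ListLE.refl (l : List LevelType) : ListLE l l :=
  List.forall₂_same.mpr fun _ _ ↦ TypeLE.refl _

theorem ListLE.trans : ∀ {l l' l'' : List LevelType}, ListLE l l' → ListLE l' l'' → ListLE l l''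
  | _, _, _, .nil, .nil => .nil
  | _, _, _, .cons h h₂, .cons h' h₂' => .cons (h.trans h') (ListLE.trans h₂ h₂')

theorem ListLE.antisymm : ∀ {l l' : List LevelType}, ListLE l l' → ListLE l' l → l = l'
  | _, _, .nil, .nil => rfl
  | _, _, .cons h h₂, .cons h' h₂' => by rw [h.antisymm h', ListLE.antisymm h₂ h₂']

theorem ListLE.head?_eq_empty {l l' : List LevelType} (h : ListLE l l')
    (h' : l'.head? = some empty) : l.head? = some empty := by
  cases h with
  | nil => exact h'
  | cons h₁ h₂ =>
    simp only [List.head?_cons, Option.some.injEq] at h' ⊢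
    subst h'
    exact h₁.eq_empty

theorem admissible_cons_of_ne_center {a : LevelType} {l : List LevelType} (hl : Admissible l)
    (h : l.head? ≠ some empty) (ha : a ≠ center) : Admissible (a :: l) :=
  ⟨hl, by rwa [if_neg h]⟩

theorem admissible_empty_cons {l : List LevelType} (hl : Admissible l) :
    Admissible (empty :: l) := ⟨hl, by split_ifs <;> simp⟩

theorem admissible_center_cons {l : List LevelType} (hl : Admissible l)
    (h : l.head? = some empty) : Admissible (center :: l) := ⟨hl, by simp [h]⟩

theorem Admissible.ne_center {a : LevelType} {l : List LevelType} (h : Admissible (a :: l))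
    (h' : l.head? ≠ some empty) : a ≠ center := by
  have := h.2; rwa [if_neg h'] at this

theorem Admissible.eq_or_eq {a : LevelType} {l : List LevelType} (h : Admissible (a :: l))
    (h' : l.head? = some empty) : a = empty ∨ a = center := by
  have := h.2; rwa [if_pos h'] at this

theorem Admissible.head?_ne {a : LevelType} {l : List LevelType} (h : Admissible (a :: l))
    (ha : a ≠ empty) (ha' : a ≠ center) : l.head? ≠ some empty := fun h' ↦ by
  rcases h.eq_or_eq h' with h | h
  exacts [ha h, ha' h]

theorem Admissible.head?_eq {l : List LevelType} (h : Admissible (center :: l)) :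
    l.head? = some empty := by
  by_contra h'
  exact h.ne_center h' rfl

theorem le_length_of_mem_word {l : List LevelType} {i : ℕ} (h : i ∈ word l) :
    i ≤ l.length ∧ l ≠ [] := by
  induction l with
  | nil => simp [word] at h
  | cons a l ih =>
    simp only [word, List.mem_append] at h
    simp only [List.length_cons, ne_eq, reduceCtorEq, not_false_eq_true, and_true]
    rcases h with (h | h) | h
    · split_ifs at h <;> simp at h; omega
    · have := ih h; omega
    · split_ifs at h <;> simp at h <;> omega

theorem word_empty_cons (l : List LevelType) : word (empty :: l) = word l := by
  simp [word, hasLeft, hasRight]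

theorem word_replicate_both (m : ℕ) : word (List.replicate (m + 1) both) =
    (List.range (m + 2)).reverse ++ (List.range (m + 2)).drop 2 := by
  induction m with
  | zero => rfl
  | succ m ih =>
    rw [List.replicate_succ, word, ih, List.range_succ (n := m + 2), List.reverse_append,
      List.drop_append_of_le_length (by simp)]
    simp [hasLeft, hasRight]

end LevelType

namespace CoxeterSystem

open LevelType

variable {n : ℕ} {W : Type*} [Group W] (cs : CoxeterSystem (typeD n) W)

/-- The product of a word in the generators, given by natural numbers. -/
def natWordProd (ω : List ℕ) : W := cs.wordProd (ω.map (Fin.ofNat (n + 1)))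

theorem natWordProd_append (ω ω' : List ℕ) :
    cs.natWordProd (ω ++ ω') = cs.natWordProd ω * cs.natWordProd ω' := by
  rw [natWordProd, List.map_append, wordProd_append]; rfl

theorem natWordProd_nil : cs.natWordProd [] = 1 := cs.wordProd_nil

theorem natWordProd_singleton_mul_self (i : ℕ) :
    cs.natWordProd [i] * cs.natWordProd [i] = 1 := by
  simp [natWordProd]

theorem natWordProd_commute {ω : List ℕ} {j : ℕ} (hj : j ≤ n)
    (h : ∀ i ∈ ω, i + 1 < j ∧ (i = 0 → 2 < j)) :
    Commute (cs.natWordProd ω) (cs.natWordProd [j]) := by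
  induction ω with
  | nil => rw [natWordProd_nil]; exact Commute.one_left _
  | cons i ω ih =>
    rw [← List.singleton_append, natWordProd_append]
    refine Commute.mul_left ?_ (ih fun i hi ↦ h i (List.mem_cons_of_mem _ hi))
    have hi := h i List.mem_cons_self
    simp only [natWordProd, List.map_cons, List.map_nil, wordProd_singleton]
    have e1 : ((Fin.ofNat (n + 1) i : Fin (n + 1)) : ℕ) = i := Nat.mod_eq_of_lt (by omega)
    have e2 : ((Fin.ofNat (n + 1) j : Fin (n + 1)) : ℕ) = j := Nat.mod_eq_of_lt (by omega)
    exact cs.simple_comm_of_add_one_lt (by rw [e1, e2]; exact hi.1) (by rw [e1, e2]; exact hi.2)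

/-- The element of the Weyl group that is encoded by a list of types. -/
def typesProd (l : List LevelType) : W := cs.natWordProd (word l)

/-- With an `empty` top level, all letters used are at least two below the new one. The exceptional
edge 0 — 2 is no obstacle: letter 0 occurs only if a level exists below the empty one, and then the
new letter is at least 3. -/
theorem typesProd_commute {l : List LevelType} (hl : l.length + 1 ≤ n)
    (h : l.head? = some empty) :
    Commute (cs.typesProd l) (cs.natWordProd [l.length + 1]) := by
  rcases l with _ | ⟨a, l⟩
  · simp at h
  · simp only [List.head?_cons, Option.some.injEq] at h
    subst h
    rw [typesProd, word_empty_cons]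
    refine cs.natWordProd_commute hl fun i hi ↦ ?_
    obtain ⟨h1, h2⟩ := le_length_of_mem_word hi
    have := List.length_pos_iff.mpr h2
    simp only [List.length_cons]
    omega

/-- The group element `v` is obtained from the word of `l` by deleting one letter. -/
def IsDeletion (v : W) (l : List LevelType) : Prop :=
  ∃ j < (word l).length, v = cs.natWordProd ((word l).eraseIdx j)

theorem typesProd_cons (a : LevelType) (l : List LevelType) : cs.typesProd (a :: l) =
    (if a.hasLeft then cs.natWordProd [l.length + 1] else 1) * cs.typesProd l *
      if a.hasRight then cs.natWordProd [if l = [] then 0 else l.length + 1] else 1 := by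
  simp only [typesProd, word, natWordProd_append]
  split_ifs <;> simp [natWordProd_nil]

/-- The deleted letter is the outer left one, an inner one, or the outer right one; this makes
deletions accessible to induction on the levels. -/
theorem isDeletion_cons_iff {v : W} {a : LevelType} {l : List LevelType} :
    cs.IsDeletion v (a :: l) ↔
      (a.hasLeft ∧ v = cs.typesProd l *
        if a.hasRight then cs.natWordProd [if l = [] then 0 else l.length + 1] else 1) ∨
      (∃ u, cs.IsDeletion u l ∧ v =
        (if a.hasLeft then cs.natWordProd [l.length + 1] else 1) * u *
          if a.hasRight then cs.natWordProd [if l = [] then 0 else l.length + 1] else 1) ∨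
      (a.hasRight ∧ v = (if a.hasLeft then cs.natWordProd [l.length + 1] else 1) *
        cs.typesProd l) := by
  have key : ∀ (ω₁ ω₂ ω₃ : List ℕ),
      (∃ j < (ω₁ ++ ω₂ ++ ω₃).length, v = cs.natWordProd ((ω₁ ++ ω₂ ++ ω₃).eraseIdx j)) ↔
      (∃ j < ω₁.length, v = cs.natWordProd (ω₁.eraseIdx j ++ ω₂ ++ ω₃)) ∨
      (∃ j < ω₂.length, v = cs.natWordProd (ω₁ ++ ω₂.eraseIdx j ++ ω₃)) ∨
      (∃ j < ω₃.length, v = cs.natWordProd (ω₁ ++ ω₂ ++ ω₃.eraseIdx j)) := by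
    intro ω₁ ω₂ ω₃
    constructor
    · rintro ⟨j, hj, rfl⟩
      simp only [List.length_append] at hj
      by_cases h1 : j < ω₁.length
      · refine Or.inl ⟨j, h1, ?_⟩
        rw [List.append_assoc, List.eraseIdx_append_of_lt_length h1, List.append_assoc]
      by_cases h2 : j < ω₁.length + ω₂.length
      · refine Or.inr (Or.inl ⟨j - ω₁.length, by omega, ?_⟩)
        rw [List.eraseIdx_append_of_lt_length (by simpa using h2),
          List.eraseIdx_append_of_length_le (by omega)]
      · refine Or.inr (Or.inr ⟨j - (ω₁.length + ω₂.length), by omega, ?_⟩)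
        rw [List.eraseIdx_append_of_length_le (by simp; omega), List.length_append]
    · rintro (⟨j, hj, rfl⟩ | ⟨j, hj, rfl⟩ | ⟨j, hj, rfl⟩)
      · refine ⟨j, by simp; omega, ?_⟩
        rw [List.append_assoc _ _ ω₃, List.append_assoc _ _ ω₃, List.eraseIdx_append_of_lt_length hj]
      · refine ⟨ω₁.length + j, by simp; omega, ?_⟩
        rw [List.eraseIdx_append_of_lt_length (by simpa using hj),
          List.eraseIdx_append_of_length_le (by omega), Nat.add_sub_cancel_left]
      · refine ⟨(ω₁ ++ ω₂).length + j, by simp; omega, ?_⟩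
        rw [List.eraseIdx_append_of_length_le (by omega), Nat.add_sub_cancel_left]
  rw [IsDeletion, word, key]
  clear key
  refine or_congr ?_ (or_congr ?_ ?_)
  · split_ifs with h₁ h₂ h₃ <;> simp [h₁, natWordProd_append, typesProd, natWordProd_nil]
  · simp only [IsDeletion, natWordProd_append]
    constructor
    · rintro ⟨j, hj, rfl⟩
      refine ⟨_, ⟨j, hj, rfl⟩, ?_⟩
      split_ifs <;> simp [natWordProd_nil]
    · rintro ⟨_, ⟨j, hj, rfl⟩, rfl⟩
      refine ⟨j, hj, ?_⟩
      split_ifs <;> simp [natWordProd_nil]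
  · split_ifs with h₁ h₂ <;> simp [*, natWordProd_append, typesProd, natWordProd_nil] <;>
      rw [← List.singleton_append, natWordProd_append]

end CoxeterSystem

/-! ### Normalisation after a deletion, and the levelwise order -/

namespace CoxeterSystem

open LevelType

variable {n : ℕ} {W : Type*} [Group W] (cs : CoxeterSystem (typeD n) W)

/-- Replacing the top type, when the types below are changed from `l` to `l'` with
`typesProd l'` obtained by deleting a letter. -/
theorem exists_typesProd_eq_conj {a : LevelType} {l l' : List LevelType}
    (hlen : l.length + 1 ≤ n) (hl : Admissible (a :: l)) (hl' : Admissible l')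
    (h : ListLE l' l) : ∃ b, Admissible (b :: l') ∧ TypeLE b a ∧
      (l'.head? ≠ some empty ∨ l.head? = some empty → b = a) ∧
      (l'.head? = some empty → l.head? ≠ some empty →
        b = if a = left ∨ a = right then center else empty) ∧
      cs.typesProd (b :: l') = (if a.hasLeft then cs.natWordProd [l.length + 1] else 1) *
        cs.typesProd l' * if a.hasRight then
          cs.natWordProd [if l = [] then 0 else l.length + 1] else 1 := by
  have hlen' : l'.length = l.length := h.length_eq
  have hnil : l' = [] ↔ l = [] := by rw [← List.length_eq_zero_iff, hlen', List.length_eq_zero_iff]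
  -- Normalisation is needed only if the level just below has newly become `empty`; otherwise `a`
  -- remains admissible.
  by_cases hc : l'.head? ≠ some empty ∨ l.head? = some empty
  · refine ⟨a, ?_, TypeLE.refl a, fun _ ↦ rfl, by tauto, ?_⟩
    · rcases hc with hc | hc
      · have hc' : l.head? ≠ some empty := fun h' ↦ hc (h.head?_eq_empty h')
        exact admissible_cons_of_ne_center hl' hc (hl.ne_center hc')
      · rcases hl.eq_or_eq hc with rfl | rfl
        exacts [admissible_empty_cons hl', admissible_center_cons hl' (h.head?_eq_empty hc)]
    · rw [typesProd_cons, hlen']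
      simp only [hnil]
  · push Not at hc
    obtain ⟨h1, h2⟩ := hc
    have hne : l ≠ [] := by
      rintro rfl
      simp [hnil.mpr rfl] at h1
    have hcomm := cs.typesProd_commute (by rw [hlen']; exact hlen) h1
    rw [hlen'] at hcomm
    have hself := cs.natWordProd_singleton_mul_self (l.length + 1)
    have hne' := hl.ne_center h2
    -- The outer letters now commute with the inner word: a single one becomes `center`, and a pair
    -- cancels because the letter squares to 1.
    refine ⟨if a = left ∨ a = right then center else empty, ?_, ?_, by tauto, fun _ _ ↦ rfl, ?_⟩
    · split_ifs
      exacts [admissible_center_cons hl' h1, admissible_empty_cons hl']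
    · cases a <;> simp_all [TypeLE]
    · rw [typesProd_cons, hlen']
      simp only [hnil, hne, if_false]
      cases a <;> simp_all [hasLeft, hasRight]
      · exact hcomm.eq
      · rw [← hcomm.eq, mul_assoc, hself, mul_one]

/-- Deleting a letter from the word of an admissible list gives the element of a smaller admissible
list. -/
theorem IsDeletion.exists_typesProd_eq {v : W} : ∀ {l : List LevelType} (_ : l.length ≤ n)
    (_ : Admissible l) (_ : cs.IsDeletion v l),
    ∃ l', Admissible l' ∧ ListLE l' l ∧ v = cs.typesProd l'
  | [], _, _, h => by obtain ⟨j, hj, -⟩ := h; simp [word] at hj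
  | a :: l, hlen, hl, h => by
    rw [List.length_cons] at hlen
    rw [isDeletion_cons_iff] at h
    rcases h with ⟨ha, rfl⟩ | ⟨u, hu, rfl⟩ | ⟨ha, rfl⟩
    · cases a <;> simp only [hasLeft, Bool.false_eq_true] at ha
      · exact ⟨empty :: l, admissible_empty_cons hl.1, .cons (by simp [TypeLE]) (ListLE.refl l), by
          simp [typesProd_cons, hasLeft, hasRight]⟩
      · exact ⟨right :: l, admissible_cons_of_ne_center hl.1 (hl.head?_ne (by simp) (by simp))
          (by simp), .cons (by simp [TypeLE]) (ListLE.refl l), by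
          simp [typesProd_cons, hasLeft, hasRight]⟩
    · obtain ⟨l', hl', hle, rfl⟩ := exists_typesProd_eq (by omega) hl.1 hu
      obtain ⟨b, hb, hba, -, -, he⟩ := cs.exists_typesProd_eq_conj hlen hl hl' hle
      exact ⟨b :: l', hb, .cons hba hle, he.symm⟩
    · cases a <;> simp only [hasRight, Bool.false_eq_true] at ha
      · exact ⟨empty :: l, admissible_empty_cons hl.1, .cons (by simp [TypeLE]) (ListLE.refl l), by
          simp [typesProd_cons, hasLeft, hasRight]⟩
      · exact ⟨empty :: l, admissible_empty_cons hl.1, .cons (by simp [TypeLE]) (ListLE.refl l), by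
          simp [typesProd_cons, hasLeft, hasRight]⟩
      · exact ⟨left :: l, admissible_cons_of_ne_center hl.1 (hl.head?_ne (by simp) (by simp))
          (by simp), .cons (by simp [TypeLE]) (ListLE.refl l), by
          simp [typesProd_cons, hasLeft, hasRight]⟩

/-- The order on admissible lists is generated by deletions of letters. -/
theorem exists_isDeletion : ∀ {l l' : List LevelType} (_ : l'.length ≤ n)
    (_ : Admissible l) (_ : Admissible l') (_ : ListLE l l') (_ : l ≠ l'),
    ∃ l'', Admissible l'' ∧ ListLE l l'' ∧ ListLE l'' l' ∧ cs.IsDeletion (cs.typesProd l'') l'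
  | [], [], _, _, _, _, hne => absurd rfl hne
  | a :: l, b :: l', hlen, hl, hl', .cons hab hll', hne => by
    rw [List.length_cons] at hlen
    have hlen' : l.length = l'.length := hll'.length_eq
    -- deletion of a letter of a lower level
    have lower : (a = b ∨ a = center ∧ (b = left ∨ b = right)) → l ≠ l' → ∃ l'', Admissible l'' ∧
        ListLE (a :: l) l'' ∧ ListLE l'' (b :: l') ∧
          cs.IsDeletion (cs.typesProd l'') (b :: l') := by
      intro hab' hne'
      obtain ⟨m, hm, hlm, hml', hd⟩ := exists_isDeletion (by omega) hl.1 hl'.1 hll' hne'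
      obtain ⟨c, hc, hcb, h1, h2, he⟩ := cs.exists_typesProd_eq_conj hlen hl' hm hml'
      refine ⟨c :: m, hc, .cons ?_ hlm, .cons hcb hml', ?_⟩
      · by_cases hcase : m.head? ≠ some empty ∨ l'.head? = some empty
        · rw [h1 hcase]; exact hab
        · push Not at hcase
          -- Normalisation lowers the top type `b`, so it has to be checked that it stays above `a`.
          -- Here `l` starts with `empty`, so `a` is `empty` or `center`; in the latter case `b` is
          -- `left` or `right` and drops to `center` only.
          have hl0 := hlm.head?_eq_empty hcase.1
          have hb := hl'.ne_center hcase.2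
          rw [h2 hcase.1 hcase.2]
          rcases hl.eq_or_eq hl0 with rfl | rfl
          · simp [TypeLE]
          · rcases hab' with rfl | ⟨-, hb'⟩
            · exact absurd rfl hb
            · simp [hb', TypeLE]
      · rw [isDeletion_cons_iff]
        exact Or.inr (Or.inl ⟨_, hd, he⟩)
    -- deletion of a letter of the top level
    have upper : ∀ c, TypeLE a c → TypeLE c b → Admissible (c :: l') →
        ((b.hasLeft ∧ c.hasLeft = false ∧ c.hasRight = b.hasRight) ∨
          (b.hasRight ∧ c.hasRight = false ∧ c.hasLeft = b.hasLeft)) → ∃ l'', Admissible l'' ∧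
        ListLE (a :: l) l'' ∧ ListLE l'' (b :: l') ∧
          cs.IsDeletion (cs.typesProd l'') (b :: l') := by
      intro c hac hcb hc h
      refine ⟨c :: l', hc, .cons hac hll', .cons hcb (ListLE.refl l'), ?_⟩
      rw [isDeletion_cons_iff, typesProd_cons]
      rcases h with ⟨h1, h2, h3⟩ | ⟨h1, h2, h3⟩
      · exact Or.inl ⟨h1, by simp [h2, h3]⟩
      · exact Or.inr (Or.inr ⟨h1, by simp [h2, h3]⟩)
    have hE := admissible_empty_cons hl'.1
    by_cases hab' : a = b
    · exact lower (Or.inl hab') fun h ↦ hne (by rw [hab', h])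
    · cases b
      · exact absurd hab.eq_empty hab'
      · have : a = empty := by cases a <;> simp_all [TypeLE]
        exact upper empty (by simp [this, TypeLE]) (by simp [TypeLE]) hE (by simp [hasLeft, hasRight])
      · have hh := hl'.head?_ne (by simp) (by simp)
        by_cases ha : a = empty
        · exact upper empty (by simp [ha, TypeLE]) (by simp [TypeLE]) hE (by simp [hasLeft, hasRight])
        · have ha' : a = center := by cases a <;> simp_all [TypeLE]
          subst ha'
          -- `center` needs an `empty` below it and `left` forbids one, so the lists differ below
          -- the top and a letter can be deleted there.
          exact lower (Or.inr ⟨rfl, by simp⟩) fun h ↦ hh (h ▸ hl.head?_eq)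
      · have hh := hl'.head?_ne (by simp) (by simp)
        by_cases ha : a = empty
        · exact upper empty (by simp [ha, TypeLE]) (by simp [TypeLE]) hE (by simp [hasLeft, hasRight])
        · have ha' : a = center := by cases a <;> simp_all [TypeLE]
          subst ha'
          exact lower (Or.inr ⟨rfl, by simp⟩) fun h ↦ hh (h ▸ hl.head?_eq)
      · have hh := hl'.head?_ne (by simp) (by simp)
        -- Any type other than `both` is below `left` or below `right`, and each of these arises
        -- from `both` by one deletion.
        by_cases ha : TypeLE a left
        · exact upper left ha (by simp [TypeLE]) (admissible_cons_of_ne_center hl'.1 hh (by simp))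
            (by simp [hasLeft, hasRight])
        · have ha' : TypeLE a right := by cases a <;> simp_all [TypeLE]
          exact upper right ha' (by simp [TypeLE]) (admissible_cons_of_ne_center hl'.1 hh (by simp))
            (by simp [hasLeft, hasRight])

end CoxeterSystem

/-! ### Separation of admissible lists by signed permutations, and the Bruhat order -/

namespace CoxeterSystem

open LevelType

variable {n : ℕ} {W : Type*} [Group W] (cs : CoxeterSystem (typeD n) W)

theorem signedPermHom_natWordProd_singleton {i : ℕ} (hi : i ≤ n) :
    cs.signedPermHom (cs.natWordProd [i]) = typeDPerm i := by
  have e : ((Fin.ofNat (n + 1) i : Fin (n + 1)) : ℕ) = i := Nat.mod_eq_of_lt (by omega)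
  rw [natWordProd, List.map_singleton, wordProd_singleton, signedPermHom_simple, e]

theorem signedPermHom_natWordProd_apply_of_forall {ω : List ℕ} {z : ℤ}
    (h : ∀ i ∈ ω, i ≤ n ∧ typeDPerm i z = z) : cs.signedPermHom (cs.natWordProd ω) z = z := by
  induction ω with
  | nil => simp [natWordProd_nil]
  | cons i ω ih =>
    rw [← List.singleton_append, natWordProd_append, map_mul, Equiv.Perm.mul_apply,
      ih fun j hj ↦ h j (List.mem_cons_of_mem _ hj),
      cs.signedPermHom_natWordProd_singleton (h i List.mem_cons_self).1]
    exact (h i List.mem_cons_self).2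

/-- A list of length m uses only generators up to m, and these move only integers of absolute value
at most m + 1. -/
theorem signedPermHom_typesProd_apply_of_lt {l : List LevelType} (hl : l.length ≤ n) {z : ℤ}
    (hz : l.length + 1 < z) : cs.signedPermHom (cs.typesProd l) z = z := by
  refine cs.signedPermHom_natWordProd_apply_of_forall fun i hi ↦ ?_
  obtain ⟨h1, h2⟩ := le_length_of_mem_word hi
  have := List.length_pos_iff.mpr h2
  refine ⟨h1.trans hl, ?_⟩
  rcases eq_or_ne i 0 with rfl | h0
  · rw [typeDPerm_zero_apply]
    exact signedSwapFun_of_ne (by omega)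
  · rw [typeDPerm_apply h0]
    exact signedSwapFun_of_ne (by omega)

theorem signedPermHom_typesProd_cons {a : LevelType} {l : List LevelType}
    (hlen : l.length + 1 ≤ n) (hl : l ≠ []) : cs.signedPermHom (cs.typesProd (a :: l)) =
    (if a.hasLeft then typeDPerm (l.length + 1) else 1) * cs.signedPermHom (cs.typesProd l) *
      if a.hasRight then typeDPerm (l.length + 1) else 1 := by
  rw [typesProd_cons, map_mul, map_mul, ← cs.signedPermHom_natWordProd_singleton hlen, if_neg hl]
  split_ifs <;> simp

/-- The base of the decoding: the four types possible at the bottom give four different images of 2.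
-/
theorem signedPermHom_typesProd_singleton_apply_two {a : LevelType} (hn : 1 ≤ n)
    (ha : a ≠ center) : cs.signedPermHom (cs.typesProd [a]) 2 =
      match a with
      | empty | center => 2
      | left => 1
      | right => -1
      | both => -2 := by
  rw [typesProd_cons]
  have h0 := cs.signedPermHom_natWordProd_singleton (Nat.zero_le n)
  have h1 := cs.signedPermHom_natWordProd_singleton hn
  have e : cs.typesProd [] = 1 := cs.natWordProd_nil
  cases a <;> simp [hasLeft, hasRight, h0, h1, e, typeDPerm_zero_apply, typeDPerm_apply,
    signedSwapFun] at ha ⊢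

/-- The type of the top level can be read off from the signed permutation. -/
theorem signedPermHom_typesProd_cons_apply : ∀ {a : LevelType} {l : List LevelType}
    (_ : l.length + 1 ≤ n) (_ : l ≠ []) (_ : Admissible (a :: l)),
    (cs.signedPermHom (cs.typesProd (a :: l)) (l.length + 2) = l.length + 2 ↔ a = empty) ∧
    (a ≠ empty → (cs.signedPermHom (cs.typesProd (a :: l)) (l.length + 2) = l.length + 1 ↔
        a = center ∨ a = left) ∧
      (cs.signedPermHom (cs.typesProd (a :: l)) (l.length + 1) = l.length + 2 ↔
        a = center ∨ a = right))
  | a, b :: l, hlen, hne, hl => by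
    rw [cs.signedPermHom_typesProd_cons hlen hne]
    set M : ℤ := (b :: l).length + 1 with hM
    set σ := typeDPerm ((b :: l).length + 1) with hσ
    set v := cs.signedPermHom (cs.typesProd (b :: l)) with hv
    have hM2 : ((b :: l).length + 2 : ℤ) = M + 1 := by rw [hM]; ring
    rw [hM2]
    have h1 : σ M = M + 1 := by
      rw [hσ, typeDPerm_apply (by simp), hM]; push_cast; exact signedSwapFun_left _ _
    have h2 : σ (M + 1) = M := by
      rw [hσ, typeDPerm_apply (by simp), hM]; push_cast; exact signedSwapFun_right _ _
    have hv1 : v (M + 1) = M + 1 :=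
      cs.signedPermHom_typesProd_apply_of_lt (by omega) (by omega)
    have hvM : v M ≠ M + 1 := fun h ↦ by
      have := v.injective (h.trans hv1.symm); omega
    have hσM : ∀ z, σ z = M ↔ z = M + 1 := fun z ↦ by rw [← h2, σ.injective.eq_iff, h2]
    have hσM1 : ∀ z, σ z = M + 1 ↔ z = M := fun z ↦ by rw [← h1, σ.injective.eq_iff]
    -- Recursively, the inner element fixes M exactly if its top level is `empty`. Admissibility
    -- relates this to `a`, and comparing σ v, v σ and σ v σ on M and M + 1 then separates the
    -- types.
    have hb : v M = M ↔ b = empty := by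
      rcases eq_or_ne l [] with rfl | hl'
      · have hb : b ≠ center := hl.1.ne_center (by simp)
        have := cs.signedPermHom_typesProd_singleton_apply_two (by omega) hb
        have hM' : M = 2 := by simp [hM]
        rw [hM', hv, this]
        cases b <;> simp at hb ⊢
      · have := (signedPermHom_typesProd_cons_apply (by simp at hlen; omega) hl' hl.1).1
        have hM' : M = l.length + 2 := by simp [hM]; ring
        rwa [← hM'] at this
    have hne : M + 1 ≠ M := by omega
    have hbc : a = center → b = empty := by
      rintro rfl; simpa using hl.head?_eq
    have hb' : a ≠ empty → a ≠ center → b ≠ empty := fun h h' ↦ by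
      simpa using hl.head?_ne h h'
    cases a <;> simp_all [hasLeft, hasRight, -List.length_cons]

/-- An admissible list of types is determined by the element of the Weyl group. -/
theorem typesProd_injective : ∀ {l l' : List LevelType} (_ : l.length ≤ n)
    (_ : l.length = l'.length) (_ : Admissible l) (_ : Admissible l')
    (_ : cs.typesProd l = cs.typesProd l'), l = l'
  | [], [], _, _, _, _, _ => rfl
  | a :: l, b :: l', hlen, hlen', hl, hl', h => by
    simp only [List.length_cons, Nat.add_right_cancel_iff] at hlen hlen'
    have hab : a = b := by
      rcases eq_or_ne l [] with rfl | hne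
      · obtain rfl : l' = [] := List.length_eq_zero_iff.mp hlen'.symm
        have ha : a ≠ center := hl.ne_center (by simp)
        have hb : b ≠ center := hl'.ne_center (by simp)
        have h1 := cs.signedPermHom_typesProd_singleton_apply_two (by omega) ha
        rw [h, cs.signedPermHom_typesProd_singleton_apply_two (by omega) hb] at h1
        cases a <;> cases b <;> first | rfl | exact absurd rfl ha | exact absurd rfl hb | simp at h1
      · have hne' : l' ≠ [] := by
          rw [← List.length_pos_iff] at hne ⊢; omega
        have h1 := cs.signedPermHom_typesProd_cons_apply hlen hne hl
        have h2 := cs.signedPermHom_typesProd_cons_apply (hlen' ▸ hlen) hne' hl'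
        rw [h, hlen'] at h1
        by_cases ha : a = empty
        · rw [ha, eq_comm, ← h2.1, h1.1, ha]
        · have hb : b ≠ empty := by rwa [ne_eq, ← h2.1, h1.1]
          have h3 := (h1.2 ha).1.symm.trans (h2.2 hb).1
          have h4 := (h1.2 ha).2.symm.trans (h2.2 hb).2
          cases a <;> cases b <;> simp at h3 h4 ha hb ⊢
    subst hab
    have hnil : l' = [] ↔ l = [] := by
      rw [← List.length_eq_zero_iff, ← hlen', List.length_eq_zero_iff]
    rw [typesProd_cons, typesProd_cons, hlen'] at h
    simp only [hnil] at h
    have h' := mul_left_cancel (mul_right_cancel h)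
    rw [typesProd_injective (by omega) hlen' hl.1 hl'.1 h']

theorem BruhatStep.length_lt {B W : Type*} [Group W] {M : CoxeterMatrix B}
    {cs : CoxeterSystem M W} {u v : W} (h : cs.BruhatStep u v) :
    cs.length u < cs.length v := by
  obtain ⟨t, _, _, hlt⟩ := h
  exact hlt

/-- Every element below the element of an admissible list is the element of a smaller admissible
list. -/
theorem BruhatLE.exists_typesProd_eq {u : W} {l : List LevelType} (hlen : l.length ≤ n)
    (hl : Admissible l) (h : cs.BruhatLE u (cs.typesProd l)) :
    ∃ l', Admissible l' ∧ ListLE l' l ∧ u = cs.typesProd l' := by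
  induction h using Relation.ReflTransGen.head_induction_on with
  | refl => exact ⟨l, hl, ListLE.refl l, rfl⟩
  | head hstep _ ih =>
    obtain ⟨l', hl', hle, rfl⟩ := ih
    obtain ⟨j, hj, rfl⟩ := BruhatStep.exists_eraseIdx cs hstep
    obtain ⟨l'', hl'', hle', he⟩ := IsDeletion.exists_typesProd_eq cs (hle.length_eq ▸ hlen) hl'
      ⟨j, by simpa using hj, rfl⟩
    refine ⟨l'', hl'', hle'.trans hle, ?_⟩
    rw [← he, natWordProd, List.eraseIdx_map]

/-- The Bruhat order on the elements of admissible lists is the levelwise order. -/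
theorem bruhatLE_typesProd_iff {l l' : List LevelType} (hlen' : l.length = l'.length)
    (hlen : l'.length ≤ n) (hl : Admissible l) (hl' : Admissible l') :
    cs.BruhatLE (cs.typesProd l) (cs.typesProd l') ↔ ListLE l l' := by
  -- Strong exchange produces some smaller admissible list for the lower element; injectivity
  -- identifies it with `l`.
  have mp : ∀ {l l' : List LevelType}, l.length = l'.length → l'.length ≤ n → Admissible l →
      Admissible l' → cs.BruhatLE (cs.typesProd l) (cs.typesProd l') → ListLE l l' := by
    intro l l' h₁ h₂ hl hl' h
    obtain ⟨m, hm, hle, he⟩ := BruhatLE.exists_typesProd_eq cs h₂ hl' h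
    rwa [cs.typesProd_injective (by omega) (h₁.trans hle.length_eq.symm) hl hm he]
  refine ⟨mp hlen' hlen hl hl', fun h ↦ ?_⟩
  induction hN : cs.length (cs.typesProd l') using Nat.strong_induction_on generalizing l' with
  | _ N ih =>
    by_cases hne : l = l'
    · rw [hne]; exact Relation.ReflTransGen.refl
    obtain ⟨m, hm, hlm, hml, j, hj, he⟩ := cs.exists_isDeletion hlen hl hl' h hne
    have hstep : cs.BruhatStep (cs.typesProd m) (cs.typesProd l') := by
      have hor := cs.bruhatStep_eraseIdx_or ((word l').map (Fin.ofNat (n + 1))) (j := j)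
        (by simpa using hj)
      rw [List.eraseIdx_map] at hor
      change cs.BruhatStep (cs.natWordProd _) (cs.typesProd l') ∨
        cs.BruhatStep (cs.typesProd l') (cs.natWordProd _) at hor
      rw [← he] at hor
      -- A step upwards from `l'` to `m` would give `l' ≤ m` by `mp`, hence `l' = m`, although the
      -- step strictly increases length.
      refine hor.resolve_right fun hs ↦ ?_
      have hle := mp hml.length_eq.symm (hml.length_eq ▸ hlen) hl' hm
        (Relation.ReflTransGen.single hs)
      have := hs.length_lt
      rw [hle.antisymm hml] at this
      exact lt_irrefl _ this
    refine Relation.ReflTransGen.tail ?_ hstep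
    exact ih _ (hN ▸ hstep.length_lt) hlm.length_eq (hml.length_eq ▸ hlen) hm hlm rfl

theorem wordProd_hortonWord (hn : n ≠ 0) :
    cs.wordProd (hortonWord n) = cs.typesProd (List.replicate n both) := by
  obtain ⟨m, rfl⟩ := Nat.exists_eq_succ_of_ne_zero hn
  rw [typesProd, natWordProd, word_replicate_both]
  congr 1
  apply List.map_injective_iff.mpr Fin.val_injective
  have hval : (List.finRange (m + 2)).map Fin.val = List.range (m + 2) :=
    List.ext_getElem (by simp) (by simp)
  rw [List.map_map, hortonWord, List.map_append, List.map_reverse, List.map_drop, hval]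
  refine (List.map_id _).symm.trans (List.map_congr_left fun i hi ↦ ?_)
  have : i < m + 2 := by
    rcases List.mem_append.mp hi with h | h
    · simpa using h
    · simpa using List.mem_of_mem_drop h
  simp [Nat.mod_eq_of_lt this]

end CoxeterSystem

/-! ### Commutation up to a scalar -/

/-- The elements `a` and `b` commute up to the scalar `c`. -/
def CommuteUpTo {k A : Type*} [Field k] [Ring A] [Algebra k A] (c : kˣ) (a b : A) : Prop :=
  a * b = (c : k) • (b * a)

namespace CommuteUpTo

variable {k A : Type*} [Field k] [Ring A] [Algebra k A] {c d : kˣ} {a b a' b' : A}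

theorem symm (h : CommuteUpTo c a b) : CommuteUpTo c⁻¹ b a := by
  rw [CommuteUpTo, h, smul_smul, Units.inv_mul, one_smul]

theorem mul_left (h : CommuteUpTo c a b) (h' : CommuteUpTo d a' b) :
    CommuteUpTo (c * d) (a * a') b := by
  unfold CommuteUpTo at *
  rw [mul_assoc, h', mul_smul_comm, ← mul_assoc, h, smul_mul_assoc, smul_smul, mul_assoc,
    Units.val_mul, mul_comm]

theorem mul_right (h : CommuteUpTo c a b) (h' : CommuteUpTo d a b') :
    CommuteUpTo (c * d) a (b * b') := by
  unfold CommuteUpTo at *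
  rw [← mul_assoc, h, smul_mul_assoc, mul_assoc, h', mul_smul_comm, smul_smul, mul_assoc,
    Units.val_mul]

theorem smul_right (h : CommuteUpTo c a b) (r : k) : CommuteUpTo c a (r • b) := by
  unfold CommuteUpTo at *
  rw [mul_smul_comm, h, smul_mul_assoc, smul_comm]

theorem smul_left (h : CommuteUpTo c a b) (r : k) : CommuteUpTo c (r • a) b := by
  unfold CommuteUpTo at *
  rw [mul_smul_comm, smul_mul_assoc, h, smul_comm]

theorem add_right (h : CommuteUpTo c a b) (h' : CommuteUpTo c a b') :
    CommuteUpTo c a (b + b') := by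
  unfold CommuteUpTo at *
  rw [mul_add, h, h', add_mul, smul_add]

theorem add_left (h : CommuteUpTo c a b) (h' : CommuteUpTo c a' b) :
    CommuteUpTo c (a + a') b := by
  unfold CommuteUpTo at *
  rw [mul_add, add_mul, h, h', smul_add]

theorem sum_right {ι : Type*} {s : Finset ι} {f : ι → A}
    (h : ∀ i ∈ s, CommuteUpTo c a (f i)) : CommuteUpTo c a (∑ i ∈ s, f i) := by
  unfold CommuteUpTo at *
  rw [Finset.mul_sum, Finset.sum_mul, Finset.smul_sum]
  exact Finset.sum_congr rfl h

theorem one_right (a : A) : CommuteUpTo (1 : kˣ) a 1 := by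
  simp [CommuteUpTo]

end CommuteUpTo

/-! ### The normal elements of the Horton algebra -/

namespace HortonAlgebra

variable {k : Type*} [Field k] {n : ℕ} (p q : Fin n → kˣ) (γ : Fin n → Fin n → kˣ)

/-- The generator `x_i`. -/
noncomputable abbrev genX (i : Fin n) : HortonAlgebra p q γ := gen p q γ (.x i)

/-- The generator `y_i`. -/
noncomputable abbrev genY (i : Fin n) : HortonAlgebra p q γ := gen p q γ (.y i)

/-- The element `Ω_m = ∑_{l < m} (q_l - p_l) y_l x_l`, with the indices `l` starting at `0`. -/
noncomputable def omega (m : ℕ) : HortonAlgebra p q γ :=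
  ∑ l : Fin n with l.val < m, (q l - p l : k) • (genY p q γ l * genX p q γ l)

theorem genY_mul_genY (i j : Fin n) :
    CommuteUpTo (γ i j) (genY p q γ i) (genY p q γ j) := by
  have := RingQuot.mkAlgHom_rel k (HortonRel.yy (p := p) (q := q) (γ := γ) i j)
  simp only [map_mul, map_smul] at this
  exact this

theorem genX_mul_genY_of_lt {i j : Fin n} (h : i < j) :
    CommuteUpTo (p j * γ j i) (genX p q γ i) (genY p q γ j) := by
  have := RingQuot.mkAlgHom_rel k (HortonRel.xy_lt (p := p) (q := q) (γ := γ) i j h)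
  simp only [map_mul, map_smul] at this
  exact this

theorem genX_mul_genY_of_gt {i j : Fin n} (h : j < i) :
    CommuteUpTo (q j * γ j i) (genX p q γ i) (genY p q γ j) := by
  have := RingQuot.mkAlgHom_rel k (HortonRel.xy_gt (p := p) (q := q) (γ := γ) i j h)
  simp only [map_mul, map_smul] at this
  exact this

theorem genX_mul_genX_of_lt {i j : Fin n} (h : i < j) :
    CommuteUpTo (q i * (p j)⁻¹ * γ i j) (genX p q γ i) (genX p q γ j) := by
  have := RingQuot.mkAlgHom_rel k (HortonRel.xx (p := p) (q := q) (γ := γ) i j h)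
  simp only [map_mul, map_smul] at this
  rw [← Units.val_inv_eq_inv_val] at this
  exact this

theorem genX_mul_genY_self (i : Fin n) : genX p q γ i * genY p q γ i =
    (q i : k) • (genY p q γ i * genX p q γ i) + omega p q γ i := by
  have := RingQuot.mkAlgHom_rel k (HortonRel.xy_eq (p := p) (q := q) (γ := γ) i)
  simp only [map_mul, map_smul, map_add, map_sum] at this
  have e : (Finset.univ.filter fun l : Fin n ↦ l.val < i) = Finset.Iio i := by
    ext l; simp
  rw [omega, e]
  exact this

theorem omega_zero : omega p q γ 0 = 0 := by simp [omega]

theorem omega_succ (i : Fin n) : omega p q γ (i + 1) =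
    omega p q γ i + (q i - p i : k) • (genY p q γ i * genX p q γ i) := by
  have e : (Finset.univ.filter fun l : Fin n ↦ l.val < i + 1) =
      insert i (Finset.univ.filter fun l : Fin n ↦ l.val < i) := by
    ext l; simp [Fin.ext_iff]; omega
  rw [omega, e, Finset.sum_insert (by simp), add_comm, omega]

theorem omega_succ_of_le {m : ℕ} (h : n ≤ m) : omega p q γ (m + 1) = omega p q γ m := by
  unfold omega
  congr 1
  ext l
  simp
  omega

/-- Moving (q_i - p_i) y_i x_i into the remainder turns Ω_i into Ω_{i+1} and q_i into p_i. Having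
both forms allows the use of whichever Ω lies outside a given prime. -/
theorem genX_mul_genY_self' (i : Fin n) : genX p q γ i * genY p q γ i =
    (p i : k) • (genY p q γ i * genX p q γ i) + omega p q γ (i + 1) := by
  rw [genX_mul_genY_self, omega_succ]
  module

variable {γ} (hγ : ∀ i j, γ i j * γ j i = 1)
include hγ

/-- The factors γ and the parameters of index l from y_l and x_l cancel, so the scalar depends only
on j and on the side of j where l lies. -/
theorem genX_mul_genY_mul_genX {j l : Fin n} (h : j ≠ l) :
    CommuteUpTo (if j < l then q j else p j) (genX p q γ j) (genY p q γ l * genX p q γ l) := by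
  rcases lt_or_gt_of_ne h with h | h
  · convert (genX_mul_genY_of_lt p q γ h).mul_right (genX_mul_genX_of_lt p q γ h) using 1
    rw [if_pos h, eq_inv_of_mul_eq_one_left (hγ j l)]
    exact Units.ext (by push_cast; field_simp)
  · convert (genX_mul_genY_of_gt p q γ h).mul_right (genX_mul_genX_of_lt p q γ h).symm using 1
    rw [if_neg h.not_gt]
    exact Units.ext (by push_cast; field_simp)

theorem genY_mul_genX_mul_genY {j l : Fin n} (h : j ≠ l) :
    CommuteUpTo (if j < l then q j else p j) (genY p q γ l * genX p q γ l) (genY p q γ j) := by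
  rcases lt_or_gt_of_ne h with h | h
  · convert (genY_mul_genY p q γ l j).mul_left (genX_mul_genY_of_gt p q γ h) using 1
    rw [if_pos h, mul_left_comm, hγ, mul_one]
  · convert (genY_mul_genY p q γ l j).mul_left (genX_mul_genY_of_lt p q γ h) using 1
    rw [if_neg h.not_gt, mul_left_comm, hγ, mul_one]

/-- Summands with l < j contribute p_j and those with l > j contribute q_j. At l = j the remainder
Ω_j in x_j y_j corrects the scalar p_j of the earlier summands to q_j. -/
theorem genX_mul_omega (j : Fin n) (m : ℕ) :
    CommuteUpTo (if j < m then q j else p j) (genX p q γ j) (omega p q γ m) := by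
  induction m with
  | zero => simp [omega_zero, CommuteUpTo]
  | succ m ih =>
    by_cases hm : n ≤ m
    · rw [omega_succ_of_le p q γ hm]
      rw [if_pos (by omega)] at ih ⊢
      exact ih
    obtain ⟨i, rfl⟩ : ∃ i : Fin n, (i : ℕ) = m := ⟨⟨m, by omega⟩, rfl⟩
    rcases eq_or_ne j i with rfl | hji
    · rw [if_neg (lt_irrefl _)] at ih
      rw [if_pos (Nat.lt_succ_self _), omega_succ]
      unfold CommuteUpTo at *
      rw [mul_add, ih, mul_smul_comm, ← mul_assoc, genX_mul_genY_self, add_mul, add_mul]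
      simp only [smul_mul_assoc]
      module
    · have hc : (if (j : ℕ) < i + 1 then q j else p j) = if j < i then q j else p j :=
        if_congr (by rw [Fin.lt_def]; have := Fin.val_ne_of_ne hji; omega) rfl rfl
      rw [hc, omega_succ]
      exact ih.add_right ((genX_mul_genY_mul_genX p q hγ hji).smul_right _)

theorem omega_mul_genY (j : Fin n) (m : ℕ) :
    CommuteUpTo (if j < m then q j else p j) (omega p q γ m) (genY p q γ j) := by
  induction m with
  | zero => simp [omega_zero, CommuteUpTo]
  | succ m ih =>
    by_cases hm : n ≤ m
    · rw [omega_succ_of_le p q γ hm]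
      rw [if_pos (by omega)] at ih ⊢
      exact ih
    obtain ⟨i, rfl⟩ : ∃ i : Fin n, (i : ℕ) = m := ⟨⟨m, by omega⟩, rfl⟩
    rcases eq_or_ne j i with rfl | hji
    · rw [if_neg (lt_irrefl _)] at ih
      rw [if_pos (Nat.lt_succ_self _), omega_succ]
      unfold CommuteUpTo at *
      rw [add_mul, ih, smul_mul_assoc, mul_assoc, genX_mul_genY_self, mul_add, mul_add]
      simp only [mul_smul_comm]
      module
    · have hc : (if (j : ℕ) < i + 1 then q j else p j) = if j < i then q j else p j :=
        if_congr (by rw [Fin.lt_def]; have := Fin.val_ne_of_ne hji; omega) rfl rfl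
      rw [hc, omega_succ]
      exact ih.add_left ((genY_mul_genX_mul_genY p q hγ hji).smul_left _)

/-- In each summand y_i x_i the scalars from y_i and x_i are inverse to each other. -/
theorem omega_mul_omega (l m : ℕ) : CommuteUpTo (1 : kˣ) (omega p q γ l) (omega p q γ m) := by
  rw [omega.eq_def p q γ m]
  refine CommuteUpTo.sum_right fun i _ ↦ CommuteUpTo.smul_right ?_ _
  convert (omega_mul_genY p q hγ i l).mul_right (genX_mul_omega p q hγ i l).symm using 1
  rw [mul_inv_cancel]

end HortonAlgebra

/-! ### Letters and their commutation scalars -/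

/-- The letters `x_i, y_i, Ω_i`, where `Ω_i` stands for the element `omega (i + 1)`. -/
inductive HortonLetter (n : ℕ) : Type
  | x (i : Fin n) : HortonLetter n
  | y (i : Fin n) : HortonLetter n
  | omega (i : Fin n) : HortonLetter n
  deriving DecidableEq

namespace HortonLetter

variable {k : Type*} [Field k] {n : ℕ} (p q : Fin n → kˣ) (γ : Fin n → Fin n → kˣ)

/-- The element of the Horton algebra denoted by a letter. -/
noncomputable def val : HortonLetter n → HortonAlgebra p q γ
  | x i => HortonAlgebra.genX p q γ i
  | y i => HortonAlgebra.genY p q γ i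
  | omega i => HortonAlgebra.omega p q γ (i + 1)

/-- The scalar up to which two letters commute. -/
def comm : HortonLetter n → HortonLetter n → kˣ
  | x i, x j => if i < j then q i * (p j)⁻¹ * γ i j
      else if j < i then (q j * (p i)⁻¹ * γ j i)⁻¹ else 1
  | x i, y j => (if i < j then p j else q j) * γ j i
  | y j, x i => ((if i < j then p j else q j) * γ j i)⁻¹
  | y i, y j => γ i j
  | x j, omega i => if j ≤ i then q j else p j
  | omega i, x j => (if j ≤ i then q j else p j)⁻¹
  | omega i, y j => if j ≤ i then q j else p j
  | y j, omega i => (if j ≤ i then q j else p j)⁻¹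
  | omega _, omega _ => 1

/-- The letters `x_i` and `y_i` are opposite. -/
def IsOpposite : HortonLetter n → HortonLetter n → Prop
  | x i, y j => i = j
  | y i, x j => i = j
  | _, _ => False

theorem IsOpposite.symm {g h : HortonLetter n} (H : IsOpposite g h) : IsOpposite h g := by
  cases g <;> cases h <;> simp_all [IsOpposite]

variable {γ}

theorem commuteUpTo_x_x {i j : Fin n} :
    CommuteUpTo (comm p q γ (x i) (x j)) (val p q γ (x i)) (val p q γ (x j)) := by
  rw [comm]
  split_ifs with h h'
  · exact HortonAlgebra.genX_mul_genX_of_lt p q γ h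
  · exact (HortonAlgebra.genX_mul_genX_of_lt p q γ h').symm
  · obtain rfl : i = j := by omega
    simp [CommuteUpTo]

theorem commuteUpTo_x_y {i j : Fin n} (H : i ≠ j) :
    CommuteUpTo (comm p q γ (x i) (y j)) (val p q γ (x i)) (val p q γ (y j)) := by
  rw [comm]
  split_ifs with h
  · exact HortonAlgebra.genX_mul_genY_of_lt p q γ h
  · exact HortonAlgebra.genX_mul_genY_of_gt p q γ (lt_of_le_of_ne (not_lt.mp h) (Ne.symm H))

variable (hγ : ∀ i j, γ i j * γ j i = 1)
include hγ

theorem commuteUpTo_x_omega {i j : Fin n} :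
    CommuteUpTo (comm p q γ (x j) (omega i)) (val p q γ (x j)) (val p q γ (omega i)) := by
  have := HortonAlgebra.genX_mul_omega p q hγ j (i + 1)
  rwa [if_congr (show (j : ℕ) < i + 1 ↔ j ≤ i by rw [Fin.le_def]; omega) rfl rfl] at this

theorem commuteUpTo_omega_y {i j : Fin n} :
    CommuteUpTo (comm p q γ (omega i) (y j)) (val p q γ (omega i)) (val p q γ (y j)) := by
  have := HortonAlgebra.omega_mul_genY p q hγ j (i + 1)
  rwa [if_congr (show (j : ℕ) < i + 1 ↔ j ≤ i by rw [Fin.le_def]; omega) rfl rfl] at this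

theorem commuteUpTo {g h : HortonLetter n} (H : ¬IsOpposite g h) :
    CommuteUpTo (comm p q γ g h) (val p q γ g) (val p q γ h) := by
  cases g <;> cases h
  · exact commuteUpTo_x_x p q
  · exact commuteUpTo_x_y p q H
  · exact commuteUpTo_x_omega p q hγ
  · exact (commuteUpTo_x_y p q (Ne.symm H)).symm
  · exact HortonAlgebra.genY_mul_genY p q γ _ _
  · exact (commuteUpTo_omega_y p q hγ).symm
  · exact (commuteUpTo_x_omega p q hγ).symm
  · exact commuteUpTo_omega_y p q hγ
  · exact HortonAlgebra.omega_mul_omega p q hγ _ _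

end HortonLetter

/-! ### Monomials in the letters -/

namespace HortonLetter

variable {k : Type*} [Field k] {n : ℕ} (p q : Fin n → kˣ) (γ : Fin n → Fin n → kˣ)

/-- The product of a word of letters in the Horton algebra. -/
noncomputable def prodVal (l : List (HortonLetter n)) : HortonAlgebra p q γ :=
  (l.map (val p q γ)).prod

/-- A multiset of letters is reduced if it contains no two opposite letters. -/
def Reduced (m : Multiset (HortonLetter n)) : Prop :=
  ∀ g ∈ m, ∀ h ∈ m, ¬IsOpposite g h

/-- The product of the letters of a multiset, in a chosen order. -/
noncomputable def monomial (m : Multiset (HortonLetter n)) : HortonAlgebra p q γ :=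
  prodVal p q γ m.toList

theorem prodVal_cons (g : HortonLetter n) (l : List (HortonLetter n)) :
    prodVal p q γ (g :: l) = val p q γ g * prodVal p q γ l := by
  simp [prodVal]

theorem prodVal_append (l l' : List (HortonLetter n)) :
    prodVal p q γ (l ++ l') = prodVal p q γ l * prodVal p q γ l' := by
  simp [prodVal]

theorem prodVal_replicate (g : HortonLetter n) (r : ℕ) :
    prodVal p q γ (List.replicate r g) = val p q γ g ^ r := by
  simp [prodVal]

theorem monomial_zero : monomial p q γ 0 = 1 := by simp [monomial, prodVal]

theorem not_isOpposite_self (g : HortonLetter n) : ¬IsOpposite g g := by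
  cases g <;> simp [IsOpposite]

theorem Reduced.mono {m m' : Multiset (HortonLetter n)} (h : Reduced m) (hm : m' ≤ m) :
    Reduced m' := fun g hg g' hg' ↦
  h g (Multiset.mem_of_le hm hg) g' (Multiset.mem_of_le hm hg')

theorem reduced_cons {g : HortonLetter n} {m : Multiset (HortonLetter n)} (h : Reduced m)
    (hg : ∀ h ∈ m, ¬IsOpposite g h) : Reduced (g ::ₘ m) := by
  intro a ha b hb
  rw [Multiset.mem_cons] at ha hb
  rcases ha with h₁ | h₁ <;> rcases hb with h₂ | h₂
  · rw [h₁, h₂]; exact not_isOpposite_self _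
  · rw [h₁]; exact hg _ h₂
  · rw [h₂]; exact fun H ↦ hg _ h₁ H.symm
  · exact h _ h₁ _ h₂

/-- The scalar up to which a letter commutes with a monomial. -/
def commScalar (g : HortonLetter n) (m : Multiset (HortonLetter n)) : kˣ :=
  (m.map (comm p q γ g)).prod

variable {γ} (hγ : ∀ i j, γ i j * γ j i = 1)
include hγ

/-- Any two letters of a reduced word commute up to a unit, so each transposition costs only a unit.
Hence the order chosen in `monomial` is immaterial. -/
theorem prodVal_perm {l l' : List (HortonLetter n)} (h : l.Perm l')
    (hl : Reduced (l : Multiset (HortonLetter n))) :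
    ∃ c : kˣ, prodVal p q γ l = (c : k) • prodVal p q γ l' := by
  induction h with
  | nil => exact ⟨1, by simp⟩
  | cons g h ih =>
    obtain ⟨c, hc⟩ := ih (hl.mono (by rw [← Multiset.cons_coe]; exact Multiset.le_cons_self _ _))
    exact ⟨c, by rw [prodVal_cons, prodVal_cons, hc, mul_smul_comm]⟩
  | swap g h l =>
    refine ⟨comm p q γ h g, ?_⟩
    rw [prodVal_cons, prodVal_cons, prodVal_cons, prodVal_cons, ← mul_assoc, ← mul_assoc,
      commuteUpTo p q hγ (hl h (by simp) g (by simp)), smul_mul_assoc]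
  | trans h₁ h₂ ih₁ ih₂ =>
    obtain ⟨c, hc⟩ := ih₁ hl
    obtain ⟨d, hd⟩ := ih₂ (by rwa [← Multiset.coe_eq_coe.mpr h₁])
    exact ⟨c * d, by rw [hc, hd, smul_smul, Units.val_mul]⟩

theorem prodVal_eq_smul_monomial {l : List (HortonLetter n)}
    (hl : Reduced (l : Multiset (HortonLetter n))) :
    ∃ c : kˣ, prodVal p q γ l = (c : k) • monomial p q γ l :=
  prodVal_perm p q hγ (Multiset.coe_eq_coe.mp (Multiset.coe_toList _).symm) hl

theorem val_mul_monomial {g : HortonLetter n} {m : Multiset (HortonLetter n)}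
    (hm : Reduced (g ::ₘ m)) :
    ∃ c : kˣ, val p q γ g * monomial p q γ m = (c : k) • monomial p q γ (g ::ₘ m) := by
  have e : ((g :: m.toList : List (HortonLetter n)) : Multiset (HortonLetter n)) = g ::ₘ m := by
    rw [← Multiset.cons_coe, Multiset.coe_toList]
  obtain ⟨c, hc⟩ := prodVal_eq_smul_monomial p q hγ (l := g :: m.toList) (by rwa [e])
  refine ⟨c, ?_⟩
  rw [e, prodVal_cons] at hc
  exact hc

theorem commuteUpTo_prodVal {g : HortonLetter n} {l : List (HortonLetter n)}
    (hg : ∀ h ∈ l, ¬IsOpposite g h) :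
    CommuteUpTo (commScalar p q γ g l) (val p q γ g) (prodVal p q γ l) := by
  induction l with
  | nil => simpa [commScalar, prodVal] using CommuteUpTo.one_right _
  | cons h l ih =>
    rw [prodVal_cons]
    have := (commuteUpTo p q hγ (hg h List.mem_cons_self)).mul_right
      (ih fun g' hg' ↦ hg g' (List.mem_cons_of_mem _ hg'))
    simpa only [commScalar, ← Multiset.cons_coe, Multiset.map_cons, Multiset.prod_cons] using this

theorem commuteUpTo_monomial {g : HortonLetter n} {m : Multiset (HortonLetter n)}
    (hg : ∀ h ∈ m, ¬IsOpposite g h) :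
    CommuteUpTo (commScalar p q γ g m) (val p q γ g) (monomial p q γ m) := by
  have := commuteUpTo_prodVal p q hγ (g := g) (l := m.toList) (by simpa using hg)
  rwa [Multiset.coe_toList] at this

omit hγ

variable (γ)

/-- The scalar by which the torus acts on a letter. -/
def weight (h : HortonAlgebra.Torus k n) : HortonLetter n → kˣ
  | x i => h.1 i
  | y i => h.2 * (h.1 i)⁻¹
  | omega _ => h.2

/-- The scalar by which the torus acts on a monomial. -/
def monomialWeight (h : HortonAlgebra.Torus k n) (m : Multiset (HortonLetter n)) : kˣ :=
  (m.map (weight h)).prod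

theorem torusAction_apply (h : HortonAlgebra.Torus k n) (a : HortonAlgebra p q γ) :
    HortonAlgebra.torusAction p q γ h a = HortonAlgebra.torusEnd p q γ h a := rfl

theorem torusAction_val (h : HortonAlgebra.Torus k n) (g : HortonLetter n) :
    HortonAlgebra.torusAction p q γ h (val p q γ g) = (weight h g : k) • val p q γ g := by
  rw [torusAction_apply]
  cases g with
  | x i => exact HortonAlgebra.torusEnd_gen p q γ h _
  | y i => exact HortonAlgebra.torusEnd_gen p q γ h _
  | omega i =>
    simp only [val, HortonAlgebra.omega, map_sum, map_smul, map_mul, Finset.smul_sum,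
      HortonAlgebra.torusEnd_gen, smul_mul_smul_comm]
    refine Finset.sum_congr rfl fun l _ ↦ ?_
    rw [smul_comm]
    congr 2
    simp [HortonAlgebra.weight, weight]

theorem torusAction_monomial (h : HortonAlgebra.Torus k n) (m : Multiset (HortonLetter n)) :
    HortonAlgebra.torusAction p q γ h (monomial p q γ m) =
      (monomialWeight h m : k) • monomial p q γ m := by
  have key : ∀ l : List (HortonLetter n), HortonAlgebra.torusAction p q γ h (prodVal p q γ l) =
      (monomialWeight h l : k) • prodVal p q γ l := by
    intro l
    induction l with
    | nil => simp [prodVal, monomialWeight]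
    | cons g l ih =>
      rw [prodVal_cons, map_mul, ih, torusAction_val, smul_mul_smul_comm, ← Units.val_mul]
      simp only [monomialWeight, ← Multiset.cons_coe, Multiset.map_cons, Multiset.prod_cons]
  rw [monomial, key, Multiset.coe_toList]

end HortonLetter

/-- A two-sided ideal of an algebra, as a submodule. -/
def TwoSidedIdeal.asSubmodule (k : Type*) {A : Type*} [Field k] [Ring A] [Algebra k A]
    (I : TwoSidedIdeal A) : Submodule k A where
  carrier := I
  add_mem' := I.add_mem
  zero_mem' := I.zero_mem
  smul_mem' c a ha := by
    rw [Algebra.smul_def]; exact I.mul_mem_left _ _ ha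

theorem TwoSidedIdeal.smul_mem_of_mem {k A : Type*} [Field k] [Ring A] [Algebra k A]
    (I : TwoSidedIdeal A) (c : k) {a : A} (ha : a ∈ I) : c • a ∈ I :=
  (I.asSubmodule k).smul_mem c ha

theorem TwoSidedIdeal.smul_mem_iff_of_ne_zero {k A : Type*} [Field k] [Ring A] [Algebra k A]
    (I : TwoSidedIdeal A) {c : k} (hc : c ≠ 0) {a : A} : c • a ∈ I ↔ a ∈ I :=
  (I.asSubmodule k).smul_mem_iff hc

namespace HortonAlgebra

variable {k : Type*} [Field k] {n : ℕ} {p q : Fin n → kˣ} {γ : Fin n → Fin n → kˣ}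

theorem induction_gen {C : HortonAlgebra p q γ → Prop} (algebraMap : ∀ c : k, C (algebraMap k _ c))
    (gen : ∀ g, C (gen p q γ g)) (mul : ∀ a b, C a → C b → C (a * b))
    (add : ∀ a b, C a → C b → C (a + b)) (a : HortonAlgebra p q γ) : C a := by
  obtain ⟨a, rfl⟩ := RingQuot.mkAlgHom_surjective k (HortonRel p q γ) a
  induction a using FreeAlgebra.induction with
  | grade0 r => rw [AlgHom.commutes]; exact algebraMap r
  | grade1 x => exact gen x
  | mul a b ha hb => rw [map_mul]; exact mul _ _ ha hb
  | add a b ha hb => rw [map_add]; exact add _ _ ha hb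

theorem genY_mul_genX_self {i : Fin n} (h : (q i : k) ≠ p i) : genY p q γ i * genX p q γ i =
    (q i - p i : k)⁻¹ • (omega p q γ (i + 1) - omega p q γ i) := by
  rw [omega_succ, add_sub_cancel_left, inv_smul_smul₀ (sub_ne_zero.mpr h)]

end HortonAlgebra

/-! ### Spanning by reduced monomials -/

namespace HortonLetter

variable {k : Type*} [Field k] {n : ℕ} {p q : Fin n → kˣ} {γ : Fin n → Fin n → kˣ}

/-- The reduced multisets of letters that do not lie in an ideal. -/
def ReducedMod (I : TwoSidedIdeal (HortonAlgebra p q γ)) (m : Multiset (HortonLetter n)) : Prop :=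
  Reduced m ∧ ∀ g ∈ m, val p q γ g ∉ I

/-- The span of an ideal and the reduced monomials in the letters outside of it. -/
noncomputable def spanMod (I : TwoSidedIdeal (HortonAlgebra p q γ)) :
    Submodule k (HortonAlgebra p q γ) :=
  I.asSubmodule k ⊔ Submodule.span k (monomial p q γ '' {m | ReducedMod I m})

variable {I : TwoSidedIdeal (HortonAlgebra p q γ)}

theorem mem_spanMod_of_mem {a : HortonAlgebra p q γ} (ha : a ∈ I) : a ∈ spanMod I :=
  Submodule.mem_sup_left (show a ∈ I.asSubmodule k from ha)

variable (hγ : ∀ i j, γ i j * γ j i = 1)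
include hγ

theorem val_mul_monomial_mem_spanMod {g : HortonLetter n} {m : Multiset (HortonLetter n)}
    (hm : ReducedMod I m) (hg : ∀ h ∈ m, ¬IsOpposite g h) :
    val p q γ g * monomial p q γ m ∈ spanMod I := by
  by_cases hgI : val p q γ g ∈ I
  · exact mem_spanMod_of_mem (I.mul_mem_right _ _ hgI)
  · have hr := reduced_cons hm.1 hg
    obtain ⟨c, hc⟩ := val_mul_monomial p q hγ hr
    rw [hc]
    refine Submodule.smul_mem _ _ (Submodule.mem_sup_right (Submodule.subset_span ⟨_, ?_, rfl⟩))
    refine ⟨hr, fun h hh ↦ ?_⟩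
    rcases Multiset.mem_cons.mp hh with rfl | hh
    exacts [hgI, hm.2 _ hh]

theorem omega_mul_monomial_mem_spanMod {j : ℕ} (hj : j ≤ n) {m : Multiset (HortonLetter n)}
    (hm : ReducedMod I m) : HortonAlgebra.omega p q γ j * monomial p q γ m ∈ spanMod I := by
  rcases j with _ | j
  · rw [HortonAlgebra.omega_zero, zero_mul]; exact Submodule.zero_mem _
  · exact val_mul_monomial_mem_spanMod hγ (g := omega ⟨j, hj⟩) hm fun h _ ↦ by
      cases h <;> simp [IsOpposite]

omit hγ in
-- Since q_i ≠ p_i, an opposite pair is a combination of Ω_i and Ω_{i+1}. These have no opposite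
-- letters, so removing one pair creates no new one.
theorem exists_val_mul_val (hpq : ∀ i, (q i : k) ≠ p i) {g h : HortonLetter n}
    (H : IsOpposite g h) : ∃ (a b : k) (i : Fin n), val p q γ g * val p q γ h =
      a • HortonAlgebra.omega p q γ i + b • HortonAlgebra.omega p q γ (i + 1) := by
  have hyx := fun i ↦ HortonAlgebra.genY_mul_genX_self (γ := γ) (hpq i)
  cases g <;> cases h <;> simp only [IsOpposite] at H
  · subst H
    rename_i i
    refine ⟨1 - q i * (q i - p i : k)⁻¹, q i * (q i - p i : k)⁻¹, i, ?_⟩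
    rw [val, val, HortonAlgebra.genX_mul_genY_self, hyx]
    module
  · subst H
    rename_i i
    exact ⟨-(q i - p i : k)⁻¹, (q i - p i : k)⁻¹, i, by rw [val, val, hyx]; module⟩

theorem val_mul_mem_spanMod (hpq : ∀ i, (q i : k) ≠ p i) (g : HortonLetter n)
    {a : HortonAlgebra p q γ} (ha : a ∈ spanMod I) : val p q γ g * a ∈ spanMod I := by
  have key : ∀ m, ReducedMod I m → val p q γ g * monomial p q γ m ∈ spanMod I := by
    intro m hm
    by_cases hg : ∀ h ∈ m, ¬IsOpposite g h
    · exact val_mul_monomial_mem_spanMod hγ hm hg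
    · push Not at hg
      obtain ⟨h, hh, hgh⟩ := hg
      obtain ⟨m, rfl⟩ := Multiset.exists_cons_of_mem hh
      have hm' : ReducedMod I m := ⟨hm.1.mono (Multiset.le_cons_self _ _),
        fun g hg ↦ hm.2 g (Multiset.mem_cons_of_mem hg)⟩
      -- The opposite letter `h` is brought to the front, where the product of `g` and `h` collapses
      -- to Ω's.
      obtain ⟨c, hc⟩ := val_mul_monomial p q hγ hm.1
      obtain ⟨a, b, i, hab⟩ := exists_val_mul_val hpq hgh
      rw [← inv_smul_eq_iff₀ c.ne_zero] at hc
      rw [← hc, mul_smul_comm, ← mul_assoc, hab, add_mul, smul_mul_assoc, smul_mul_assoc]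
      exact Submodule.smul_mem _ _ (Submodule.add_mem _
        (Submodule.smul_mem _ _ (omega_mul_monomial_mem_spanMod hγ i.2.le hm'))
        (Submodule.smul_mem _ _ (omega_mul_monomial_mem_spanMod hγ i.2 hm')))
  have hle : spanMod I ≤ (spanMod I).comap (LinearMap.mulLeft k (val p q γ g)) := by
    refine sup_le (fun a ha ↦ mem_spanMod_of_mem (I.mul_mem_left _ _ ha)) ?_
    rw [Submodule.span_le]
    rintro _ ⟨m, hm, rfl⟩
    exact key m hm
  exact hle ha

/-- The reduced monomials in the letters outside of an ideal span the quotient by the ideal. -/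
theorem spanMod_eq_top (hpq : ∀ i, (q i : k) ≠ p i) : spanMod I = ⊤ := by
  have key : ∀ a : HortonAlgebra p q γ, ∀ s ∈ spanMod I, a * s ∈ spanMod I := by
    intro a
    induction a using HortonAlgebra.induction_gen with
    | algebraMap c => intro s hs; rw [← Algebra.smul_def]; exact Submodule.smul_mem _ _ hs
    | gen g =>
      intro s hs
      cases g with
      | x i => exact val_mul_mem_spanMod hγ hpq (x i) hs
      | y i => exact val_mul_mem_spanMod hγ hpq (y i) hs
    | mul a b ha hb => intro s hs; rw [mul_assoc]; exact ha _ (hb _ hs)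
    | add a b ha hb => intro s hs; rw [add_mul]; exact Submodule.add_mem _ (ha _ hs) (hb _ hs)
  refine eq_top_iff.mpr fun a _ ↦ ?_
  rw [← mul_one a]
  refine key a 1 (Submodule.mem_sup_right (Submodule.subset_span ⟨0, ?_, monomial_zero p q γ⟩))
  exact ⟨fun g hg ↦ by simp at hg, fun g hg ↦ by simp at hg⟩

end HortonLetter

/-! ### Prime ideals of the Horton algebra -/

/-- Primeness is applied to I = {u | u A b ⊆ P} and J = {v | I A v ⊆ P}: these are two-sided ideals
with I J ⊆ P, a ∈ I and b ∈ J. -/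
theorem TwoSidedIdeal.IsPrimeIdeal.mem_or_mem {A : Type*} [Ring A] {P : TwoSidedIdeal A}
    (hP : P.IsPrimeIdeal) {a b : A} (h : ∀ r, a * r * b ∈ P) : a ∈ P ∨ b ∈ P := by
  let I : TwoSidedIdeal A := TwoSidedIdeal.mk' {u | ∀ r, u * r * b ∈ P}
    (fun r ↦ by rw [zero_mul, zero_mul]; exact P.zero_mem)
    (fun {u v} hu hv r ↦ by rw [add_mul, add_mul]; exact P.add_mem (hu r) (hv r))
    (fun {u} hu r ↦ by rw [neg_mul, neg_mul]; exact P.neg_mem (hu r))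
    (fun {s u} hu r ↦ by rw [mul_assoc, mul_assoc, ← mul_assoc u]; exact P.mul_mem_left _ _ (hu r))
    (fun {u s} hu r ↦ by rw [mul_assoc u]; exact hu _)
  let J : TwoSidedIdeal A := TwoSidedIdeal.mk' {v | ∀ u ∈ I, ∀ r, u * r * v ∈ P}
    (fun u _ r ↦ by rw [mul_zero]; exact P.zero_mem)
    (fun {v w} hv hw u hu r ↦ by rw [mul_add]; exact P.add_mem (hv u hu r) (hw u hu r))
    (fun {v} hv u hu r ↦ by rw [mul_neg]; exact P.neg_mem (hv u hu r))
    (fun {s v} hv u hu r ↦ by rw [← mul_assoc, mul_assoc u]; exact hv u hu _)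
    (fun {v s} hv u hu r ↦ by rw [← mul_assoc]; exact P.mul_mem_right _ _ (hv u hu r))
  have hI : ∀ u, u ∈ I ↔ ∀ r, u * r * b ∈ P := fun u ↦ by
    simp only [I, TwoSidedIdeal.mem_mk', Set.mem_ofPred_eq]
  have hJ : ∀ v, v ∈ J ↔ ∀ u ∈ I, ∀ r, u * r * v ∈ P := fun v ↦ by
    simp only [J, TwoSidedIdeal.mem_mk', Set.mem_ofPred_eq]
  rcases hP.2 I J (fun u hu v hv ↦ by simpa using (hJ v).mp hv u hu 1) with h' | h'
  · exact Or.inl (h' ((hI a).mpr h))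
  · exact Or.inr (h' ((hJ b).mpr fun u hu ↦ (hI u).mp hu))

theorem TwoSidedIdeal.IsPrimeIdeal.one_notMem {A : Type*} [Ring A] {P : TwoSidedIdeal A}
    (hP : P.IsPrimeIdeal) : (1 : A) ∉ P := fun h ↦ hP.1 ((P.one_mem_iff).mp h)

/-- If `x y = α y x + w` and `x w = β w x`, then
`(α - β) (x ^ r y - α ^ r y x ^ r) = (α ^ r - β ^ r) w x ^ (r - 1)`. -/
theorem smul_pow_mul_sub {k A : Type*} [Field k] [Ring A] [Algebra k A] {x y w : A} {α β : k}
    (hxy : x * y = α • (y * x) + w) (hxw : x * w = β • (w * x)) (r : ℕ) :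
    (α - β) • (x ^ (r + 1) * y - α ^ (r + 1) • (y * x ^ (r + 1))) =
      (α ^ (r + 1) - β ^ (r + 1)) • (w * x ^ r) := by
  induction r with
  | zero => simp [hxy]
  | succ r ih =>
    have h1 : x ^ (r + 2) * y = x * (x ^ (r + 1) * y) := by rw [pow_succ' x, mul_assoc]
    have h2 : (α - β) • (x ^ (r + 1) * y) = (α - β) • α ^ (r + 1) • (y * x ^ (r + 1)) +
        (α ^ (r + 1) - β ^ (r + 1)) • (w * x ^ r) := by rw [← ih]; module
    have h3 : x * (y * x ^ (r + 1)) = α • (y * x ^ (r + 2)) + w * x ^ (r + 1) := by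
      rw [← mul_assoc, hxy, add_mul, smul_mul_assoc, mul_assoc, ← pow_succ']
    have h4 : x * (w * x ^ r) = β • (w * x ^ (r + 1)) := by
      rw [← mul_assoc, hxw, smul_mul_assoc, mul_assoc, ← pow_succ']
    rw [smul_sub, h1, ← mul_smul_comm, h2, mul_add, mul_smul_comm, mul_smul_comm, mul_smul_comm,
      h3, h4]
    module

theorem CommuteUpTo.exists_sub_mem {k A : Type*} [Field k] [Ring A] [Algebra k A] {c : kˣ}
    {a b : A} (h : CommuteUpTo c a b) (P : TwoSidedIdeal A) :
    ∃ d : k, a * b - d • (b * a) ∈ P :=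
  ⟨c, by rw [h, sub_self]; exact P.zero_mem⟩

namespace HortonLetter

variable {k : Type*} [Field k] {n : ℕ} {p q : Fin n → kˣ} {γ : Fin n → Fin n → kˣ}
  {P : TwoSidedIdeal (HortonAlgebra p q γ)}

theorem ReducedMod.mono {m m' : Multiset (HortonLetter n)} (h : ReducedMod P m) (hm : m' ≤ m) :
    ReducedMod P m' :=
  ⟨h.1.mono hm, fun g hg ↦ h.2 g (Multiset.mem_of_le hm hg)⟩

/-- An element that commutes with all the generators up to scalars modulo a prime ideal can be
cancelled modulo the ideal. -/
theorem mem_or_mem_of_mul_mem (hP : P.IsPrimeIdeal) {a b : HortonAlgebra p q γ}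
    (ha : ∀ g, ∃ c : k, a * HortonAlgebra.gen p q γ g - c • (HortonAlgebra.gen p q γ g * a) ∈ P)
    (h : a * b ∈ P) : a ∈ P ∨ b ∈ P := by
  refine hP.mem_or_mem fun r ↦ ?_
  -- Normality modulo P passes from the generators to sums and products.
  have key : ∃ r', a * r - r' * a ∈ P := by
    induction r using HortonAlgebra.induction_gen with
    | algebraMap c => exact ⟨_, by rw [← Algebra.commutes c a, sub_self]; exact P.zero_mem⟩
    | gen g =>
      obtain ⟨c, hc⟩ := ha g
      exact ⟨c • HortonAlgebra.gen p q γ g, by rwa [smul_mul_assoc]⟩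
    | mul r s hr hs =>
      obtain ⟨r', hr⟩ := hr
      obtain ⟨s', hs⟩ := hs
      refine ⟨r' * s', ?_⟩
      have : a * (r * s) - r' * s' * a = (a * r - r' * a) * s + r' * (a * s - s' * a) := by
        simp only [sub_mul, mul_sub, mul_assoc]; abel
      rw [this]
      exact P.add_mem (P.mul_mem_right _ _ hr) (P.mul_mem_left _ _ hs)
    | add r s hr hs =>
      obtain ⟨r', hr⟩ := hr
      obtain ⟨s', hs⟩ := hs
      refine ⟨r' + s', ?_⟩
      have : a * (r + s) - (r' + s') * a = (a * r - r' * a) + (a * s - s' * a) := by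
        simp only [add_mul, mul_add]; abel
      rw [this]
      exact P.add_mem hr hs
  obtain ⟨r', hr⟩ := key
  have : a * r * b = (a * r - r' * a) * b + r' * (a * b) := by
    simp only [sub_mul, mul_assoc]; abel
  rw [this]
  exact P.add_mem (P.mul_mem_right _ _ hr) (P.mul_mem_left _ _ h)

variable (hγ : ∀ i j, γ i j * γ j i = 1)
include hγ

theorem omega_mem_or_mem (hP : P.IsPrimeIdeal) {m : ℕ} {b : HortonAlgebra p q γ}
    (h : HortonAlgebra.omega p q γ m * b ∈ P) : HortonAlgebra.omega p q γ m ∈ P ∨ b ∈ P := by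
  refine mem_or_mem_of_mul_mem hP (fun g ↦ ?_) h
  cases g with
  | x j =>
    exact (HortonAlgebra.genX_mul_omega p q hγ j m).symm.exists_sub_mem P
  | y j =>
    exact (HortonAlgebra.omega_mul_genY p q hγ j m).exists_sub_mem P

/-- Once Ω_i vanishes modulo P, x_i commutes up to scalars with y_i too, so it is normal there. -/
theorem genX_mem_or_mem (hP : P.IsPrimeIdeal) {i : Fin n} {b : HortonAlgebra p q γ}
    (hi : HortonAlgebra.omega p q γ i ∈ P) (h : HortonAlgebra.genX p q γ i * b ∈ P) :
    HortonAlgebra.genX p q γ i ∈ P ∨ b ∈ P := by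
  refine mem_or_mem_of_mul_mem hP (fun g ↦ ?_) h
  cases g with
  | x j =>
    exact (commuteUpTo p q hγ (g := x i) (h := x j) id).exists_sub_mem P
  | y j =>
    by_cases hij : i = j
    · subst hij
      exact ⟨q i, by rwa [HortonAlgebra.genX_mul_genY_self, add_sub_cancel_left]⟩
    · exact (commuteUpTo p q hγ (g := x i) (h := y j) hij).exists_sub_mem P

theorem genY_mem_or_mem (hP : P.IsPrimeIdeal) {i : Fin n} {b : HortonAlgebra p q γ}
    (hi : HortonAlgebra.omega p q γ i ∈ P) (h : HortonAlgebra.genY p q γ i * b ∈ P) :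
    HortonAlgebra.genY p q γ i ∈ P ∨ b ∈ P := by
  refine mem_or_mem_of_mul_mem hP (fun g ↦ ?_) h
  cases g with
  | x j =>
    by_cases hij : i = j
    · subst hij
      refine ⟨(q i : k)⁻¹, ?_⟩
      rw [HortonAlgebra.genX_mul_genY_self, smul_add, inv_smul_smul₀ (q i).ne_zero,
        sub_add_cancel_left]
      exact P.neg_mem (P.smul_mem_of_mem _ hi)
    · exact (commuteUpTo p q hγ (g := y i) (h := x j) hij).exists_sub_mem P
  | y j =>
    exact (commuteUpTo p q hγ (g := y i) (h := y j) id).exists_sub_mem P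

omit hγ in
-- The two forms of the relation between x_i and y_i express Ω_i and Ω_{i+1} through multiples of
-- x_i.
theorem omega_mem_of_genX_mem {i : Fin n} (h : HortonAlgebra.genX p q γ i ∈ P) :
    HortonAlgebra.omega p q γ i ∈ P ∧ HortonAlgebra.omega p q γ (i + 1) ∈ P := by
  constructor
  · rw [← sub_eq_iff_eq_add'.mpr (HortonAlgebra.genX_mul_genY_self p q γ i)]
    exact P.sub_mem (P.mul_mem_right _ _ h) (P.smul_mem_of_mem _ (P.mul_mem_left _ _ h))
  · rw [← sub_eq_iff_eq_add'.mpr (HortonAlgebra.genX_mul_genY_self' p q γ i)]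
    exact P.sub_mem (P.mul_mem_right _ _ h) (P.smul_mem_of_mem _ (P.mul_mem_left _ _ h))

omit hγ in
theorem omega_mem_of_genY_mem {i : Fin n} (h : HortonAlgebra.genY p q γ i ∈ P) :
    HortonAlgebra.omega p q γ i ∈ P ∧ HortonAlgebra.omega p q γ (i + 1) ∈ P := by
  constructor
  · rw [← sub_eq_iff_eq_add'.mpr (HortonAlgebra.genX_mul_genY_self p q γ i)]
    exact P.sub_mem (P.mul_mem_left _ _ h) (P.smul_mem_of_mem _ (P.mul_mem_right _ _ h))
  · rw [← sub_eq_iff_eq_add'.mpr (HortonAlgebra.genX_mul_genY_self' p q γ i)]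
    exact P.sub_mem (P.mul_mem_left _ _ h) (P.smul_mem_of_mem _ (P.mul_mem_right _ _ h))

/-- If `x_i` and `y_i` do not commute up to a scalar modulo a prime ideal, then the relation
between them has a remainder that can be cancelled. -/
theorem exists_remainder (hpq : ∀ i : Fin n, ∀ m : ℕ, 0 < m → (p i * (q i)⁻¹) ^ m ≠ 1)
    {g : HortonLetter n} {i : Fin n} (hg : g = x i ∨ g = y i)
    (hi : HortonAlgebra.omega p q γ i ∉ P ∨ HortonAlgebra.omega p q γ (i + 1) ∉ P) :
    ∃ (h : HortonLetter n) (α β c : kˣ) (m : ℕ), (∀ g', IsOpposite g' h → g' = g) ∧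
      val p q γ g * val p q γ h =
        (α : k) • (val p q γ h * val p q γ g) + (c : k) • HortonAlgebra.omega p q γ m ∧
      CommuteUpTo β (val p q γ g) (HortonAlgebra.omega p q γ m) ∧
      HortonAlgebra.omega p q γ m ∉ P ∧ ∀ r : ℕ, 0 < r → α ^ r ≠ β ^ r := by
  have hne : ∀ r : ℕ, 0 < r → q i ^ r ≠ p i ^ r := fun r hr h ↦
    hpq i r hr (by rw [mul_pow, inv_pow, h, mul_inv_cancel])
  have hxo := HortonAlgebra.genX_mul_omega p q hγ i
  have hoy := fun m ↦ (HortonAlgebra.omega_mul_genY p q hγ i m).symm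
  have h1 := HortonAlgebra.genX_mul_genY_self p q γ i
  have h2 := HortonAlgebra.genX_mul_genY_self' p q γ i
  -- The relation solved for y_i x_i, which serves the case g = y_i.
  have hinv : ∀ {c : kˣ} {w : HortonAlgebra p q γ}, HortonAlgebra.genX p q γ i *
      HortonAlgebra.genY p q γ i = (c : k) •
        (HortonAlgebra.genY p q γ i * HortonAlgebra.genX p q γ i) + w →
      HortonAlgebra.genY p q γ i * HortonAlgebra.genX p q γ i = ((c⁻¹ : kˣ) : k) •
        (HortonAlgebra.genX p q γ i * HortonAlgebra.genY p q γ i) + ((-c⁻¹ : kˣ) : k) • w := by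
    intro c w h
    rw [h, smul_add, smul_smul, Units.inv_mul, one_smul, Units.val_neg]
    module
  have hox : ∀ g' : HortonLetter n, IsOpposite g' (x i) → g' = y i := by
    intro g' h; cases g' <;> simp_all [IsOpposite]
  have hoy' : ∀ g' : HortonLetter n, IsOpposite g' (y i) → g' = x i := by
    intro g' h; cases g' <;> simp_all [IsOpposite]
  have hinv' : ∀ r : ℕ, 0 < r → (q i)⁻¹ ^ r ≠ (p i)⁻¹ ^ r := fun r hr h ↦
    hne r hr (by rwa [inv_pow, inv_pow, inv_inj] at h)
  -- With remainder Ω_i the scalars (α, β) for x_i are (q_i, p_i); with Ω_{i+1} they are exchanged.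
  -- For y_i they are inverted.
  rcases hi with hi | hi
  · rcases hg with rfl | rfl
    · refine ⟨y i, q i, p i, 1, i, hoy', by rw [Units.val_one, one_smul]; exact h1, ?_, hi, hne⟩
      have := hxo i
      rwa [if_neg (lt_irrefl _)] at this
    · refine ⟨x i, (q i)⁻¹, (p i)⁻¹, -(q i)⁻¹, i, hox, hinv h1, ?_, hi, hinv'⟩
      have := hoy i
      rwa [if_neg (lt_irrefl _)] at this
  · rcases hg with rfl | rfl
    · refine ⟨y i, p i, q i, 1, i + 1, hoy', by rw [Units.val_one, one_smul]; exact h2, ?_, hi,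
        fun r hr ↦ (hne r hr).symm⟩
      have := hxo (i + 1)
      rwa [if_pos (Nat.lt_succ_self _)] at this
    · refine ⟨x i, (p i)⁻¹, (q i)⁻¹, -(p i)⁻¹, i + 1, hox, hinv h2, ?_, hi,
        fun r hr ↦ (hinv' r hr).symm⟩
      have := hoy (i + 1)
      rwa [if_pos (Nat.lt_succ_self _)] at this

/-- A reduced monomial in letters outside of a prime ideal does not lie in the ideal. -/
theorem prodVal_notMem (hpq : ∀ i : Fin n, ∀ m : ℕ, 0 < m → (p i * (q i)⁻¹) ^ m ≠ 1)
    (hP : P.IsPrimeIdeal) {l : List (HortonLetter n)} (hl : ReducedMod P l) :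
    prodVal p q γ l ∉ P := by
  induction hN : l.length using Nat.strong_induction_on generalizing l with
  | _ N ih =>
  intro hmem
  rcases l with _ | ⟨g, l⟩
  · exact hP.one_notMem (by simpa [prodVal] using hmem)
  have hg : val p q γ g ∉ P := hl.2 g (by simp)
  have hl' : ReducedMod P l := hl.mono (Multiset.le_cons_self l g)
  have hrest : prodVal p q γ l ∉ P := ih l.length (by rw [← hN]; simp) hl' rfl
  rw [prodVal_cons] at hmem
  have main : ∀ i : Fin n, (g = x i ∨ g = y i) → False := by
    intro i hgi
    by_cases hi : HortonAlgebra.omega p q γ i ∈ P ∧ HortonAlgebra.omega p q γ (i + 1) ∈ P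
    · rcases hgi with rfl | rfl
      · exact (genX_mem_or_mem hγ hP hi.1 hmem).elim hg hrest
      · exact (genY_mem_or_mem hγ hP hi.1 hmem).elim hg hrest
    obtain ⟨h, α, β, c, m, hopp, hgh, hgw, hw, hαβ⟩ := exists_remainder hγ hpq hgi (not_and_or.mp hi)
    -- move all the letters `g` to the front
    set r := l.count g with hr
    set l' := l.filter (fun a ↦ !a == g) with hl'def
    have hperm : l.Perm (List.replicate r g ++ l') := by
      have := List.filter_append_perm (· == g) l
      rw [List.filter_beq] at this
      exact this.symm
    obtain ⟨d, hd⟩ := prodVal_perm p q hγ hperm hl'.1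
    rw [prodVal_append, prodVal_replicate] at hd
    rw [hd, mul_smul_comm, P.smul_mem_iff_of_ne_zero d.ne_zero, ← mul_assoc, ← pow_succ'] at hmem
    rw [hd, P.smul_mem_iff_of_ne_zero d.ne_zero] at hrest
    -- The only letter opposite to `h` is `g`, and `l'` contains no `g`. So g^{r+1} h l' and h
    -- g^{r+1} l' both lie in P.
    have hh := commuteUpTo_prodVal p q hγ (g := h) (l := l') fun g' hg' H ↦ by
      have := hopp g' H.symm
      simp [hl'def, this] at hg'
    have key := congrArg (· * prodVal p q γ l')
      (smul_pow_mul_sub hgh (hgw.smul_right (c : k)) r)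
    simp only [smul_mul_assoc, sub_mul, mul_assoc, smul_smul] at key
    have hmem' : val p q γ g ^ (r + 1) * (val p q γ h * prodVal p q γ l') ∈ P := by
      rw [hh, mul_smul_comm, ← mul_assoc]
      exact P.smul_mem_of_mem _ (P.mul_mem_right _ _ hmem)
    -- The combination of these two elements that removes h g^{r+1} l' leaves a nonzero multiple of
    -- Ω g^r l'. Cancelling Ω puts g^r l', hence the shorter word `l`, in P.
    have hkey := P.smul_mem_of_mem ((α : k) - β) (P.sub_mem hmem'
      (P.smul_mem_of_mem ((α : k) ^ (r + 1)) (P.mul_mem_left (val p q γ h) _ hmem)))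
    rw [key, P.smul_mem_iff_of_ne_zero] at hkey
    · exact (omega_mem_or_mem hγ hP hkey).elim hw hrest
    · rw [← sub_mul]
      refine mul_ne_zero (sub_ne_zero.mpr fun h ↦ hαβ (r + 1) (Nat.succ_pos r) ?_) c.ne_zero
      exact Units.ext (by simpa using h)
  cases g with
  | x i => exact main i (Or.inl rfl)
  | y i => exact main i (Or.inr rfl)
  | omega i => exact (omega_mem_or_mem hγ hP hmem).elim hg hrest

end HortonLetter

/-! ### Invariant prime ideals are determined by the letters in them -/

namespace HortonLetter

variable {k : Type*} [Field k] {n : ℕ} {p q : Fin n → kˣ} {γ : Fin n → Fin n → kˣ}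

theorem monomialWeight_cons (h : HortonAlgebra.Torus k n) (g : HortonLetter n)
    (m : Multiset (HortonLetter n)) :
    monomialWeight h (g ::ₘ m) = weight h g * monomialWeight h m := by
  simp [monomialWeight]

theorem monomialWeight_mulSingle (t : kˣ) (i : Fin n) (m : Multiset (HortonLetter n)) :
    monomialWeight (Pi.mulSingle i t, 1) m = t ^ ((m.count (x i) : ℤ) - m.count (y i)) := by
  induction m using Multiset.induction with
  | empty => simp [monomialWeight]
  | cons g m ih =>
    rw [monomialWeight_cons, ih, Multiset.count_cons, Multiset.count_cons]
    cases g with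
    | x j =>
      by_cases hij : i = j
      · subst hij
        simp [weight, ← zpow_one_add]
        ring_nf
      · simp [weight, hij]
    | y j =>
      by_cases hij : i = j
      · subst hij
        have hw : weight (Pi.mulSingle i t, 1) (y i) = t ^ (-1 : ℤ) := by simp [weight]
        rw [hw, ← zpow_add]
        simp
        ring_nf
      · simp [weight, hij]
    | omega j => simp [weight]

/-- The coordinate c counts each y_i and each Ω_i once and no x_i. When the y_i are known, it
determines the number of Ω's. -/
theorem monomialWeight_one_snd (t : kˣ) (m : Multiset (HortonLetter n)) :
    monomialWeight (1, t) m =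
      t ^ (∑ i : Fin n, m.count (y i) + ∑ i : Fin n, m.count (omega i)) := by
  induction m using Multiset.induction with
  | empty => simp [monomialWeight]
  | cons g m ih =>
    rw [monomialWeight_cons, ih]
    cases g <;> simp [weight, Multiset.count_cons, Finset.sum_add_distrib, ← pow_succ'] <;>
      (congr 1 <;> ring)

theorem commScalar_cons (g h : HortonLetter n) (m : Multiset (HortonLetter n)) :
    commScalar p q γ g (h ::ₘ m) = comm p q γ g h * commScalar p q γ g m := by
  simp [commScalar]

/-- Isolates the contribution of the Ω_i: q_j for those with i ≥ j and p_j for the others. Monomials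
with the same x's and y's differ only in this factor. -/
theorem commScalar_x (j : Fin n) (m : Multiset (HortonLetter n)) :
    commScalar p q γ (x j) m = commScalar p q γ (x j) (m.filter fun g ↦ ¬∃ i, g = omega i) *
      (q j ^ (∑ i ∈ Finset.Ici j, m.count (omega i)) *
        p j ^ (∑ i ∈ Finset.Iio j, m.count (omega i))) := by
  induction m using Multiset.induction with
  | empty => simp
  | cons g m ih =>
    rw [commScalar_cons, ih]
    cases g with
    | x i => simp [commScalar_cons, mul_assoc]
    | y i => simp [commScalar_cons, mul_assoc]
    | omega i =>
      simp only [Multiset.count_cons, omega.injEq, Finset.sum_add_distrib]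
      simp only [comm, Finset.sum_ite_eq', Finset.mem_Ici, Finset.mem_Iio]
      rw [Multiset.filter_cons_of_neg _ (by simp)]
      by_cases h : j ≤ i
      · simp only [h, not_lt.mpr h, if_true, if_false, add_zero, pow_succ]
        exact Units.ext (by push_cast; ring)
      · simp only [h, not_le.mp h, if_true, if_false, add_zero, pow_succ]
        exact Units.ext (by push_cast; ring)

theorem commScalar_y (j : Fin n) (m : Multiset (HortonLetter n)) :
    commScalar p q γ (y j) m = commScalar p q γ (y j) (m.filter fun g ↦ ¬∃ i, g = omega i) *
      (q j ^ (∑ i ∈ Finset.Ici j, m.count (omega i)) *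
        p j ^ (∑ i ∈ Finset.Iio j, m.count (omega i)))⁻¹ := by
  induction m using Multiset.induction with
  | empty => simp
  | cons g m ih =>
    rw [commScalar_cons, ih]
    cases g with
    | x i => simp [commScalar_cons, mul_assoc]
    | y i => simp [commScalar_cons, mul_assoc]
    | omega i =>
      simp only [Multiset.count_cons, omega.injEq, Finset.sum_add_distrib]
      simp only [comm, Finset.sum_ite_eq', Finset.mem_Ici, Finset.mem_Iio]
      rw [Multiset.filter_cons_of_neg _ (by simp)]
      by_cases h : j ≤ i
      · simp only [h, not_lt.mpr h, if_true, if_false, add_zero, pow_succ]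
        exact Units.ext (by push_cast; field_simp)
      · simp only [h, not_le.mp h, if_true, if_false, add_zero, pow_succ]
        exact Units.ext (by push_cast; field_simp)

/-- Two reduced multisets that the torus does not separate contain the same letters `x_i` and
`y_i`, and the same number of letters `Ω_i`. -/
theorem count_eq_of_monomialWeight_eq {t : kˣ} (ht : ∀ m : ℕ, 0 < m → t ^ m ≠ 1)
    {m m' : Multiset (HortonLetter n)} (hm : Reduced m) (hm' : Reduced m')
    (h : ∀ u : HortonAlgebra.Torus k n, monomialWeight u m = monomialWeight u m') :
    (∀ i, m.count (x i) = m'.count (x i)) ∧ (∀ i, m.count (y i) = m'.count (y i)) ∧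
      ∑ i : Fin n, m.count (omega i) = ∑ i : Fin n, m'.count (omega i) := by
  have hinj : Function.Injective fun a : ℤ ↦ t ^ a := by
    rw [injective_zpow_iff_not_isOfFinOrder, isOfFinOrder_iff_pow_eq_one]
    rintro ⟨m, hm0, hm1⟩
    exact ht m hm0 hm1
  -- In a reduced monomial one of the two exponents vanishes, so their difference, which is the
  -- torus weight, determines both.
  have hred : ∀ {m : Multiset (HortonLetter n)}, Reduced m → ∀ i,
      m.count (x i) = 0 ∨ m.count (y i) = 0 := by
    intro m hm i
    by_contra hc
    push Not at hc
    exact hm (x i) (Multiset.count_ne_zero.mp hc.1) (y i) (Multiset.count_ne_zero.mp hc.2) rfl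
  have h1 : ∀ i, (m.count (x i) : ℤ) - m.count (y i) = m'.count (x i) - m'.count (y i) := by
    intro i
    have := h (Pi.mulSingle i t, 1)
    rw [monomialWeight_mulSingle, monomialWeight_mulSingle] at this
    exact hinj this
  have hx : ∀ i, m.count (x i) = m'.count (x i) := fun i ↦ by
    have := h1 i; have := hred hm i; have := hred hm' i; omega
  have hy : ∀ i, m.count (y i) = m'.count (y i) := fun i ↦ by
    have := h1 i; have := hred hm i; have := hred hm' i; omega
  refine ⟨hx, hy, ?_⟩
  have := h (1, t)
  rw [monomialWeight_one_snd, monomialWeight_one_snd, ← zpow_natCast, ← zpow_natCast] at this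
  have := hinj this
  simp only [hy] at this
  omega

/-- Two different reduced multisets that the torus does not separate are separated by commutation
with a letter `x_j` or `y_j`. -/
theorem exists_commScalar_ne (hpq : ∀ i : Fin n, ∀ m : ℕ, 0 < m → (p i * (q i)⁻¹) ^ m ≠ 1)
    {m m' : Multiset (HortonLetter n)} (hne : m ≠ m')
    (hx : ∀ i, m.count (x i) = m'.count (x i)) (hy : ∀ i, m.count (y i) = m'.count (y i))
    (ho : ∑ i : Fin n, m.count (omega i) = ∑ i : Fin n, m'.count (omega i)) :
    ∃ j, (omega j ∈ m ∨ omega j ∈ m') ∧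
      commScalar p q γ (x j) m ≠ commScalar p q γ (x j) m' ∧
      commScalar p q γ (y j) m ≠ commScalar p q γ (y j) m' := by
  have hfilter : (m.filter fun g ↦ ¬∃ i, g = omega i) = m'.filter fun g ↦ ¬∃ i, g = omega i := by
    ext g
    rw [Multiset.count_filter, Multiset.count_filter]
    cases g <;> simp [hx, hy]
  have hex : (Finset.univ.filter fun i ↦ m.count (omega i) ≠ m'.count (omega i)).Nonempty := by
    by_contra hc
    rw [Finset.not_nonempty_iff_eq_empty, Finset.filter_eq_empty_iff] at hc
    apply hne
    ext g
    cases g with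
    | x i => exact hx i
    | y i => exact hy i
    | omega i => simpa using hc (Finset.mem_univ i)
  -- At the largest index j where the exponents of Ω differ, the totals over i ≥ j differ as well,
  -- while the overall totals agree.
  obtain ⟨j, hj, hmax⟩ := Finset.exists_max_image _ id hex
  simp only [Finset.mem_filter, Finset.mem_univ, true_and, id] at hj hmax
  set S := ∑ i ∈ Finset.Ici j, m.count (omega i) with hS
  set S' := ∑ i ∈ Finset.Ici j, m'.count (omega i) with hS'
  set L := ∑ i ∈ Finset.Iio j, m.count (omega i) with hL
  set L' := ∑ i ∈ Finset.Iio j, m'.count (omega i) with hL'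
  have hSne : S ≠ S' := by
    rw [hS, hS', ← Finset.Ioi_insert, Finset.sum_insert (by simp), Finset.sum_insert (by simp),
      Finset.sum_congr rfl fun i hi ↦ ?_]
    · exact fun h ↦ hj (Nat.add_right_cancel h)
    · by_contra hc
      exact absurd (hmax i hc) (not_le.mpr (Finset.mem_Ioi.mp hi))
  have hsum : S + L = S' + L' := by
    have hd : ∀ f : Fin n → ℕ, ∑ i ∈ Finset.Ici j, f i + ∑ i ∈ Finset.Iio j, f i = ∑ i, f i := by
      intro f
      rw [← Finset.sum_union (by
        rw [Finset.disjoint_left]; intro i hi hi'; simp at hi hi'; omega)]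
      congr 1
      ext i
      simp [le_or_gt]
    rw [hS, hL, hS', hL', hd, hd, ho]
  -- With equal total degree, the two scalars differ by a nonzero power of p_j/q_j.
  have hpow : ∀ {a b c d : ℕ}, a < c → a + b = c + d →
      q j ^ a * p j ^ b ≠ q j ^ c * p j ^ d := by
    intro a b c d hac hs h
    obtain ⟨e, rfl⟩ := Nat.exists_eq_add_of_lt hac
    obtain rfl : b = e + 1 + d := by omega
    apply hpq j (e + 1) (Nat.succ_pos e)
    rw [add_assoc a, pow_add (q j) a, pow_add (p j) _ d, mul_assoc, mul_left_cancel_iff,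
      mul_right_cancel_iff] at h
    rw [mul_pow, inv_pow, h, mul_inv_cancel]
  have hne' : q j ^ S * p j ^ L ≠ q j ^ S' * p j ^ L' := by
    rcases lt_or_gt_of_ne hSne with h | h
    · exact hpow h hsum
    · exact (hpow h hsum.symm).symm
  refine ⟨j, ?_, ?_, ?_⟩
  · by_contra hc
    push Not at hc
    exact hj (by rw [Multiset.count_eq_zero.mpr hc.1, Multiset.count_eq_zero.mpr hc.2])
  · rw [commScalar_x, commScalar_x j m', hfilter]
    exact fun h ↦ hne' (mul_left_cancel h)
  · rw [commScalar_y, commScalar_y j m', hfilter]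
    exact fun h ↦ hne' (inv_injective (mul_left_cancel h))

end HortonLetter

/-! ### Independence modulo an invariant prime -/

namespace HortonLetter

variable {k : Type*} [Field k] {n : ℕ} {p q : Fin n → kˣ} {γ : Fin n → Fin n → kˣ}
  {P : TwoSidedIdeal (HortonAlgebra p q γ)}

/-- The reduced monomials in the letters outside of an invariant prime ideal are linearly
independent modulo the ideal. -/
theorem eq_zero_of_sum_mem (hn : n ≠ 0) (hγ : ∀ i j, γ i j * γ j i = 1)
    (hpq : ∀ i : Fin n, ∀ m : ℕ, 0 < m → (p i * (q i)⁻¹) ^ m ≠ 1) (hP : P.IsPrimeIdeal)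
    (hH : ∀ h, ∀ a ∈ P, HortonAlgebra.torusAction p q γ h a ∈ P)
    {s : Finset (Multiset (HortonLetter n))} (hs : ∀ m ∈ s, ReducedMod P m)
    {c : Multiset (HortonLetter n) → k} (hc : ∑ m ∈ s, c m • monomial p q γ m ∈ P) :
    ∀ m ∈ s, c m = 0 := by
  induction hN : s.card using Nat.strong_induction_on generalizing s c with
  | _ N ih =>
  -- it suffices to show that one coefficient vanishes
  have reduce : ∀ m₁ ∈ s, c m₁ = 0 → ∀ m ∈ s, c m = 0 := by
    intro m₁ hm₁ h0 m hm
    rw [← Finset.add_sum_erase _ _ hm₁, h0, zero_smul, zero_add] at hc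
    have := ih (s.erase m₁).card (by rw [← hN]; exact Finset.card_erase_lt_of_mem hm₁)
      (fun m hm ↦ hs m (Finset.mem_of_mem_erase hm)) hc rfl
    by_cases hmm : m = m₁
    · rw [hmm, h0]
    · exact this m (Finset.mem_erase.mpr ⟨hmm, hm⟩)
  by_cases hsep : ∃ m₀ ∈ s, ∃ m₁ ∈ s, ∃ u : HortonAlgebra.Torus k n,
      monomialWeight u m₀ ≠ monomialWeight u m₁
  · obtain ⟨m₀, hm₀, m₁, hm₁, u, hu⟩ := hsep
    refine reduce m₁ hm₁ ?_
    -- Applying u and subtracting the weight of m₀ times the relation removes the term m₀ but keeps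
    -- m₁.
    have h1 := P.sub_mem (hH u _ hc) (P.smul_mem_of_mem (monomialWeight u m₀ : k) hc)
    rw [map_sum, Finset.smul_sum, ← Finset.sum_sub_distrib] at h1
    have h2 : ∀ m ∈ s, HortonAlgebra.torusAction p q γ u (c m • monomial p q γ m) -
        (monomialWeight u m₀ : k) • c m • monomial p q γ m =
          ((monomialWeight u m - monomialWeight u m₀ : k) * c m) • monomial p q γ m := by
      intro m _
      rw [map_smul, torusAction_monomial]
      module
    rw [Finset.sum_congr rfl h2, ← Finset.add_sum_erase _ _ hm₀, sub_self, zero_mul, zero_smul,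
      zero_add] at h1
    have h3 := ih (s.erase m₀).card (by rw [← hN]; exact Finset.card_erase_lt_of_mem hm₀)
      (fun m hm ↦ hs m (Finset.mem_of_mem_erase hm)) h1 rfl m₁
      (Finset.mem_erase.mpr ⟨fun h ↦ hu (by rw [h]), hm₁⟩)
    exact (mul_eq_zero.mp h3).resolve_left
      (sub_ne_zero.mpr fun h ↦ hu (Units.ext h.symm))
  push Not at hsep
  intro m₀ hm₀
  by_cases hex : ∃ m₁ ∈ s, m₀ ≠ m₁
  · obtain ⟨m₁, hm₁, hne⟩ := hex
    -- As n ≠ 0, the scalar p_0 q_0⁻¹ is available as an element of infinite order, with which torus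
    -- weights determine integer exponents.
    have hcount := fun m (hm : m ∈ s) ↦ count_eq_of_monomialWeight_eq (hpq ⟨0, Nat.pos_of_ne_zero hn⟩)
      (hs m₀ hm₀).1 (hs m hm).1 (hsep m₀ hm₀ m hm)
    obtain ⟨hx, hy, ho⟩ := hcount m₁ hm₁
    obtain ⟨j, hj, hjx, hjy⟩ := exists_commScalar_ne hpq hne hx hy ho
    have hjP : HortonAlgebra.omega p q γ (j + 1) ∉ P := by
      rcases hj with hj | hj
      exacts [(hs m₀ hm₀).2 _ hj, (hs m₁ hm₁).2 _ hj]
    -- All monomials of the relation have the same exponent of y_j. If it is nonzero, none contains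
    -- x_j and y_j is chosen; otherwise x_j is. Thus g is opposite to no letter that occurs.
    obtain ⟨g, hgopp, hgP, hg⟩ : ∃ g, (∀ m ∈ s, ∀ h ∈ m, ¬IsOpposite g h) ∧ val p q γ g ∉ P ∧
        commScalar p q γ g m₀ ≠ commScalar p q γ g m₁ := by
      by_cases hyj : y j ∈ m₀
      · refine ⟨y j, fun m hm h hh H ↦ ?_, fun h ↦ hjP (omega_mem_of_genY_mem h).2, hjy⟩
        refine (hs m hm).1 (y j) ?_ h hh H
        rw [← Multiset.count_ne_zero] at hyj ⊢
        rwa [← (hcount m hm).2.1]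
      · refine ⟨x j, fun m hm h hh H ↦ ?_, fun h ↦ hjP (omega_mem_of_genX_mem h).2, hjx⟩
        obtain rfl : h = y j := by cases h <;> simp_all [IsOpposite]
        apply hyj
        rw [← Multiset.count_ne_zero] at hh ⊢
        rwa [(hcount m hm).2.1]
    refine reduce m₁ hm₁ ?_ m₀ hm₀
    have hcons : ∀ m ∈ s, ReducedMod P (g ::ₘ m) := fun m hm ↦
      ⟨reduced_cons (hs m hm).1 (hgopp m hm), fun h hh ↦ by
        rcases Multiset.mem_cons.mp hh with rfl | hh
        exacts [hgP, (hs m hm).2 _ hh]⟩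
    have hd : ∀ m : Multiset (HortonLetter n), ∃ d : kˣ, m ∈ s →
        monomial p q γ m * val p q γ g = (d : k) • monomial p q γ (g ::ₘ m) := by
      intro m
      by_cases hm : m ∈ s
      · obtain ⟨d, hd⟩ := val_mul_monomial p q hγ (hcons m hm).1
        refine ⟨(commScalar p q γ g m)⁻¹ * d, fun _ ↦ ?_⟩
        rw [(commuteUpTo_monomial p q hγ (hgopp m hm)).symm, hd, smul_smul, Units.val_mul]
      · exact ⟨1, fun h ↦ absurd h hm⟩
    choose d hd using hd
    -- The twisted commutator of the relation with g removes m₀, keeps m₁, and replaces each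
    -- remaining m by g m: a shorter relation of the same kind.
    have h1 := P.sub_mem (P.mul_mem_left (val p q γ g) _ hc)
      (P.smul_mem_of_mem (commScalar p q γ g m₀ : k) (P.mul_mem_right _ (val p q γ g) hc))
    rw [Finset.mul_sum, Finset.sum_mul, Finset.smul_sum, ← Finset.sum_sub_distrib] at h1
    have h2 : ∀ m ∈ s, val p q γ g * c m • monomial p q γ m - (commScalar p q γ g m₀ : k) •
        (c m • monomial p q γ m * val p q γ g) =
          ((commScalar p q γ g m - commScalar p q γ g m₀ : k) * d m * c m) •
            monomial p q γ (g ::ₘ m) := by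
      intro m hm
      rw [mul_smul_comm, smul_mul_assoc, commuteUpTo_monomial p q hγ (hgopp m hm), hd m hm]
      module
    rw [Finset.sum_congr rfl h2, ← Finset.add_sum_erase _ _ hm₀, sub_self, zero_mul, zero_mul,
      zero_smul, zero_add] at h1
    have hinj : Function.Injective fun m : Multiset (HortonLetter n) ↦ g ::ₘ m := fun _ _ h ↦
      (Multiset.cons_inj_right g).mp h
    have h3 := ih ((s.erase m₀).image fun m ↦ g ::ₘ m).card
      (by rw [← hN, Finset.card_image_of_injective _ hinj]; exact Finset.card_erase_lt_of_mem hm₀)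
      (s := (s.erase m₀).image fun m ↦ g ::ₘ m)
      -- The coefficients are reindexed by m' = g ::ₘ m, so m is recovered by erasing g.
      (c := fun m' ↦ (commScalar p q γ g (m'.erase g) - commScalar p q γ g m₀ : k) *
        d (m'.erase g) * c (m'.erase g))
      (fun m' hm' ↦ by
        obtain ⟨m, hm, rfl⟩ := Finset.mem_image.mp hm'
        exact hcons m (Finset.mem_of_mem_erase hm))
      (by
        rw [Finset.sum_image hinj.injOn]
        simpa only [Multiset.erase_cons_head] using h1) rfl
      (g ::ₘ m₁) (Finset.mem_image_of_mem _ (Finset.mem_erase.mpr ⟨hne.symm, hm₁⟩))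
    rw [Multiset.erase_cons_head] at h3
    exact (mul_eq_zero.mp h3).resolve_left (mul_ne_zero
      (sub_ne_zero.mpr fun h ↦ hg (Units.ext h.symm)) (d m₁).ne_zero)
  · push Not at hex
    obtain rfl : s = {m₀} := by
      ext m; rw [Finset.mem_singleton]
      exact ⟨fun h ↦ (hex m h).symm, fun h ↦ h ▸ hm₀⟩
    rw [Finset.sum_singleton] at hc
    by_contra h0
    rw [P.smul_mem_iff_of_ne_zero h0] at hc
    exact prodVal_notMem hγ hpq hP (by rw [Multiset.coe_toList]; exact hs m₀ hm₀) hc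

/-- An invariant prime ideal is generated by the letters in it. -/
theorem le_of_forall_val_mem (hn : n ≠ 0) (hγ : ∀ i j, γ i j * γ j i = 1)
    (hpq : ∀ i : Fin n, ∀ m : ℕ, 0 < m → (p i * (q i)⁻¹) ^ m ≠ 1) (hP : P.IsPrimeIdeal)
    (hH : ∀ h, ∀ a ∈ P, HortonAlgebra.torusAction p q γ h a ∈ P)
    {P' : TwoSidedIdeal (HortonAlgebra p q γ)} (h : ∀ g, val p q γ g ∈ P → val p q γ g ∈ P') :
    P ≤ P' := by
  set T : Set (HortonAlgebra p q γ) := {a | ∃ g, a = val p q γ g ∧ a ∈ P} with hT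
  set I := TwoSidedIdeal.span T with hI
  have hIP : I ≤ P := TwoSidedIdeal.span_le.mpr fun a ⟨_, _, ha⟩ ↦ ha
  have hIP' : I ≤ P' := TwoSidedIdeal.span_le.mpr fun a ⟨g, hg, ha⟩ ↦ by
    rw [hg] at ha ⊢; exact h g ha
  -- I contains every letter of P. So the monomials that span modulo I are independent modulo P, and
  -- the part of an element of P outside I vanishes.
  have hred : ∀ m, ReducedMod I m → ReducedMod P m := fun m hm ↦
    ⟨hm.1, fun g hg hgP ↦ hm.2 g hg (TwoSidedIdeal.subset_span ⟨g, rfl, hgP⟩)⟩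
  have hne : ∀ i, (q i : k) ≠ p i := fun i hi ↦ hpq i 1 one_pos (by
    rw [pow_one, ← Units.ext hi, mul_inv_cancel])
  intro a ha
  have hmem : a ∈ spanMod I := by rw [spanMod_eq_top hγ hne]; trivial
  obtain ⟨b, hb, s, hs, rfl⟩ := Submodule.mem_sup.mp hmem
  have hbI : b ∈ I := hb
  obtain ⟨l, hl, rfl⟩ := (Finsupp.mem_span_image_iff_linearCombination k).mp hs
  rw [Finsupp.linearCombination_apply, Finsupp.sum] at ha ⊢
  have hsum : ∑ m ∈ l.support, l m • monomial p q γ m ∈ P := by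
    have := P.sub_mem ha (hIP hbI)
    rwa [add_sub_cancel_left] at this
  have hzero := eq_zero_of_sum_mem hn hγ hpq hP hH
    (fun m hm ↦ hred m ((Finsupp.mem_supported k l).mp hl hm)) hsum
  rw [Finset.sum_eq_zero fun m hm ↦ by rw [hzero m hm, zero_smul], add_zero]
  exact hIP' hbI

end HortonLetter

/-! ### Quantum tori, acting on their underlying space -/

namespace QuantumTorus

variable {k ι : Type*} [Field k] [Fintype ι] (M : ι → ι → kˣ)

/-- The bicharacter of `ℤ^ι` with given values on the basis. -/
def bichar (v w : ι → ℤ) : kˣ := ∏ a, ∏ b, M a b ^ (v a * w b)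

theorem bichar_add_left (u v w : ι → ℤ) : bichar M (u + v) w = bichar M u w * bichar M v w := by
  simp only [bichar, Pi.add_apply, add_mul, zpow_add, Finset.prod_mul_distrib]

theorem bichar_add_right (u v w : ι → ℤ) : bichar M u (v + w) = bichar M u v * bichar M u w := by
  simp only [bichar, Pi.add_apply, mul_add, zpow_add, Finset.prod_mul_distrib]

theorem bichar_zero_left (v : ι → ℤ) : bichar M 0 v = 1 := by simp [bichar]

theorem bichar_zero_right (v : ι → ℤ) : bichar M v 0 = 1 := by simp [bichar]

theorem bichar_single [DecidableEq ι] (a b : ι) (r s : ℤ) :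
    bichar M (Pi.single a r) (Pi.single b s) = M a b ^ (r * s) := by
  rw [bichar, Finset.prod_eq_single a, Finset.prod_eq_single b]
  · simp
  · intro b' _ h; simp [Pi.single_eq_of_ne h]
  · simp
  · intro a' _ h; simp [Pi.single_eq_of_ne h]
  · simp

/-- The action of a basis element of the quantum torus on the quantum torus by multiplication. -/
noncomputable def shift (v : ι → ℤ) : Module.End k ((ι → ℤ) →₀ k) :=
  Finsupp.linearCombination k fun w ↦ Finsupp.single (v + w) (bichar M v w : k)

theorem shift_single (v w : ι → ℤ) (c : k) :
    shift M v (Finsupp.single w c) = c • Finsupp.single (v + w) (bichar M v w : k) := by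
  simp [shift]

theorem shift_zero : shift M (0 : ι → ℤ) = 1 := by
  refine Finsupp.lhom_ext fun w c ↦ ?_
  simp [shift_single, bichar_zero_left]

theorem shift_mul_shift (v w : ι → ℤ) :
    shift M v * shift M w = (bichar M v w : k) • shift M (v + w) := by
  refine Finsupp.lhom_ext fun u c ↦ ?_
  simp only [Module.End.mul_apply, LinearMap.smul_apply, shift_single,
    bichar_add_right, bichar_add_left, Finsupp.smul_single, smul_eq_mul, Units.val_mul, add_assoc]
  congr 1
  ring

theorem commuteUpTo_shift [DecidableEq ι] (a b : ι) :
    CommuteUpTo (M a b * (M b a)⁻¹) (shift M (Pi.single a 1)) (shift M (Pi.single b 1)) := by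
  rw [CommuteUpTo, shift_mul_shift, shift_mul_shift, bichar_single, bichar_single, smul_smul,
    add_comm (Pi.single b 1 : ι → ℤ)]
  simp

theorem shift_mul_shift_neg [DecidableEq ι] {a : ι} (h : M a a = 1) :
    shift M (Pi.single a 1) * shift M (Pi.single a (-1)) = 1 := by
  rw [shift_mul_shift, bichar_single, ← Pi.single_add]
  simp [h, shift_zero]

theorem shift_neg_mul_shift [DecidableEq ι] {a : ι} (h : M a a = 1) :
    shift M (Pi.single a (-1)) * shift M (Pi.single a 1) = 1 := by
  rw [shift_mul_shift, bichar_single, ← Pi.single_add]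
  simp [h, shift_zero]

/-- The element of the quantum torus with given coefficients. -/
noncomputable def toEnd : ((ι → ℤ) →₀ k) →ₗ[k] Module.End k ((ι → ℤ) →₀ k) :=
  Finsupp.linearCombination k (shift M)

theorem toEnd_single (v : ι → ℤ) (c : k) : toEnd M (Finsupp.single v c) = c • shift M v := by
  simp [toEnd]

theorem shift_mem_range (v : ι → ℤ) : shift M v ∈ LinearMap.range (toEnd M) :=
  ⟨Finsupp.single v 1, by rw [toEnd_single, one_smul]⟩

theorem one_mem_range : (1 : Module.End k ((ι → ℤ) →₀ k)) ∈ LinearMap.range (toEnd M) := by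
  rw [← shift_zero M]; exact shift_mem_range M 0

theorem mul_mem_range {f g : Module.End k ((ι → ℤ) →₀ k)} (hf : f ∈ LinearMap.range (toEnd M))
    (hg : g ∈ LinearMap.range (toEnd M)) : f * g ∈ LinearMap.range (toEnd M) := by
  obtain ⟨c, rfl⟩ := hf
  obtain ⟨d, rfl⟩ := hg
  induction c using Finsupp.induction_linear with
  | zero => simp
  | add c c' hc hc' => rw [map_add, add_mul]; exact Submodule.add_mem _ hc hc'
  | single v r =>
    induction d using Finsupp.induction_linear with
    | zero => simp
    | add d d' hd hd' => rw [map_add, mul_add]; exact Submodule.add_mem _ hd hd'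
    | single w s =>
      rw [toEnd_single, toEnd_single, smul_mul_smul_comm, shift_mul_shift]
      exact Submodule.smul_mem _ _ (Submodule.smul_mem _ _ (shift_mem_range M _))

theorem toEnd_mul_toEnd (c d : (ι → ℤ) →₀ k) : toEnd M c * toEnd M d =
    ∑ v ∈ c.support, ∑ w ∈ d.support, (c v * d w * bichar M v w) • shift M (v + w) := by
  simp only [toEnd, Finsupp.linearCombination_apply, Finsupp.sum, Finset.sum_mul_sum,
    smul_mul_smul_comm, shift_mul_shift, smul_smul]

/-- Quantum tori are domains. -/
theorem eq_zero_or_eq_zero_of_mul_eq_zero {f g : Module.End k ((ι → ℤ) →₀ k)}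
    (hf : f ∈ LinearMap.range (toEnd M)) (hg : g ∈ LinearMap.range (toEnd M)) (h : f * g = 0) :
    f = 0 ∨ g = 0 := by
  obtain ⟨c, rfl⟩ := hf
  obtain ⟨d, rfl⟩ := hg
  by_contra hc
  push Not at hc
  have hc0 : c.support.Nonempty := Finsupp.support_nonempty_iff.mpr fun h ↦ hc.1 (by rw [h, map_zero])
  have hd0 : d.support.Nonempty := Finsupp.support_nonempty_iff.mpr fun h ↦ hc.2 (by rw [h, map_zero])
  -- ℤ^ι has unique sums: some v + w from the two supports arises only once, so no cancellation
  -- occurs at this coefficient of the product applied to the basis vector at 0.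
  obtain ⟨v, hv, w, hw, huniq⟩ := UniqueSums.uniqueAdd_of_nonempty hc0 hd0
  have h1 := congrArg (fun f ↦ f (Finsupp.single 0 1) (v + w)) h
  simp only [toEnd_mul_toEnd, LinearMap.sum_apply, LinearMap.smul_apply, shift_single,
    bichar_zero_right, Units.val_one, one_smul, add_zero, Finsupp.finsetSum_apply,
    LinearMap.zero_apply, Finsupp.zero_apply, Finsupp.smul_apply] at h1
  rw [Finset.sum_eq_single v, Finset.sum_eq_single w] at h1
  · simp [Finsupp.mem_support_iff.mp hv, Finsupp.mem_support_iff.mp hw] at h1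
  · intro w' hw' hne
    rw [Finsupp.single_eq_of_ne, smul_zero]
    exact fun h ↦ hne (huniq hv hw' h.symm).2
  · intro h'; exact absurd hw h'
  · intro v' hv' hne
    refine Finset.sum_eq_zero fun w' hw' ↦ ?_
    rw [Finsupp.single_eq_of_ne, smul_zero]
    exact fun h ↦ hne (huniq hv' hw' h.symm).1
  · intro h'; exact absurd hv h'

/-- The diagonal automorphism of the quantum torus with given eigenvalues. -/
noncomputable def diag (χ : ι → kˣ) : Module.End k ((ι → ℤ) →₀ k) :=
  Finsupp.linearCombination k fun w ↦ Finsupp.single w ((∏ a, χ a ^ w a : kˣ) : k)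

theorem diag_single (χ : ι → kˣ) (w : ι → ℤ) (c : k) :
    diag χ (Finsupp.single w c) = c • Finsupp.single w ((∏ a, χ a ^ w a : kˣ) : k) := by
  simp [diag]

theorem diag_mul_diag_inv (χ : ι → kˣ) : diag χ * diag χ⁻¹ = 1 := by
  refine Finsupp.lhom_ext fun w c ↦ ?_
  rw [Module.End.mul_apply, diag_single, map_smul, diag_single, Finsupp.smul_single,
    Finsupp.smul_single, smul_eq_mul, smul_eq_mul, ← Units.val_mul, ← Finset.prod_mul_distrib]
  simp

theorem commuteUpTo_diag [DecidableEq ι] (χ : ι → kˣ) (a : ι) :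
    CommuteUpTo (χ a) (diag χ) (shift M (Pi.single a 1)) := by
  refine Finsupp.lhom_ext fun w c ↦ ?_
  have h : ∏ b, χ b ^ (Pi.single a 1 + w : ι → ℤ) b = χ a * ∏ b, χ b ^ w b := by
    simp only [Pi.add_apply, zpow_add, Finset.prod_mul_distrib]
    congr 1
    rw [Finset.prod_eq_single a]
    · simp
    · intro b _ hb; simp [Pi.single_eq_of_ne hb]
    · simp
  simp only [Module.End.mul_apply, LinearMap.smul_apply, shift_single, diag_single, h,
    Finsupp.smul_single, smul_eq_mul, Units.val_mul]
  congr 1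
  ring

end QuantumTorus

theorem CommuteUpTo.of_inverse {k A : Type*} [Field k] [Ring A] [Algebra k A] {c : kˣ} {a b b' : A}
    (h : CommuteUpTo c a b) (h₁ : b * b' = 1) (h₂ : b' * b = 1) : CommuteUpTo c⁻¹ a b' := by
  unfold CommuteUpTo at *
  have h3 : b' * (a * b) * b' = (c : k) • (b' * (b * a) * b') := by
    rw [h, mul_smul_comm, smul_mul_assoc]
  rw [← mul_assoc b' b, h₂, one_mul, mul_assoc, mul_assoc, h₁, mul_one] at h3
  rw [h3, smul_smul, Units.inv_mul, one_smul]

/-! ### Homomorphisms from the Horton algebra -/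

namespace HortonAlgebra

variable {k : Type*} [Field k] {n : ℕ} {p q : Fin n → kˣ} {γ : Fin n → Fin n → kˣ}

theorem sum_Iio_sub {A : Type*} [AddCommGroup A] (f : ℕ → A) (i : Fin n) :
    ∑ l ∈ Finset.Iio i, (f (l + 1) - f l) = f i - f 0 := by
  have := Finset.sum_map (Finset.Iio i) Fin.valEmbedding fun l ↦ f (l + 1) - f l
  rw [Fin.map_valEmbedding_Iio, Nat.Iio_eq_range, Finset.sum_range_sub] at this
  exact this.symm

/-- The data of a homomorphism from the Horton algebra to an algebra that sends `y_i` to a multiple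
of a unit `Y_i`, and `Ω_m` to a multiple of an element `O_m`. -/
structure HomData (p q : Fin n → kˣ) (γ : Fin n → Fin n → kˣ) (A : Type*) [Ring A]
    [Algebra k A] where
  (O : ℕ → A) (Y Y' : Fin n → A) (e : ℕ → k) (η u v : Fin n → k)
  O_zero : O 0 = 0
  Y_mul : ∀ i, Y i * Y' i = 1
  mul_Y : ∀ i, Y' i * Y i = 1
  O_O : ∀ l m, CommuteUpTo (1 : kˣ) (O l) (O m)
  O_Y : ∀ (j : Fin n) m, CommuteUpTo (if (j : ℕ) < m then q j else p j) (O m) (Y j)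
  Y_Y : ∀ i j, CommuteUpTo (γ i j) (Y i) (Y j)
  -- With y_i ↦ η_i Y_i and Y_i x_i represented by u_i O_{i+1} - v_i O_i, these equations make (q_i
  -- - p_i) y_i x_i map to e_{i+1} O_{i+1} - e_i O_i, so that the sums Ω_m telescope.
  u_eq : ∀ i, (q i - p i) * (η i * u i) = e (i + 1)
  v_eq : ∀ i, (q i - p i) * (η i * v i) = e i

namespace HomData

variable {A : Type*} [Ring A] [Algebra k A] (D : HomData p q γ A)

/-- The element `Y_i x_i`. -/
def W (i : Fin n) : A := D.u i • D.O (i + 1) - D.v i • D.O i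

/-- The images of the generators. -/
def genImage : HortonGen n → A
  | .x i => D.Y' i * D.W i
  | .y i => D.η i • D.Y i

theorem W_eq (i : Fin n) : D.W i = D.u i • D.O (i + 1) + (-D.v i) • D.O i := by
  rw [W]; module

/-- For j ≠ i the indices i and i + 1 lie on the same side of the jump at j, so both terms of `W`
have the same scalar. -/
theorem W_Y_of_ne {i j : Fin n} (h : i ≠ j) :
    CommuteUpTo (if i < j then p j else q j) (D.W i) (D.Y j) := by
  rw [W_eq]
  have h1 := D.O_Y j (i + 1)
  have h2 := D.O_Y j i
  have hv := Fin.val_ne_of_ne h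
  rcases lt_or_gt_of_ne h with h | h
  · rw [if_neg (by rw [Fin.lt_def] at h; omega)] at h1 h2
    rw [if_pos h]
    exact (h1.smul_left _).add_left (h2.smul_left _)
  · rw [if_pos (by rw [Fin.lt_def] at h; omega)] at h1 h2
    rw [if_neg (not_lt.mpr h.le)]
    exact (h1.smul_left _).add_left (h2.smul_left _)

theorem W_W (i j : Fin n) : CommuteUpTo (1 : kˣ) (D.W i) (D.W j) := by
  have h : ∀ m, CommuteUpTo (1 : kˣ) (D.W i) (D.O m) := fun m ↦ by
    rw [W_eq]; exact ((D.O_O _ m).smul_left _).add_left ((D.O_O _ m).smul_left _)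
  rw [D.W_eq j]
  exact ((h _).smul_right _).add_right ((h _).smul_right _)

theorem genImage_y_mul_x (i : Fin n) : (q i - p i : k) •
    (D.genImage (.y i) * D.genImage (.x i)) = D.e (i + 1) • D.O (i + 1) - D.e i • D.O i := by
  rw [genImage, genImage, smul_mul_assoc, ← mul_assoc, D.Y_mul, one_mul, W, ← D.u_eq, ← D.v_eq]
  module

/-- O_{i+1} passes Y_i with q_i but O_i passes it with p_i; the discrepancy η_i v_i (q_i - p_i) O_i
is the required remainder. -/
theorem genImage_x_mul_y (i : Fin n) : D.genImage (.x i) * D.genImage (.y i) =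
    (q i : k) • (D.genImage (.y i) * D.genImage (.x i)) + D.e i • D.O i := by
  have h1 := D.O_Y i (i + 1)
  have h2 := D.O_Y i i
  rw [if_pos (Nat.lt_succ_self _)] at h1
  rw [if_neg (lt_irrefl _)] at h2
  unfold CommuteUpTo at h1 h2
  have h3 : ∀ a : A, D.Y' i * (D.Y i * a) = a := fun a ↦ by
    rw [← mul_assoc, D.mul_Y, one_mul]
  have h4 : ∀ a : A, D.Y i * (D.Y' i * a) = a := fun a ↦ by
    rw [← mul_assoc, D.Y_mul, one_mul]
  simp only [genImage, W, mul_smul_comm, smul_mul_assoc, mul_assoc, sub_mul, mul_sub, h1, h2, h3,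
    h4, ← D.v_eq]
  module

theorem Y'_Y (i j : Fin n) : CommuteUpTo (γ j i) (D.Y' i) (D.Y j) := by
  have := ((D.Y_Y j i).of_inverse (D.Y_mul i) (D.mul_Y i)).symm
  rwa [inv_inv] at this

theorem genImage_x_y {i j : Fin n} (h : i ≠ j) :
    CommuteUpTo ((if i < j then p j else q j) * γ j i) (D.genImage (.x i)) (D.genImage (.y j)) := by
  rw [mul_comm]
  exact ((D.Y'_Y i j).mul_left (D.W_Y_of_ne h)).smul_right _

variable (hγ : ∀ i j, γ i j * γ j i = 1)
include hγ

theorem genImage_x_x {i j : Fin n} (h : i < j) :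
    CommuteUpTo (q i * (p j)⁻¹ * γ i j) (D.genImage (.x i)) (D.genImage (.x j)) := by
  have h1 := (D.Y'_Y i j).of_inverse (D.Y_mul j) (D.mul_Y j)
  have h2 := (D.W_Y_of_ne h.ne).of_inverse (D.Y_mul j) (D.mul_Y j)
  have h3 := ((D.W_Y_of_ne h.ne').of_inverse (D.Y_mul i) (D.mul_Y i)).symm
  rw [if_pos h] at h2
  rw [if_neg h.not_gt, inv_inv] at h3
  have e : q i * (p j)⁻¹ * γ i j = (γ j i)⁻¹ * (p j)⁻¹ * (q i * 1) := by
    rw [eq_inv_of_mul_eq_one_left (hγ i j)]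
    ext
    push_cast
    ring
  rw [e]
  exact (h1.mul_left h2).mul_right (h3.mul_left (D.W_W i j))

/-- The homomorphism from the Horton algebra. -/
noncomputable def hom : HortonAlgebra p q γ →ₐ[k] A :=
  RingQuot.liftAlgHom k ⟨FreeAlgebra.lift k D.genImage, by
    intro a b r
    cases r with
    | yy i j =>
      simp only [map_mul, map_smul, FreeAlgebra.lift_ι_apply]
      exact ((D.Y_Y i j).smul_left _).smul_right _
    | xy_lt i j hij =>
      simp only [map_mul, map_smul, FreeAlgebra.lift_ι_apply]
      have := D.genImage_x_y hij.ne
      rwa [if_pos hij] at this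
    | xy_gt i j hij =>
      simp only [map_mul, map_smul, FreeAlgebra.lift_ι_apply]
      have := D.genImage_x_y hij.ne'
      rwa [if_neg hij.not_gt] at this
    | xx i j hij =>
      simp only [map_mul, map_smul, FreeAlgebra.lift_ι_apply]
      have := D.genImage_x_x hγ hij
      rwa [CommuteUpTo, Units.val_mul, Units.val_mul, Units.val_inv_eq_inv_val] at this
    | xy_eq i =>
      simp only [map_mul, map_smul, map_add, map_sum, FreeAlgebra.lift_ι_apply]
      rw [genImage_x_mul_y]
      simp only [genImage_y_mul_x]
      rw [sum_Iio_sub fun m ↦ D.e m • D.O m, D.O_zero, smul_zero, sub_zero]⟩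

theorem hom_gen (g : HortonGen n) : D.hom hγ (gen p q γ g) = D.genImage g := by
  simp only [hom, gen, RingQuot.liftAlgHom_mkAlgHom_apply, FreeAlgebra.lift_ι_apply]

theorem hom_omega {m : ℕ} (hm : m ≤ n) : D.hom hγ (omega p q γ m) = D.e m • D.O m := by
  induction m with
  | zero => rw [omega_zero, map_zero, D.O_zero, smul_zero]
  | succ m ih =>
    rw [omega_succ p q γ ⟨m, hm⟩, map_add, ih (by omega), map_smul, map_mul, hom_gen, hom_gen,
      genImage_y_mul_x]
    simp

end HomData

end HortonAlgebra

/-! ### Existence of invariant prime ideals -/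

namespace LevelType

/-- The list of the first values of a sequence, the last one first. -/
def tower (c : ℕ → LevelType) : ℕ → List LevelType
  | 0 => []
  | m + 1 => c m :: tower c m

theorem length_tower (c : ℕ → LevelType) (m : ℕ) : (tower c m).length = m := by
  induction m with
  | zero => rfl
  | succ m ih => simp [tower, ih]

/-- The previous value of the sequence is `empty`. -/
def OpenBelow (c : ℕ → LevelType) : ℕ → Prop
  | 0 => False
  | m + 1 => c m = empty

theorem head?_tower (c : ℕ → LevelType) (m : ℕ) :
    (tower c m).head? = some empty ↔ OpenBelow c m := by
  cases m <;> simp [tower, OpenBelow]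

theorem admissible_tower {c : ℕ → LevelType} {n : ℕ} : Admissible (tower c n) ↔
    ∀ i < n, (OpenBelow c i → c i = empty ∨ c i = center) ∧ (c i = center → OpenBelow c i) := by
  induction n with
  | zero => simp [tower, Admissible]
  | succ n ih =>
    rw [Nat.forall_lt_succ_right, tower, Admissible, ih]
    refine and_congr_right fun _ ↦ ?_
    have := head?_tower c n
    by_cases h : OpenBelow c n
    · rw [if_pos (this.mpr h)]; simp [h]
    · rw [if_neg (mt this.mp h)]; simp [h]

theorem exists_eq_tower (l : List LevelType) : ∃ c, l = tower c l.length := by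
  induction l with
  | nil => exact ⟨fun _ ↦ empty, rfl⟩
  | cons a l ih =>
    obtain ⟨c, hc⟩ := ih
    refine ⟨fun i ↦ if i = l.length then a else c i, ?_⟩
    have h : ∀ m ≤ l.length, tower (fun i ↦ if i = l.length then a else c i) m = tower c m := by
      intro m hm
      induction m with
      | zero => rfl
      | succ m ih => rw [tower, tower, ih (by omega), if_neg (by omega)]
    rw [List.length_cons, tower, h _ le_rfl, if_pos rfl, ← hc]

theorem listLE_tower {c c' : ℕ → LevelType} {n : ℕ} :
    ListLE (tower c n) (tower c' n) ↔ ∀ i < n, TypeLE (c i) (c' i) := by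
  induction n with
  | zero => simp [tower, ListLE]
  | succ n ih =>
    rw [Nat.forall_lt_succ_right, tower, tower, ListLE, List.forall₂_cons, ← ListLE, ih, and_comm]

end LevelType

/-- The kernel of a homomorphism to an algebra, the image of which consists of elements that are not
zero divisors, is prime. -/
theorem TwoSidedIdeal.isPrimeIdeal_ker {A B : Type*} [Ring A] [Ring B] [Nontrivial B] (f : A →+* B)
    (h : ∀ a b, f a * f b = 0 → f a = 0 ∨ f b = 0) : (TwoSidedIdeal.ker f).IsPrimeIdeal := by
  constructor
  · intro htop
    have : (1 : A) ∈ TwoSidedIdeal.ker f := by rw [htop]; trivial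
    rw [TwoSidedIdeal.mem_ker, map_one] at this
    exact one_ne_zero this
  · intro I J hIJ
    by_contra! hc
    obtain ⟨a, haI, ha⟩ := SetLike.not_le_iff_exists.mp hc.1
    obtain ⟨b, hbJ, hb⟩ := SetLike.not_le_iff_exists.mp hc.2
    rw [TwoSidedIdeal.mem_ker] at ha hb
    have := hIJ a haI b hbJ
    rw [TwoSidedIdeal.mem_ker, map_mul] at this
    exact (h a b this).elim ha hb

namespace HortonAlgebra

open LevelType QuantumTorus

variable {k : Type*} [Field k] {n : ℕ} (p q : Fin n → kˣ) (γ : Fin n → Fin n → kˣ)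

/-- Half of the commutation scalars of the quantum torus with generators `Ω_1, …, Ω_n` and
`y_1, …, y_n`. -/
def scalarMatrix : Fin n ⊕ Fin n → Fin n ⊕ Fin n → kˣ
  | .inl i, .inr j => if j ≤ i then q j else p j
  | .inr i, .inr j => if i < j then γ i j else 1
  | _, _ => 1

/-- The generator `Ω_m` of the quantum torus. -/
noncomputable def torusOmega : ℕ → Module.End k ((Fin n ⊕ Fin n → ℤ) →₀ k)
  | 0 => 0
  | m + 1 => if h : m < n then shift (scalarMatrix p q γ) (Pi.single (.inl ⟨m, h⟩) 1) else 0

theorem torusOmega_succ (i : Fin n) : torusOmega p q γ (i + 1) =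
    shift (scalarMatrix p q γ) (Pi.single (.inl i) 1) := by
  simp [torusOmega]

theorem torusOmega_induction {C : ℕ → Module.End k ((Fin n ⊕ Fin n → ℤ) →₀ k) → Prop}
    (h0 : ∀ m, C m 0)
    (h1 : ∀ i : Fin n, C (i + 1) (shift (scalarMatrix p q γ) (Pi.single (.inl i) 1))) (m : ℕ) :
    C m (torusOmega p q γ m) := by
  cases m with
  | zero => exact h0 0
  | succ m =>
    by_cases h : m < n
    · have := h1 ⟨m, h⟩
      simpa [torusOmega, h] using this
    · simpa [torusOmega, h] using h0 _

theorem torusOmega_apply (m : ℕ) (i : Fin n) :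
    torusOmega p q γ m (Finsupp.single 0 1) (Pi.single (.inl i) 1) =
      if m = i + 1 then 1 else 0 := by
  cases m with
  | zero => simp [torusOmega]
  | succ m =>
    by_cases h : m < n
    · have hs : (Pi.single (.inl ⟨m, h⟩) 1 : Fin n ⊕ Fin n → ℤ) = Pi.single (.inl i) 1 ↔ m = i := by
        refine ⟨fun h' ↦ ?_, fun h' ↦ by subst h'; rfl⟩
        have := congrFun h' (.inl ⟨m, h⟩)
        rw [Pi.single_eq_same, Pi.single_apply] at this
        simpa [Fin.ext_iff] using this
      simp [torusOmega, h, shift_single, bichar_zero_right, Finsupp.single_apply, hs]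
    · have : m ≠ i := fun h' ↦ h (h' ▸ i.2)
      simp [torusOmega, h, this]

section

variable {p q γ}

theorem torusOmega_torusOmega (l m : ℕ) :
    CommuteUpTo (1 : kˣ) (torusOmega p q γ l) (torusOmega p q γ m) := by
  refine torusOmega_induction p q γ (C := fun _ f ↦ CommuteUpTo (1 : kˣ) f _)
    (fun _ ↦ by simp [CommuteUpTo]) (fun i ↦ ?_) l
  refine torusOmega_induction p q γ (C := fun _ f ↦ CommuteUpTo (1 : kˣ) _ f)
    (fun _ ↦ by simp [CommuteUpTo]) (fun j ↦ ?_) m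
  have := commuteUpTo_shift (scalarMatrix p q γ) (.inl i) (.inl j)
  simpa [scalarMatrix] using this

theorem torusOmega_shift (j : Fin n) (m : ℕ) :
    CommuteUpTo (if (j : ℕ) < m then q j else p j) (torusOmega p q γ m)
      (shift (scalarMatrix p q γ) (Pi.single (.inr j) 1)) := by
  refine torusOmega_induction p q γ
    (C := fun m f ↦ CommuteUpTo (if (j : ℕ) < m then q j else p j) f _)
    (fun _ ↦ by simp [CommuteUpTo]) (fun i ↦ ?_) m
  have := commuteUpTo_shift (scalarMatrix p q γ) (.inl i) (.inr j)
  have e : scalarMatrix p q γ (.inl i) (.inr j) * (scalarMatrix p q γ (.inr j) (.inl i))⁻¹ =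
      if (j : ℕ) < i + 1 then q j else p j := by
    have h : j ≤ i ↔ (j : ℕ) < i + 1 := (Nat.lt_succ_iff (m := j) (n := i)).symm
    simp only [scalarMatrix, h, inv_one, mul_one]
  rwa [e] at this

theorem shift_shift (hγ_diag : ∀ i, γ i i = 1) (hγ : ∀ i j, γ i j * γ j i = 1) (i j : Fin n) :
    CommuteUpTo (γ i j) (shift (scalarMatrix p q γ) (Pi.single (.inr i) 1))
      (shift (scalarMatrix p q γ) (Pi.single (.inr j) 1)) := by
  have := commuteUpTo_shift (scalarMatrix p q γ) (.inr i) (.inr j)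
  have e : scalarMatrix p q γ (.inr i) (.inr j) * (scalarMatrix p q γ (.inr j) (.inr i))⁻¹ =
      γ i j := by
    rcases lt_trichotomy i j with h | rfl | h
    · simp [scalarMatrix, h, h.not_gt]
    · simp [scalarMatrix, hγ_diag]
    · simp [scalarMatrix, h, h.not_gt, eq_inv_of_mul_eq_one_left (hγ i j)]
  rwa [e] at this

open Classical in
/-- The homomorphism to a quantum torus, the kernel of which has given types. -/
noncomputable def torusData (hqp : ∀ i, (q i : k) - p i ≠ 0) (hγ_diag : ∀ i, γ i i = 1)
    (hγ : ∀ i j, γ i j * γ j i = 1) {c : ℕ → LevelType} (hc : Admissible (tower c n)) :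
    HomData p q γ (Module.End k ((Fin n ⊕ Fin n → ℤ) →₀ k)) where
  O := torusOmega p q γ
  Y i := shift (scalarMatrix p q γ) (Pi.single (.inr i) 1)
  Y' i := shift (scalarMatrix p q γ) (Pi.single (.inr i) (-1))
  -- Ω_m survives exactly if the level below m is `empty`. For `right`, y_i is killed and x_i can be
  -- sent freely to a unit. For `empty` and `center`, y_i survives and u_i, v_i are forced. For
  -- `left` and `both`, W_i must vanish; there admissibility gives v_i = 0.
  e m := if OpenBelow c m then 1 else 0
  η i := if c i = right ∨ c i = both then 0 else 1
  u i := if c i = right then 1 else if c i = empty then (q i - p i : k)⁻¹ else 0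
  v i := if OpenBelow c i then (q i - p i : k)⁻¹ else 0
  O_zero := rfl
  Y_mul i := shift_mul_shift_neg _ (by simp [scalarMatrix])
  mul_Y i := shift_neg_mul_shift _ (by simp [scalarMatrix])
  O_O := torusOmega_torusOmega
  O_Y := torusOmega_shift
  Y_Y := shift_shift hγ_diag hγ
  u_eq i := by
    have := hqp i
    rw [OpenBelow]
    cases h : c i <;> simp [this]
  v_eq i := by
    have := hqp i
    have h1 := admissible_tower.mp hc i i.2
    by_cases h : OpenBelow c i
    · rcases h1.1 h with h' | h' <;> simp [h, h', this]
    · simp [h]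

section

variable (hqp : ∀ i, (q i : k) - p i ≠ 0) (hγ_diag : ∀ i, γ i i = 1)
  (hγ : ∀ i j, γ i j * γ j i = 1) {c : ℕ → LevelType} (hc : Admissible (tower c n))

theorem hom_torusData_mem_range (a : HortonAlgebra p q γ) :
    (torusData hqp hγ_diag hγ hc).hom hγ a ∈ LinearMap.range (toEnd (scalarMatrix p q γ)) := by
  have hO : ∀ m, torusOmega p q γ m ∈ LinearMap.range (toEnd (scalarMatrix p q γ)) := fun m ↦
    torusOmega_induction p q γ (C := fun _ f ↦ f ∈ LinearMap.range (toEnd (scalarMatrix p q γ)))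
      (fun _ ↦ Submodule.zero_mem _) (fun i ↦ shift_mem_range _ _) m
  induction a using induction_gen with
  | algebraMap c =>
    rw [AlgHom.commutes, Algebra.algebraMap_eq_smul_one]
    exact Submodule.smul_mem _ _ (one_mem_range _)
  | gen g =>
    rw [HomData.hom_gen]
    cases g with
    | x i =>
      refine mul_mem_range _ (shift_mem_range _ _) ?_
      rw [HomData.W_eq]
      have h1 := Submodule.smul_mem _ ((torusData hqp hγ_diag hγ hc).u i) (hO (i + 1))
      have h2 := Submodule.smul_mem _ (-(torusData hqp hγ_diag hγ hc).v i) (hO i)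
      exact Submodule.add_mem _ h1 h2
    | y i => exact Submodule.smul_mem _ _ (shift_mem_range _ _)
  | mul a b ha hb => rw [map_mul]; exact mul_mem_range _ ha hb
  | add a b ha hb => rw [map_add]; exact Submodule.add_mem _ ha hb

/-- A diagonal automorphism implements the action of h on the image, which makes the kernel
invariant. -/
theorem diag_mul_hom_torusData (h : Torus k n) (a : HortonAlgebra p q γ) :
    diag (Sum.elim (fun _ ↦ h.2) fun i ↦ h.2 * (h.1 i)⁻¹) *
      (torusData hqp hγ_diag hγ hc).hom hγ a =
    (torusData hqp hγ_diag hγ hc).hom hγ (torusAction p q γ h a) *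
      diag (Sum.elim (fun _ ↦ h.2) fun i ↦ h.2 * (h.1 i)⁻¹) := by
  set D := torusData hqp hγ_diag hγ hc
  set χ : Fin n ⊕ Fin n → kˣ := Sum.elim (fun _ ↦ h.2) fun i ↦ h.2 * (h.1 i)⁻¹ with hχ
  have hO : ∀ m, CommuteUpTo h.2 (diag χ) (D.O m) := fun m ↦
    torusOmega_induction p q γ (C := fun _ f ↦ CommuteUpTo h.2 (diag χ) f)
      (fun _ ↦ by simp [CommuteUpTo]) (fun i ↦ commuteUpTo_diag _ χ (.inl i)) m
  have hY : ∀ i, CommuteUpTo (h.2 * (h.1 i)⁻¹) (diag χ) (D.Y i) := fun i ↦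
    commuteUpTo_diag _ χ (.inr i)
  have hY' : ∀ i, CommuteUpTo (h.2 * (h.1 i)⁻¹)⁻¹ (diag χ) (D.Y' i) := fun i ↦
    (hY i).of_inverse (D.Y_mul i) (D.mul_Y i)
  have hW : ∀ i, CommuteUpTo h.2 (diag χ) (D.W i) := fun i ↦ by
    rw [D.W_eq]; exact ((hO _).smul_right _).add_right ((hO _).smul_right _)
  induction a using induction_gen with
  | algebraMap c => rw [AlgEquiv.commutes, AlgHom.commutes, Algebra.commutes]
  | gen g =>
    rw [HortonLetter.torusAction_apply, torusEnd_gen, map_smul, HomData.hom_gen, smul_mul_assoc]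
    cases g with
    | x i =>
      have := (hY' i).mul_right (hW i)
      have e : (h.2 * (h.1 i)⁻¹)⁻¹ * h.2 = h.1 i := by
        rw [mul_inv_rev, inv_inv, inv_mul_cancel_right]
      rwa [e] at this
    | y i => exact (hY i).smul_right _
  | mul a b ha hb => rw [map_mul, map_mul, map_mul, ← mul_assoc, ha, mul_assoc, hb, mul_assoc]
  | add a b ha hb => rw [map_add, map_add, map_add, mul_add, add_mul, ha, hb]

theorem hom_torusData_genX_eq_zero (i : Fin n) :
    (torusData hqp hγ_diag hγ hc).hom hγ (genX p q γ i) = 0 ↔ c i = left ∨ c i = both := by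
  set D := torusData hqp hγ_diag hγ hc with hD
  have h1 : D.hom hγ (genX p q γ i) = D.Y' i * D.W i := D.hom_gen hγ (.x i)
  have h2 : D.W i = D.Y i * D.hom hγ (genX p q γ i) := by
    rw [h1, ← mul_assoc, D.Y_mul, one_mul]
  have h3 : D.hom hγ (genX p q γ i) = 0 ↔ D.W i = 0 :=
    ⟨fun h ↦ by rw [h2, h, mul_zero], fun h ↦ by rw [h1, h, mul_zero]⟩
  have hadm := admissible_tower.mp hc i i.2
  have hW : ∀ j, D.W i (Finsupp.single 0 1) (Pi.single (.inl j) 1) =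
      D.u i * (if i = j then 1 else 0) - D.v i * if (i : ℕ) = j + 1 then 1 else 0 := fun j ↦ by
    have h4 := torusOmega_apply p q γ (i + 1) j
    have h5 := torusOmega_apply p q γ i j
    simp only [Nat.add_right_cancel_iff, Fin.val_inj] at h4
    rw [← h4, ← h5]
    rfl
  rw [h3]
  constructor
  · intro h0
    simp only [h0, LinearMap.zero_apply, Finsupp.zero_apply] at hW
    have hu : D.u i = 0 := by simpa using (hW i).symm
    by_contra! hne
    have h6 : c i = center := by
      have := hqp i
      have h' : (if c i = right then 1 else if c i = empty then (q i - p i : k)⁻¹ else 0) = 0 := hu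
      cases h : c i
      · rw [h, if_neg (by decide), if_pos rfl] at h'; exact absurd h' (inv_ne_zero this)
      · rfl
      · exact absurd h hne.1
      · rw [h, if_pos rfl] at h'; exact absurd h' one_ne_zero
      · exact absurd h hne.2
    have h7 := hadm.2 h6
    -- For `center` the term v_i O_i keeps x_i nonzero. It would be missing at level 0, where O_0 =
    -- 0, but admissibility excludes `center` there.
    cases hi : (i : ℕ) with
    | zero => rw [hi] at h7; exact h7
    | succ j =>
      have hv : D.v i = 0 := by simpa [hu, hi] using (hW ⟨j, by omega⟩).symm
      have := hqp i
      simp [hD, torusData, h7, this] at hv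
  · intro h
    have hu : D.u i = 0 := by rcases h with h | h <;> simp [hD, torusData, h]
    have hv : D.v i = 0 := by
      have : ¬OpenBelow c i := fun h' ↦ by have := hadm.1 h'; rcases h with h | h <;> simp [h] at this
      simp [hD, torusData, this]
    rw [D.W_eq, hu, hv, neg_zero, zero_smul, zero_smul, add_zero]

theorem shift_ne_zero (M : Fin n ⊕ Fin n → Fin n ⊕ Fin n → kˣ) (v : Fin n ⊕ Fin n → ℤ) :
    shift M v ≠ 0 := fun h ↦ by
  have := congrArg (fun f ↦ f (Finsupp.single 0 1)) h
  simp [shift_single, bichar_zero_right] at this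

theorem hom_torusData_genY_eq_zero (i : Fin n) :
    (torusData hqp hγ_diag hγ hc).hom hγ (genY p q γ i) = 0 ↔ c i = right ∨ c i = both := by
  have h1 : (torusData hqp hγ_diag hγ hc).hom hγ (genY p q γ i) =
    (torusData hqp hγ_diag hγ hc).genImage (.y i) := HomData.hom_gen _ hγ (.y i)
  rw [h1]
  simp [HomData.genImage, torusData, shift_ne_zero, or_iff_not_imp_left]

theorem hom_torusData_omega_eq_zero (i : Fin n) :
    (torusData hqp hγ_diag hγ hc).hom hγ (omega p q γ (i + 1)) = 0 ↔ c i ≠ empty := by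
  rw [HomData.hom_omega _ hγ i.2]
  by_cases h : c i = empty <;> simp [torusData, torusOmega_succ, shift_ne_zero, OpenBelow, h]

end

theorem exists_invariant_isPrimeIdeal (hqp : ∀ i, (q i : k) - p i ≠ 0) (hγ_diag : ∀ i, γ i i = 1)
    (hγ : ∀ i j, γ i j * γ j i = 1) {c : ℕ → LevelType} (hc : Admissible (tower c n)) :
    ∃ P : TwoSidedIdeal (HortonAlgebra p q γ), P.IsPrimeIdeal ∧
      (∀ h, ∀ a ∈ P, torusAction p q γ h a ∈ P) ∧ ∀ i : Fin n,
        (genX p q γ i ∈ P ↔ c i = left ∨ c i = both) ∧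
        (genY p q γ i ∈ P ↔ c i = right ∨ c i = both) ∧
        (omega p q γ (i + 1) ∈ P ↔ c i ≠ empty) := by
  set φ := (torusData hqp hγ_diag hγ hc).hom hγ with hφ
  have mem_ker : ∀ a, a ∈ TwoSidedIdeal.ker φ.toRingHom ↔ φ a = 0 :=
    fun a ↦ TwoSidedIdeal.mem_ker φ.toRingHom
  refine ⟨TwoSidedIdeal.ker φ.toRingHom, ?_, ?_, fun i ↦ ?_⟩
  · exact TwoSidedIdeal.isPrimeIdeal_ker _ fun a b h ↦ eq_zero_or_eq_zero_of_mul_eq_zero _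
      (hom_torusData_mem_range hqp hγ_diag hγ hc a) (hom_torusData_mem_range hqp hγ_diag hγ hc b) h
  · intro h a ha
    rw [mem_ker] at ha ⊢
    have h1 := diag_mul_hom_torusData hqp hγ_diag hγ hc h a
    rw [← hφ, ha, mul_zero] at h1
    rw [← mul_one (φ _), ← diag_mul_diag_inv (Sum.elim (fun _ ↦ h.2) fun i ↦ h.2 * (h.1 i)⁻¹),
      ← mul_assoc, ← h1, zero_mul]
  · rw [mem_ker, mem_ker, mem_ker]
    exact ⟨hom_torusData_genX_eq_zero hqp hγ_diag hγ hc i,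
      hom_torusData_genY_eq_zero hqp hγ_diag hγ hc i, hom_torusData_omega_eq_zero hqp hγ_diag hγ hc i⟩

end

end HortonAlgebra

/-! ### Types of invariant prime ideals -/

namespace HortonAlgebra

open LevelType

variable {k : Type*} [Field k] {n : ℕ} {p q : Fin n → kˣ} {γ : Fin n → Fin n → kˣ}

open Classical in
/-- The type of a level of an ideal. -/
noncomputable def levelType (P : TwoSidedIdeal (HortonAlgebra p q γ)) (m : ℕ) : LevelType :=
  if h : m < n then
    if genX p q γ ⟨m, h⟩ ∈ P then if genY p q γ ⟨m, h⟩ ∈ P then both else left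
    else if genY p q γ ⟨m, h⟩ ∈ P then right
    else if omega p q γ (m + 1) ∈ P then center else empty
  else empty

variable {P P' : TwoSidedIdeal (HortonAlgebra p q γ)}

theorem genX_mem_iff (i : Fin n) :
    genX p q γ i ∈ P ↔ levelType P i = left ∨ levelType P i = both := by
  simp only [levelType, i.2, dite_true, Fin.eta]
  split_ifs <;> simp_all

theorem genY_mem_iff (i : Fin n) :
    genY p q γ i ∈ P ↔ levelType P i = right ∨ levelType P i = both := by
  simp only [levelType, i.2, dite_true, Fin.eta]
  split_ifs <;> simp_all

theorem omega_mem_iff (i : Fin n) : omega p q γ (i + 1) ∈ P ↔ levelType P i ≠ empty := by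
  have h1 : genX p q γ i ∈ P → omega p q γ (i + 1) ∈ P := fun h ↦
    (HortonLetter.omega_mem_of_genX_mem h).2
  have h2 : genY p q γ i ∈ P → omega p q γ (i + 1) ∈ P := fun h ↦
    (HortonLetter.omega_mem_of_genY_mem h).2
  simp only [levelType, i.2, dite_true, Fin.eta]
  split_ifs <;> simp_all

theorem levelType_eq {c : LevelType} {i : Fin n}
    (hx : genX p q γ i ∈ P ↔ c = left ∨ c = both) (hy : genY p q γ i ∈ P ↔ c = right ∨ c = both)
    (ho : omega p q γ (i + 1) ∈ P ↔ c ≠ empty) : levelType P i = c := by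
  rw [genX_mem_iff] at hx
  rw [genY_mem_iff] at hy
  rw [omega_mem_iff] at ho
  cases h : levelType P i <;> cases c <;> simp_all

/-- This is what fixes the form of `TypeLE`: inclusion of the sets of letters at one level. -/
theorem typeLE_iff (i : Fin n) : TypeLE (levelType P i) (levelType P' i) ↔
    (genX p q γ i ∈ P → genX p q γ i ∈ P') ∧ (genY p q γ i ∈ P → genY p q γ i ∈ P') ∧
      (omega p q γ (i + 1) ∈ P → omega p q γ (i + 1) ∈ P') := by
  rw [genX_mem_iff, genX_mem_iff, genY_mem_iff, genY_mem_iff, omega_mem_iff, omega_mem_iff]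
  cases levelType P i <;> cases levelType P' i <;> simp [TypeLE]

theorem openBelow_levelType_iff {m : ℕ} (hm : m ≤ n) :
    OpenBelow (levelType P) m ↔ omega p q γ m ∉ P := by
  cases m with
  | zero => simp [OpenBelow, omega_zero, P.zero_mem]
  | succ m => rw [OpenBelow, omega_mem_iff (⟨m, hm⟩ : Fin n), not_not]

/-- If Ω_i ∉ P, neither x_i nor y_i is in P. If Ω_i and Ω_{i+1} are in P, then y_i x_i ∈ P with y_i
normal modulo P, so x_i or y_i is in P and `center` cannot occur. -/
theorem admissible_levelType (hγ : ∀ i j, γ i j * γ j i = 1) (hqp : ∀ i, (q i : k) - p i ≠ 0)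
    (hP : P.IsPrimeIdeal) : Admissible (tower (levelType P) n) := by
  refine admissible_tower.mpr fun i hi ↦ ?_
  have hx := genX_mem_iff (P := P) ⟨i, hi⟩
  have hy := genY_mem_iff (P := P) ⟨i, hi⟩
  have ho := omega_mem_iff (P := P) ⟨i, hi⟩
  rw [openBelow_levelType_iff hi.le]
  constructor
  · intro h
    rw [iff_false_left fun h' ↦ h (HortonLetter.omega_mem_of_genX_mem h').1] at hx
    rw [iff_false_left fun h' ↦ h (HortonLetter.omega_mem_of_genY_mem h').1] at hy
    revert hx hy
    cases levelType P i <;> simp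
  · intro hc h
    have h1 : omega p q γ (i + 1) ∈ P := ho.mpr (by simp [hc])
    have h2 : genY p q γ ⟨i, hi⟩ * genX p q γ ⟨i, hi⟩ ∈ P := by
      rw [genY_mul_genX_self (sub_ne_zero.mp (hqp _))]
      exact P.smul_mem_of_mem _ (P.sub_mem h1 h)
    rcases HortonLetter.genY_mem_or_mem hγ hP h h2 with h3 | h3
    · simpa [hc] using hy.mp h3
    · simpa [hc] using hx.mp h3

theorem le_iff_listLE_levelType (hn : n ≠ 0) (hγ : ∀ i j, γ i j * γ j i = 1)
    (hpq : ∀ i : Fin n, ∀ m : ℕ, 0 < m → (p i * (q i)⁻¹) ^ m ≠ 1) (hP : P.IsPrimeIdeal)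
    (hH : ∀ h, ∀ a ∈ P, torusAction p q γ h a ∈ P) :
    P ≤ P' ↔ ListLE (tower (levelType P) n) (tower (levelType P') n) := by
  have key : (∀ i < n, TypeLE (levelType P i) (levelType P' i)) ↔
      ∀ i : Fin n, TypeLE (levelType P i) (levelType P' i) :=
    ⟨fun h i ↦ h i i.2, fun h i hi ↦ h ⟨i, hi⟩⟩
  simp only [listLE_tower, key, typeLE_iff]
  constructor
  · exact fun h i ↦ ⟨fun h' ↦ h h', fun h' ↦ h h', fun h' ↦ h h'⟩
  · intro h
    refine HortonLetter.le_of_forall_val_mem hn hγ hpq hP hH fun g ↦ ?_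
    cases g with
    | x i => exact (h i).1
    | y i => exact (h i).2.1
    | omega i => exact (h i).2.2

theorem exists_levelType_eq (hγ_diag : ∀ i, γ i i = 1) (hγ : ∀ i j, γ i j * γ j i = 1)
    (hqp : ∀ i, (q i : k) - p i ≠ 0) {l : List LevelType} (hl : l.length = n)
    (hadm : Admissible l) : ∃ P : TwoSidedIdeal (HortonAlgebra p q γ), P.IsPrimeIdeal ∧
      (∀ h, ∀ a ∈ P, torusAction p q γ h a ∈ P) ∧ tower (levelType P) n = l := by
  obtain ⟨c, hc⟩ := exists_eq_tower l
  rw [hl] at hc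
  subst hc
  obtain ⟨P, hP, hH, h⟩ := exists_invariant_isPrimeIdeal hqp hγ_diag hγ hadm
  have h' : ∀ i < n, levelType P i = c i := fun i hi ↦
    levelType_eq (i := ⟨i, hi⟩) (h ⟨i, hi⟩).1 (h ⟨i, hi⟩).2.1 (h ⟨i, hi⟩).2.2
  refine ⟨P, hP, hH, ListLE.antisymm (listLE_tower.mpr fun i hi ↦ ?_)
    (listLE_tower.mpr fun i hi ↦ ?_)⟩ <;>
  · rw [h' i hi]; exact TypeLE.refl _

end HortonAlgebra

/-! ### Comparison of the two encodings -/

namespace LevelType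

theorem admissible_replicate_both (n : ℕ) : Admissible (List.replicate n both) := by
  induction n with
  | zero => trivial
  | succ n ih => refine ⟨ih, ?_⟩; cases n <;> simp [List.replicate_succ]

theorem admissible_replicate_empty (n : ℕ) : Admissible (List.replicate n empty) := by
  induction n with
  | zero => trivial
  | succ n ih => refine ⟨ih, ?_⟩; cases n <;> simp [List.replicate_succ]

theorem word_replicate_empty (n : ℕ) : word (List.replicate n empty) = [] := by
  induction n with
  | zero => rfl
  | succ n ih => rw [List.replicate_succ, word, ih]; rfl

theorem listLE_replicate_both {l : List LevelType} {n : ℕ} (h : l.length = n) :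
    ListLE l (List.replicate n both) := by
  subst h
  induction l with
  | nil => exact .nil
  | cons a l ih => exact .cons (le_both a) ih

theorem replicate_empty_listLE {l : List LevelType} {n : ℕ} (h : l.length = n) :
    ListLE (List.replicate n empty) l := by
  subst h
  induction l with
  | nil => exact .nil
  | cons a l ih => exact .cons trivial ih

end LevelType

/-- The elements of the interval `[1, s_n ⋯ s_1 s_0 s_2 ⋯ s_n]` are encoded by the admissible
lists of types. -/
theorem CoxeterSystem.mem_bruhatInterval_hortonWord_iff {n : ℕ} (hn : n ≠ 0) {W : Type*} [Group W]
    (cs : CoxeterSystem (typeD n) W) (w : W) :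
    cs.toBruhat w ∈ cs.bruhatInterval (cs.wordProd (hortonWord n)) ↔
      ∃ l : List LevelType, l.length = n ∧ LevelType.Admissible l ∧ w = cs.typesProd l := by
  rw [cs.wordProd_hortonWord hn]
  constructor
  · rintro ⟨-, h⟩
    obtain ⟨l, hl, hle, rfl⟩ := BruhatLE.exists_typesProd_eq cs (by simp)
      (LevelType.admissible_replicate_both n) h
    exact ⟨l, by simpa using hle.length_eq, hl, rfl⟩
  · rintro ⟨l, hlen, hl, rfl⟩
    have h1 : cs.typesProd (List.replicate n .empty) = 1 := by
      rw [typesProd, LevelType.word_replicate_empty, natWordProd_nil]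
    constructor
    · rw [← h1]
      exact (cs.bruhatLE_typesProd_iff (by simp [hlen]) hlen.le
        (LevelType.admissible_replicate_empty n) hl).mpr (LevelType.replicate_empty_listLE hlen)
    · exact (cs.bruhatLE_typesProd_iff (by simp [hlen]) (by simp) hl
        (LevelType.admissible_replicate_both n)).mpr (LevelType.listLE_replicate_both hlen)

theorem mainTheorem4 {k : Type*} [Field k] (n : ℕ) (hn : 2 ≤ n)
    (p q : Fin n → kˣ) (γ : Fin n → Fin n → kˣ)
    (hpq : ∀ i : Fin n, ∀ m : ℕ, 0 < m → (p i * (q i)⁻¹) ^ m ≠ 1)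
    (hγ_diag : ∀ i : Fin n, γ i i = 1)
    (hγ_anti : ∀ i j : Fin n, γ i j * γ j i = 1)
    {W : Type*} [Group W] (cs : CoxeterSystem (typeD n) W) :
    Nonempty (InvariantPrimeSpectrum (HortonAlgebra.torusAction p q γ) ≃o
      cs.bruhatInterval (cs.wordProd (hortonWord n))) := by
  have hn' : n ≠ 0 := by omega
  have hqp : ∀ i, (q i : k) - p i ≠ 0 := fun i h ↦ hpq i 1 one_pos (by
    rw [pow_one, mul_inv_eq_one]; exact Units.ext (sub_eq_zero.mp h).symm)
  let T (P : InvariantPrimeSpectrum (HortonAlgebra.torusAction p q γ)) : List LevelType :=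
    LevelType.tower (HortonAlgebra.levelType P.1) n
  have hlen : ∀ P, (T P).length = n := fun P ↦ LevelType.length_tower _ _
  have hadm : ∀ P, LevelType.Admissible (T P) := fun P ↦
    HortonAlgebra.admissible_levelType hγ_anti hqp P.2.1
  have hle : ∀ P P', cs.BruhatLE (cs.typesProd (T P)) (cs.typesProd (T P')) ↔ P ≤ P' :=
    fun P P' ↦ (cs.bruhatLE_typesProd_iff ((hlen P).trans (hlen P').symm) (hlen P').le (hadm P)
      (hadm P')).trans
      (HortonAlgebra.le_iff_listLE_levelType hn' hγ_anti hpq P.2.1 P.2.2).symm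
  let F : InvariantPrimeSpectrum (HortonAlgebra.torusAction p q γ) ↪o
      cs.bruhatInterval (cs.wordProd (hortonWord n)) :=
    OrderEmbedding.ofMapLEIff (fun P ↦ ⟨cs.toBruhat (cs.typesProd (T P)),
      (cs.mem_bruhatInterval_hortonWord_iff hn' _).mpr ⟨T P, hlen P, hadm P, rfl⟩⟩) hle
  refine ⟨RelIso.ofSurjective F fun ⟨w, hw⟩ ↦ ?_⟩
  obtain ⟨l, hl, hladm, rfl⟩ := (cs.mem_bruhatInterval_hortonWord_iff hn' w).mp hw
  obtain ⟨P, hP, hH, hPl⟩ := HortonAlgebra.exists_levelType_eq hγ_diag hγ_anti hqp hl hladm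
  exact ⟨⟨P, hP, hH⟩, Subtype.ext (congrArg cs.typesProd hPl)⟩
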